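/- Let $N_1,N_2\ge 0$ be integers and let $R=(R^{\lambda\alpha}_{\beta\mu})$ be complex numbers, where $\lambda,\mu\in\{1,\dots,N_1\}$ and $\alpha,\beta\in\{1,\dots,N_2\}$ (Greek letters $\lambda,\mu,\nu,\rho$ run over $\{1,\dots,N_1\}$, letters $\alpha,\beta,\gamma,\delta$ over $\{1,\dots,N_2\}$, repeated up-down indices are summed, and a bar denotes complex conjugation). Let $\mathcal A_R$ be the complex quadratic algebra with generators $x_1^\lambda$, $x_2^\alpha$ (all of degree $1$) and relations $$x_1^\lambda x_1^\mu=x_1^\mu x_1^\lambda,\quad x_2^\alpha x_2^\beta=x_2^\beta x_2^\alpha,\quad x_1^\lambda x_2^\alpha=R^{\lambda\alpha}_{\beta\mu}x_2^\beta x_1^\mu,\quad x_2^\alpha x_1^\lambda=\overline R^{\lambda\alpha}_{\beta\mu}x_1^\mu x_2^\beta .$$ Assume that $R$ satisfies, for all values of the free indices, (real) $\overline R^{\lambda\alpha}_{\beta\mu}R^{\mu\beta}_{\gamma\nu}=\delta^\lambda_\nu\delta^\alpha_\gamma$; (yb1) $R^{\lambda\alpha}_{\gamma\rho}R^{\rho\beta}_{\delta\mu}=R^{\lambda\beta}_{\delta\rho}R^{\rho\alpha}_{\gamma\mu}$,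 $\ \overline R^{\lambda\alpha}_{\gamma\rho}\overline R^{\rho\beta}_{\delta\mu}=\overline R^{\lambda\beta}_{\delta\rho}\overline R^{\rho\alpha}_{\gamma\mu}$, $\ \overline R^{\lambda\alpha}_{\gamma\rho}R^{\rho\beta}_{\delta\mu}=R^{\lambda\beta}_{\delta\rho}\overline R^{\rho\alpha}_{\gamma\mu}$; (yb2) $R^{\lambda\alpha}_{\gamma\nu}R^{\mu\gamma}_{\beta\rho}=R^{\mu\alpha}_{\gamma\rho}R^{\lambda\gamma}_{\beta\nu}$, $\ \overline R^{\lambda\alpha}_{\gamma\nu}\overline R^{\mu\gamma}_{\beta\rho}=\overline R^{\mu\alpha}_{\gamma\rho}\overline R^{\lambda\gamma}_{\beta\nu}$, $\ R^{\lambda\alpha}_{\gamma\nu}\overline R^{\mu\gamma}_{\beta\rho}=\overline R^{\mu\alpha}_{\gamma\rho}R^{\lambda\gamma}_{\beta\nu}$. For a quadratic algebra $\mathcal A=T(E)/(\mathcal I)$ with $E$ finite-dimensional over $\mathbb C$ and $\mathcal I\subseteq E\otimes E$, write $\mathcal A=\bigoplus_n\mathcal A_n$ for its grading and let $\mathcal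 A^!=T(E^*)/(\mathcal I^\perp)$ be its Koszul dual, where $\mathcal I^\perp\subseteq E^*\otimes E^*=(E\otimes E)^*$ is the annihilator of $\mathcal I$. The Koszul complex of $\mathcal A$ is the complex of free left $\mathcal A$-modules $\mathcal A\otimes W_n$ ($n\ge 0$), where $W_n=(\mathcal A^!_n)^*=\bigcap_{r+2+s=n}E^{\otimes r}\otimes \mathcal I\otimes E^{\otimes s}\subseteq E^{\otimes n}$ (so $W_0=\mathbb C$, $W_1=E$), with differential induced by $a\otimes(v_0\otimes v_1\otimes\dots\otimes v_n)\mapsto av_0\otimes(v_1\otimes\dots\otimes v_n)$. The algebra is Koszul if this complex is acyclic in all degrees $n\ge1$. Let $\mathbb C$ denote the trivial $\mathcal A$-module, on which $E$ acts by $0$. Theorem. The algebra $\mathcal A_R$ has the following properties. 1. $\mathcal A_R$ is Koszul. 2. $\mathcal A_R$ has (left) global dimension $N_1+N_2$, that is, the supremum of the projective dimensions of its left modules is $N_1+N_2$; moreover the trivial left module $\mathbb C$ has projective dimension exactly $N_1+N_2$. 3. $\mathcal A_R$ is Gorenstein: $\mathrm{Ext}^n_{\mathcal A_R}(\mathbb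 C,\mathcal A_R)=0$ for $n\ne N_1+N_2$, and $\mathrm{Ext}^{N_1+N_2}_{\mathcal A_R}(\mathbb C,\mathcal A_R)$ is isomorphic, as a right $\mathcal A_R$-module, to the trivial module $\mathbb C$. 4. $\mathcal A_R$ has polynomial growth: there are $C>0$ and $N\in\mathbb N$ with $\dim_{\mathbb C}(\mathcal A_R)_n\le C\,n^{N-1}$ for all $n\ge1$. Thus $\mathcal A_R$ is a Koszul Artin–Schelter algebra of global dimension $N_1+N_2$. Moreover the Hilbert (Poincaré) series of $\mathcal A_R$ and of its Koszul dual $\mathcal A_R^!$ are $$\sum_{n\ge0}\dim_{\mathbb C}\big((\mathcal A_R)_n\big)\,t^n=\frac1{(1-t)^{N_1+N_2}},\qquad \sum_{n\ge0}\dim_{\mathbb C}\big((\mathcal A_R^!)_n\big)\,t^n=(1+t)^{N_1+N_2}.$$ -/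

import Mathlib

open CategoryTheory TensorProduct

/-! ## Quadratic algebras

A quadratic algebra `A(E, R) = T(E)/(R)` is given by a finite set `ι` indexing a basis
`(x_i)` of the space of generators `E` and by a subspace `R` of `E ⊗ E`. An element
`∑ r_{ij} x_i ⊗ x_j` of `E ⊗ E` is encoded by its coefficient function `r : ι × ι → ℂ`;
in the same way an element of the `n`-th tensor power of `E` is encoded by its coefficient
function `(Fin n → ι) → ℂ`. The dual space `E*` is referred to the dual basis, indexed by
the same `ι`. -/

namespace Quadratic

variable {ι : Type} [Fintype ι]

/-- The element `∑ r_{ij} x_i x_j` of the free algebra `T(E)`. -/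
noncomputable def quadraticElement (r : ι × ι → ℂ) : FreeAlgebra ℂ ι :=
  ∑ p : ι × ι, r p • (FreeAlgebra.ι ℂ p.1 * FreeAlgebra.ι ℂ p.2)

/-- The elements of the space of relations are set equal to `0`. -/
inductive IsRelation (R : Submodule ℂ (ι × ι → ℂ)) : FreeAlgebra ℂ ι → FreeAlgebra ℂ ι → Prop
  | of (r : ι × ι → ℂ) (hr : r ∈ R) : IsRelation R (quadraticElement r) 0

/-- The quadratic algebra `A(E, R) = T(E)/(R)`. -/
def Alg (R : Submodule ℂ (ι × ι → ℂ)) : Type := RingQuot (IsRelation R)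

noncomputable instance (R : Submodule ℂ (ι × ι → ℂ)) : Ring (Alg R) :=
  inferInstanceAs (Ring (RingQuot (IsRelation R)))

noncomputable instance (R : Submodule ℂ (ι × ι → ℂ)) : Algebra ℂ (Alg R) :=
  inferInstanceAs (Algebra ℂ (RingQuot (IsRelation R)))

/-- The canonical projection `T(E) → A(E, R)`. -/
noncomputable def proj (R : Submodule ℂ (ι × ι → ℂ)) : FreeAlgebra ℂ ι →ₐ[ℂ] Alg R :=
  RingQuot.mkAlgHom ℂ (IsRelation R)

/-- The generator `x_i` of `A(E, R)`. -/
noncomputable def gen (R : Submodule ℂ (ι × ι → ℂ)) (i : ι) : Alg R :=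
  proj R (FreeAlgebra.ι ℂ i)

/-- The homogeneous component of degree `n` of `A(E, R)`: the image of the `n`-th tensor power
of `E`, that is, the span of the products of `n` generators. -/
noncomputable def degreePart (R : Submodule ℂ (ι × ι → ℂ)) (n : ℕ) : Submodule ℂ (Alg R) :=
  Submodule.span ℂ (Set.range (gen R)) ^ n

/-- The Poincaré (Hilbert) series `∑ dim(A_n) tⁿ`. -/
noncomputable def hilbertSeries (R : Submodule ℂ (ι × ι → ℂ)) : PowerSeries ℚ :=
  PowerSeries.mk fun n => (Module.finrank ℂ (degreePart R n) : ℚ)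

/-- Polynomial growth: `dim(A_n) ≤ C n ^ (N - 1)` for some `C > 0`, `N ∈ ℕ` and all `n ≥ 1`. -/
def HasPolynomialGrowth (R : Submodule ℂ (ι × ι → ℂ)) : Prop :=
  ∃ C : ℝ, 0 < C ∧ ∃ N : ℕ, ∀ n : ℕ, 1 ≤ n →
    (Module.finrank ℂ (degreePart R n) : ℝ) ≤ C * (n : ℝ) ^ ((N : ℤ) - 1)

/-- The orthogonal `R^⊥ ⊆ E* ⊗ E*` of the space of relations. The Koszul dual of `A(E, R)` is
the quadratic algebra `A(E*, R^⊥)`, that is `Alg (orthogonal R)`. -/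
def orthogonal (R : Submodule ℂ (ι × ι → ℂ)) : Submodule ℂ (ι × ι → ℂ) where
  carrier := {ω | ∀ r ∈ R, ∑ p, ω p * r p = 0}
  zero_mem' := by simp
  add_mem' := by
    intro a b ha hb r hr
    simp [add_mul, Finset.sum_add_distrib, ha r hr, hb r hr]
  smul_mem' := by
    intro c a ha r hr
    simp [mul_assoc, ← Finset.mul_sum, ha r hr]

/-! ### The Koszul complex -/

/-- The dual of the degree `n` component of the Koszul dual algebra, as the subspace
`⋂_{r+2+s=n} E^{⊗r} ⊗ R ⊗ E^{⊗s}` of `E^{⊗n}` (all of `E^{⊗n}` for `n = 0, 1`): for every two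
neighbouring positions `k, k + 1` and every choice of the letters at the other positions, the
coefficients, as a function of the letters at the positions `k, k + 1`, form an element of `R`. -/
def dualPart (R : Submodule ℂ (ι × ι → ℂ)) (n : ℕ) : Submodule ℂ ((Fin n → ι) → ℂ) where
  carrier := {w | ∀ (k : ℕ) (hk : k + 1 < n) (f : Fin n → ι),
    (fun p : ι × ι => w (Function.update (Function.update f ⟨k, Nat.lt_of_succ_lt hk⟩ p.1)
      ⟨k + 1, hk⟩ p.2)) ∈ R}
  zero_mem' := fun _ _ _ => R.zero_mem
  add_mem' := fun ha hb k hk f => R.add_mem (ha k hk f) (hb k hk f)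
  smul_mem' := fun c _ ha k hk f => R.smul_mem c (ha k hk f)

/-- The component `w_i` of `w = ∑ x_i ⊗ w_i`, as a map from the `n+1`-st to the `n`-th space. -/
def slice (R : Submodule ℂ (ι × ι → ℂ)) (n : ℕ) (i : ι) :
    dualPart R (n + 1) →ₗ[ℂ] dualPart R n where
  toFun w := ⟨fun f => w.1 (Fin.cons i f), by
    intro k hk f
    have h := w.2 (k + 1) (Nat.succ_lt_succ hk) (Fin.cons i f)
    have e : ∀ p : ι × ι,
        (Fin.cons i (Function.update (Function.update f ⟨k, Nat.lt_of_succ_lt hk⟩ p.1)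
          ⟨k + 1, hk⟩ p.2) : Fin (n + 1) → ι) =
        Function.update (Function.update (Fin.cons i f : Fin (n + 1) → ι)
          ⟨k + 1, Nat.lt_of_succ_lt (Nat.succ_lt_succ hk)⟩ p.1)
          ⟨k + 1 + 1, Nat.succ_lt_succ hk⟩ p.2 := by
      intro p
      rw [Fin.cons_update, Fin.cons_update]
      rfl
    simpa only [e] using h⟩
  map_add' _ _ := rfl
  map_smul' _ _ := rfl

/-- Right multiplication by `a`, as an endomorphism of the left module `A`. -/
noncomputable def rightMul (R : Submodule ℂ (ι × ι → ℂ)) (a : Alg R) : Alg R →ₗ[Alg R] Alg R :=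
  LinearMap.toSpanSingleton (Alg R) (Alg R) a

/-- The differential `b (a ⊗ (x_0 ⊗ x_1 ⊗ ⋯ ⊗ x_n)) = a x_0 ⊗ (x_1 ⊗ ⋯ ⊗ x_n)` of the Koszul
complex of free left `A`-modules whose term in degree `n` is `A ⊗ (A^!_n)*`. -/
noncomputable def koszulDifferential (R : Submodule ℂ (ι × ι → ℂ)) (n : ℕ) :
    Alg R ⊗[ℂ] dualPart R (n + 1) →ₗ[Alg R] Alg R ⊗[ℂ] dualPart R n :=
  ∑ i : ι, TensorProduct.AlgebraTensorModule.map (rightMul R (gen R i)) (slice R n i)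

/-- `A(E, R)` is a Koszul algebra: its Koszul complex is acyclic in positive degrees. -/
def IsKoszul (R : Submodule ℂ (ι × ι → ℂ)) : Prop :=
  ∀ n : ℕ, Function.Exact (koszulDifferential R (n + 1)) (koszulDifferential R n)

/-! ### Homological conditions -/

/-- The augmentation `ε : A → ℂ`, which kills the generators. -/
noncomputable def augmentation (R : Submodule ℂ (ι × ι → ℂ)) : Alg R →ₐ[ℂ] ℂ :=
  RingQuot.liftAlgHom ℂ ⟨FreeAlgebra.lift ℂ (fun _ : ι => (0 : ℂ)), by
    rintro _ _ ⟨r, -⟩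
    simp [quadraticElement]⟩

/-- The trivial left module `ℂ`, on which `A` acts through the augmentation. -/
noncomputable def trivialModule (R : Submodule ℂ (ι × ι → ℂ)) : ModuleCat.{0} (Alg R) :=
  (ModuleCat.restrictScalars (augmentation R).toRingHom).obj (ModuleCat.of ℂ ℂ)

/-- The algebra `A` as a left module over itself. -/
noncomputable def regularModule (R : Submodule ℂ (ι × ι → ℂ)) : ModuleCat.{0} (Alg R) :=
  ModuleCat.of (Alg R) (Alg R)

/-- Right multiplication by `a` as an endomorphism of the left module `A`. It induces the right
`A`-module structure of `Ext^n(-, A)`. -/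
noncomputable def rightMulHom (R : Submodule ℂ (ι × ι → ℂ)) (a : Alg R) :
    regularModule R ⟶ regularModule R :=
  ModuleCat.ofHom (rightMul R a)

/-- The Gorenstein property in dimension `D`: one has `Ext^n_A(ℂ, A) = 0` for `n ≠ D`, and
`Ext^D_A(ℂ, A)` is the trivial right `A`-module `ℂ`, that is, it has dimension `1` over `ℂ` and
`A` acts on it through the augmentation. -/
def IsGorenstein (R : Submodule ℂ (ι × ι → ℂ)) (D : ℕ) : Prop :=
  (∀ n : ℕ, n ≠ D → Subsingleton (Abelian.Ext.{0} (trivialModule R) (regularModule R) n)) ∧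
  Module.finrank ℂ (Abelian.Ext.{0} (trivialModule R) (regularModule R) D) = 1 ∧
  ∀ (a : Alg R) (e : Abelian.Ext.{0} (trivialModule R) (regularModule R) D),
    e.comp (Abelian.Ext.mk₀ (rightMulHom R a)) (add_zero D) = augmentation R a • e

/-- The (left) global dimension of a ring: the supremum of the projective dimensions of its left
modules. -/
noncomputable def globalDimension (A : Type) [Ring A] : WithBot ℕ∞ :=
  ⨆ M : ModuleCat.{0} A, projectiveDimension M

end Quadratic

/-! ## The algebra `A_R`

The matrix is written `R lam al be mu` for `R^{λα}_{βμ}`. -/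

namespace NCProduct

open ComplexConjugate

variable {N₁ N₂ : ℕ}

/-- The reality condition `∑ conj(R^{λα}_{βμ}) R^{μβ}_{γν} = δ^λ_ν δ^α_γ`. -/
def RealCondition (R : Fin N₁ → Fin N₂ → Fin N₂ → Fin N₁ → ℂ) : Prop :=
  ∀ (lam nu : Fin N₁) (al ga : Fin N₂),
    ∑ be, ∑ mu, conj (R lam al be mu) * R mu be ga nu = if lam = nu ∧ al = ga then 1 else 0

/-- The Yang-Baxter conditions for two indices of the second kind and one of the first. -/
def YangBaxterOne (R : Fin N₁ → Fin N₂ → Fin N₂ → Fin N₁ → ℂ) : Prop :=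
  ∀ (lam mu : Fin N₁) (al be ga de : Fin N₂),
    (∑ rho, R lam al ga rho * R rho be de mu = ∑ rho, R lam be de rho * R rho al ga mu) ∧
    (∑ rho, conj (R lam al ga rho) * conj (R rho be de mu) =
      ∑ rho, conj (R lam be de rho) * conj (R rho al ga mu)) ∧
    (∑ rho, conj (R lam al ga rho) * R rho be de mu =
      ∑ rho, R lam be de rho * conj (R rho al ga mu))

/-- The Yang-Baxter conditions for two indices of the first kind and one of the second. -/
def YangBaxterTwo (R : Fin N₁ → Fin N₂ → Fin N₂ → Fin N₁ → ℂ) : Prop :=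
  ∀ (lam mu nu rho : Fin N₁) (al be : Fin N₂),
    (∑ ga, R lam al ga nu * R mu ga be rho = ∑ ga, R mu al ga rho * R lam ga be nu) ∧
    (∑ ga, conj (R lam al ga nu) * conj (R mu ga be rho) =
      ∑ ga, conj (R mu al ga rho) * conj (R lam ga be nu)) ∧
    (∑ ga, R lam al ga nu * conj (R mu ga be rho) =
      ∑ ga, conj (R mu al ga rho) * R lam ga be nu)

/-- The basis element `x^a ⊗ x^b` of `E ⊗ E`. The generators `x_1^λ` have the indices `.inl λ`,
the generators `x_2^α` the indices `.inr α`. -/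
def word (a b : Fin N₁ ⊕ Fin N₂) : (Fin N₁ ⊕ Fin N₂) × (Fin N₁ ⊕ Fin N₂) → ℂ :=
  Pi.single (a, b) 1

/-- The space of relations of `A_R`, spanned by the relations
`x_1^λ x_1^μ = x_1^μ x_1^λ`, `x_2^α x_2^β = x_2^β x_2^α`,
`x_1^λ x_2^α = ∑ R^{λα}_{βμ} x_2^β x_1^μ`, `x_2^α x_1^λ = ∑ conj(R^{λα}_{βμ}) x_1^μ x_2^β`.
The algebra `A_R` is `Quadratic.Alg (relations R)`. -/
def relations (R : Fin N₁ → Fin N₂ → Fin N₂ → Fin N₁ → ℂ) :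
    Submodule ℂ ((Fin N₁ ⊕ Fin N₂) × (Fin N₁ ⊕ Fin N₂) → ℂ) :=
  Submodule.span ℂ
    ({r | ∃ lam mu : Fin N₁, r = word (.inl lam) (.inl mu) - word (.inl mu) (.inl lam)} ∪
     {r | ∃ al be : Fin N₂, r = word (.inr al) (.inr be) - word (.inr be) (.inr al)} ∪
     {r | ∃ (lam : Fin N₁) (al : Fin N₂), r = word (.inl lam) (.inr al) -
        ∑ be, ∑ mu, R lam al be mu • word (.inr be) (.inl mu)} ∪
     {r | ∃ (lam : Fin N₁) (al : Fin N₂), r = word (.inr al) (.inl lam) -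
        ∑ be, ∑ mu, conj (R lam al be mu) • word (.inl mu) (.inr be)})

end NCProduct

set_option linter.unusedSectionVars false

/-! Let L be the set of letters of the first kind. Conditions (yb1) and (yb2) say that R, read as a
family of matrices in either pair of indices, consists of commuting matrices, so that R and its
conjugate have the form ∑ P_e ⊗ Q_e with commuting P_e and commuting Q_e
(`exists_commuting_decomposition`). Condition (real) makes these operators invertible. Let the
conjugate of R act on the products x_2 ⊗ x_1 and the identity on the other products: this operator
on E ⊗ E, a `Twist`, carries the relations onto the antisymmetric tensors. Its tensor factors
commute at all positions, so the product of its copies over all pairs of positions j < k is a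
well-defined invertible operator `sort n` on E^{⊗n}, and it straightens the relations at every pair
of neighbouring positions simultaneously (`Compatible.slices_mem_iff`). Hence it maps W_n onto the
alternating tensors and induces a linear, not multiplicative, isomorphism of A_R with the polynomial
ring (`Compatible.finrank_dualPart`, `Compatible.polyEquiv`). Both Hilbert series follow, since W_n
is dual to the degree n part of A_R^!.

The operator `sort` does not see a letter of L at the left end nor a letter outside L at the right
end. Left multiplication by a letter of L therefore becomes multiplication in the polynomial ring,
right multiplication by a letter outside L likewise, and the slice by a letter of L becomes a
contraction. Using R in place of its conjugate gives a second twist, with L replaced by its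
complement. For S = L and for S = Lᶜ the transported derivations δ_s and exterior products C_s give
half of the classical Koszul homotopy, h = ∑_{s ∈ S} δ_s ⊗ C_s, with d h + h d = E + N. Here E
counts the letters in S, and N collects the terms that mix S with its complement. No formula for N
is needed: it commutes with E and lowers the number of letters outside S, so it is nilpotent. On
homology E = -N is both diagonalizable and nilpotent, hence zero (`totalCount_mem_range`). Adding
the cases S = L and S = Lᶜ, the total degree annihilates homology; it is positive in homological
degree at least 1, so A_R is Koszul.

The same argument applies to the dual complex A ⊗ W_n*, with left multiplications. The total
operator is there the degree in A plus N₁ + N₂ - n, so cohomology can only live in n = N₁ + N₂ and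
in degree 0 of A, where it is one-dimensional and trivial.

Finally, for every left module M the spaces A ⊗ W_n ⊗ M form a free resolution (`koszulResolution`)
of length at most N₁ + N₂. For the trivial module its A-linear dual is the complex above, which
gives the Gorenstein property; the nonzero top Ext group then forces the dimensions to be exactly N₁
+ N₂. -/

namespace Quadratic

/-! ### Matrices acting at chosen positions of a tensor. -/

section Operators

variable {ι : Type} [Fintype ι] [DecidableEq ι]

/-- Coefficient functions of the tensors of degree `n`. -/
abbrev Tensor (ι : Type) (n : ℕ) : Type := (Fin n → ι) → ℂ

/-- The matrix `X` acting on the tensor factor at the position `j`. -/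
def siteOp (n : ℕ) (j : Fin n) (X : Matrix ι ι ℂ) : Module.End ℂ (Tensor ι n) where
  toFun w f := ∑ a, X (f j) a * w (Function.update f j a)
  map_add' v w := by ext f; simp [mul_add, Finset.sum_add_distrib]
  map_smul' c w := by ext f; simp [Finset.mul_sum, mul_left_comm]

theorem siteOp_apply {n : ℕ} (j : Fin n) (X : Matrix ι ι ℂ) (w : Tensor ι n) (f : Fin n → ι) :
    siteOp n j X w f = ∑ a, X (f j) a * w (Function.update f j a) := rfl

theorem siteOp_mul {n : ℕ} (j : Fin n) (X Y : Matrix ι ι ℂ) :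
    siteOp n j (X * Y) = siteOp n j X * siteOp n j Y := by
  refine LinearMap.ext fun w => funext fun f => ?_
  simp only [siteOp_apply, Module.End.mul_apply, Matrix.mul_apply, Finset.sum_mul,
    Function.update_self, Function.update_idem, Finset.mul_sum]
  rw [Finset.sum_comm]
  simp [mul_assoc]

theorem siteOp_commute_of_ne {n : ℕ} {j k : Fin n} (h : j ≠ k) (X Y : Matrix ι ι ℂ) :
    Commute (siteOp n j X) (siteOp n k Y) := by
  refine LinearMap.ext fun w => funext fun f => ?_
  simp only [siteOp_apply, Module.End.mul_apply, Finset.mul_sum,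
    Function.update_of_ne h, Function.update_of_ne h.symm]
  rw [Finset.sum_comm]
  refine Finset.sum_congr rfl fun a _ => Finset.sum_congr rfl fun b _ => ?_
  rw [Function.update_comm h, mul_left_comm]

theorem siteOp_commute {n : ℕ} {X Y : Matrix ι ι ℂ} (h : Commute X Y) (j k : Fin n) :
    Commute (siteOp n j X) (siteOp n k Y) := by
  rcases eq_or_ne j k with rfl | hjk
  · rw [Commute, SemiconjBy, ← siteOp_mul, ← siteOp_mul, h.eq]
  · exact siteOp_commute_of_ne hjk X Y

/-- The matrix `M` acting on the two tensor factors at the positions `j` and `k`. -/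
def twoSite (n : ℕ) (j k : Fin n) (M : Matrix (ι × ι) (ι × ι) ℂ) : Module.End ℂ (Tensor ι n) where
  toFun w f := ∑ p, M (f j, f k) p * w (Function.update (Function.update f j p.1) k p.2)
  map_add' v w := by ext f; simp [mul_add, Finset.sum_add_distrib]
  map_smul' c w := by ext f; simp [Finset.mul_sum, mul_left_comm]

theorem twoSite_apply {n : ℕ} (j k : Fin n) (M : Matrix (ι × ι) (ι × ι) ℂ) (w : Tensor ι n)
    (f : Fin n → ι) : twoSite n j k M w f =
      ∑ p, M (f j, f k) p * w (Function.update (Function.update f j p.1) k p.2) := rfl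

theorem update_update_update {n : ℕ} {j k : Fin n} (h : j ≠ k) (f : Fin n → ι) (a b c d : ι) :
    Function.update (Function.update (Function.update (Function.update f j a) k b) j c) k d =
      Function.update (Function.update f j c) k d := by
  rw [Function.update_comm h.symm, Function.update_idem, Function.update_idem]

theorem twoSite_mul {n : ℕ} {j k : Fin n} (h : j ≠ k) (M M' : Matrix (ι × ι) (ι × ι) ℂ) :
    twoSite n j k (M * M') = twoSite n j k M * twoSite n j k M' := by
  refine LinearMap.ext fun w => funext fun f => ?_
  simp only [twoSite_apply, Module.End.mul_apply, Matrix.mul_apply, Finset.sum_mul,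
    Function.update_self, Function.update_of_ne h, Finset.mul_sum, update_update_update h]
  rw [Finset.sum_comm]
  simp [mul_assoc]

theorem twoSite_one {n : ℕ} {j k : Fin n} : twoSite n j k (1 : Matrix (ι × ι) (ι × ι) ℂ) = 1 := by
  refine LinearMap.ext fun w => funext fun f => ?_
  simp [twoSite_apply, Matrix.one_apply]

theorem isUnit_twoSite {n : ℕ} {j k : Fin n} (h : j ≠ k) {M : Matrix (ι × ι) (ι × ι) ℂ}
    (hM : IsUnit M) : IsUnit (twoSite n j k M) := by
  obtain ⟨u, rfl⟩ := hM
  refine isUnit_iff_exists.2 ⟨twoSite n j k (↑u⁻¹ : Matrix (ι × ι) (ι × ι) ℂ), ?_, ?_⟩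
  · rw [← twoSite_mul h, Units.mul_inv, twoSite_one]
  · rw [← twoSite_mul h, Units.inv_mul, twoSite_one]

theorem twoSite_kronecker {n : ℕ} {j k : Fin n} (h : j ≠ k) (X Y : Matrix ι ι ℂ) :
    twoSite n j k (Matrix.kroneckerMap (· * ·) X Y) = siteOp n j X * siteOp n k Y := by
  refine LinearMap.ext fun w => funext fun f => ?_
  simp only [twoSite_apply, Module.End.mul_apply, siteOp_apply, Fintype.sum_prod_type,
    Function.update_of_ne h.symm, Finset.mul_sum, Matrix.kroneckerMap_apply, mul_assoc]

/-- The permutation `s` of the positions. -/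
def permOp {n : ℕ} (s : Equiv.Perm (Fin n)) : Module.End ℂ (Tensor ι n) :=
  LinearMap.funLeft ℂ ℂ (fun f : Fin n → ι => f ∘ s)

omit [Fintype ι] [DecidableEq ι] in
theorem permOp_apply {n : ℕ} (s : Equiv.Perm (Fin n)) (w : Tensor ι n) (f : Fin n → ι) :
    permOp s w f = w (f ∘ s) := rfl

theorem permOp_siteOp {n : ℕ} (s : Equiv.Perm (Fin n)) (j : Fin n) (X : Matrix ι ι ℂ) :
    permOp s * siteOp n j X = siteOp n (s j) X * permOp s := by
  refine LinearMap.ext fun w => funext fun f => ?_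
  simp only [Module.End.mul_apply, permOp_apply, siteOp_apply, Function.comp_apply]
  refine Finset.sum_congr rfl fun a _ => ?_
  rw [Function.update_comp_equiv, s.symm_apply_apply]

/-- Intertwining relations are checked factor by factor. The commutative monoids `M` and `M'` make
unordered products meaningful although the operators live in noncommutative endomorphism rings. -/
theorem comp_finset_prod {M M' V V' : Type*} [CommMonoid M] [CommMonoid M'] [AddCommGroup V]
    [Module ℂ V] [AddCommGroup V'] [Module ℂ V'] (φ : M →* Module.End ℂ V)
    (ψ : M' →* Module.End ℂ V') (e : V →ₗ[ℂ] V') {α : Type*} (t : Finset α) (x : α → M) (y : α → M')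
    (h : ∀ p ∈ t, e ∘ₗ φ (x p) = ψ (y p) ∘ₗ e) :
    e ∘ₗ φ (∏ p ∈ t, x p) = ψ (∏ p ∈ t, y p) ∘ₗ e := by
  classical
  induction t using Finset.induction_on with
  | empty => simp [Module.End.one_eq_id]
  | insert a t ha ih =>
    rw [Finset.prod_insert ha, Finset.prod_insert ha, map_mul, map_mul, Module.End.mul_eq_comp,
      Module.End.mul_eq_comp, ← LinearMap.comp_assoc, h a (by simp), LinearMap.comp_assoc,
      ih (fun p hp => h p (by simp [hp])), LinearMap.comp_assoc]

end Operators

/-! ### Twists and the operators `sort n`. -/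

/-- A decomposition `∑ A_e ⊗ B_e`, into pairwise commuting matrices, of an invertible operator on
`E ⊗ E` which moves only the products `x_i ⊗ x_j` with `i ∉ L` and `j ∈ L`. -/
structure Twist {ι : Type} [Fintype ι] [DecidableEq ι] (L : Finset ι) where
  κ : Type
  [fintype : Fintype κ]
  A : κ → Matrix ι ι ℂ
  B : κ → Matrix ι ι ℂ
  commA : ∀ e e', Commute (A e) (A e')
  commB : ∀ e e', Commute (B e) (B e')
  commAB : ∀ e e', Commute (A e) (B e')
  isUnit : IsUnit (∑ e, Matrix.kroneckerMap (· * ·) (A e) (B e))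
  block : ∀ p q, ¬ (p.1 ∉ L ∧ p.2 ∈ L ∧ q.1 ∉ L ∧ q.2 ∈ L) →
    (∑ e, Matrix.kroneckerMap (· * ·) (A e) (B e)) p q = (1 : Matrix (ι × ι) (ι × ι) ℂ) p q

namespace Twist

open scoped IsMulCommutative

attribute [instance] Twist.fintype

variable {ι : Type} [Fintype ι] [DecidableEq ι] {L : Finset ι} (T : Twist L)

/-- The operator on `E ⊗ E`. -/
def mat : Matrix (ι × ι) (ι × ι) ℂ := ∑ e, Matrix.kroneckerMap (· * ·) (T.A e) (T.B e)

/-- All the operators `A_e` and `B_e` at all positions. -/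
def gens (n : ℕ) : Set (Module.End ℂ (Tensor ι n)) :=
  {X | ∃ j e, X = siteOp n j (T.A e) ∨ X = siteOp n j (T.B e)}

theorem gens_comm (n : ℕ) : ∀ a ∈ T.gens n, ∀ b ∈ T.gens n, a * b = b * a := by
  rintro a ⟨j, e, rfl | rfl⟩ b ⟨k, e', rfl | rfl⟩
  · exact siteOp_commute (T.commA e e') j k
  · exact siteOp_commute (T.commAB e e') j k
  · exact siteOp_commute (T.commAB e' e).symm j k
  · exact siteOp_commute (T.commB e e') j k

/-- The commutative algebra generated by the operators `A_e` and `B_e` at all positions. -/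
def siteAlg (n : ℕ) : Subalgebra ℂ (Module.End ℂ (Tensor ι n)) := Algebra.adjoin ℂ (T.gens n)

/-- This is what allows `sort` to be a product over pairs of positions without any chosen order of
the factors. -/
instance (n : ℕ) : IsMulCommutative (T.siteAlg n) :=
  Algebra.isMulCommutative_adjoin ℂ (T.gens_comm n)

/-- The inclusion of the commutative algebra of operators. -/
def incl (n : ℕ) : T.siteAlg n →* Module.End ℂ (Tensor ι n) where
  toFun x := x.1
  map_one' := rfl
  map_mul' _ _ := rfl

/-- The operator acting on the factors at the positions `j` and `k`. -/
noncomputable def pairOp (n : ℕ) (j k : Fin n) : T.siteAlg n :=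
  ⟨∑ e, siteOp n j (T.A e) * siteOp n k (T.B e), Subalgebra.sum_mem _ fun e _ =>
    Subalgebra.mul_mem _ (Algebra.subset_adjoin ⟨j, e, Or.inl rfl⟩)
      (Algebra.subset_adjoin ⟨k, e, Or.inr rfl⟩)⟩

theorem incl_pairOp' (n : ℕ) (j k : Fin n) :
    T.incl n (T.pairOp n j k) = ∑ e, siteOp n j (T.A e) * siteOp n k (T.B e) := rfl

/-- `pairOp` is defined by the factors `A_e` and `B_e`, hence lies in the commutative algebra for
all positions; only for distinct positions does it represent the twist itself. -/
theorem incl_pairOp {n : ℕ} {j k : Fin n} (h : j ≠ k) :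
    T.incl n (T.pairOp n j k) = twoSite n j k T.mat := by
  rw [incl_pairOp', mat]
  simp_rw [← twoSite_kronecker h]
  refine LinearMap.ext fun w => funext fun f => ?_
  simp only [LinearMap.sum_apply, Finset.sum_apply, twoSite_apply, Matrix.sum_apply, Finset.sum_mul]
  rw [Finset.sum_comm]

theorem permOp_pairOp {n : ℕ} (s : Equiv.Perm (Fin n)) (j k : Fin n) :
    permOp s * T.incl n (T.pairOp n j k) = T.incl n (T.pairOp n (s j) (s k)) * permOp s := by
  simp only [incl_pairOp', Finset.mul_sum, Finset.sum_mul]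
  refine Finset.sum_congr rfl fun e _ => ?_
  rw [← mul_assoc, permOp_siteOp, mul_assoc, permOp_siteOp, mul_assoc]

/-- The product of the pair operators over all pairs of positions `j < k`, as an element of the
commutative algebra. -/
noncomputable def sortEl (n : ℕ) : T.siteAlg n :=
  ∏ p : Fin n × Fin n, if p.1 < p.2 then T.pairOp n p.1 p.2 else 1

/-- The product of the pair operators over all pairs of positions `j < k`. -/
noncomputable def sort (n : ℕ) : Module.End ℂ (Tensor ι n) := T.incl n (T.sortEl n)

theorem isUnit_incl_prod {n : ℕ} (P : Fin n × Fin n → Prop) [DecidablePred P]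
    (hP : ∀ p, P p → p.1 ≠ p.2) :
    IsUnit (T.incl n (∏ p : Fin n × Fin n, if P p then T.pairOp n p.1 p.2 else 1)) := by
  refine Finset.prod_induction _ (fun x => IsUnit (T.incl n x)) ?_ ?_ ?_
  · intro a b ha hb
    rw [map_mul]; exact ha.mul hb
  · simp
  · intro p _
    split_ifs with h
    · rw [T.incl_pairOp (hP p h)]
      exact isUnit_twoSite (hP p h) T.isUnit
    · simp

theorem isUnit_sort (n : ℕ) : IsUnit (T.sort n) :=
  T.isUnit_incl_prod (fun p => p.1 < p.2) fun _ h => h.ne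

/-- The transposition of two neighbouring positions permutes the remaining pairs i < j among
themselves, so the product `G` of the other factors commutes with it. -/
theorem exists_sort_eq_mul {n : ℕ} (k : ℕ) (hk : k + 1 < n) :
    ∃ G : Module.End ℂ (Tensor ι n), IsUnit G ∧
      T.sort n = G * twoSite n ⟨k, Nat.lt_of_succ_lt hk⟩ ⟨k + 1, hk⟩ T.mat ∧
      permOp (Equiv.swap ⟨k, Nat.lt_of_succ_lt hk⟩ ⟨k + 1, hk⟩) * G =
        G * permOp (Equiv.swap ⟨k, Nat.lt_of_succ_lt hk⟩ ⟨k + 1, hk⟩) := by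
  set a : Fin n := ⟨k, Nat.lt_of_succ_lt hk⟩
  set b : Fin n := ⟨k + 1, hk⟩
  have hab : a < b := by simp [a, b]
  set s := Equiv.swap a b
  have h1 : T.sortEl n = (∏ p : Fin n × Fin n, if p.1 < p.2 ∧ p ≠ (a, b)
      then T.pairOp n p.1 p.2 else 1) * T.pairOp n a b := by
    have : T.pairOp n a b = ∏ p : Fin n × Fin n, if p = (a, b) then T.pairOp n p.1 p.2 else 1 := by
      rw [Finset.prod_ite_eq' Finset.univ (a, b) (fun p => T.pairOp n p.1 p.2)]
      simp
    rw [this, ← Finset.prod_mul_distrib, sortEl]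
    refine Finset.prod_congr rfl fun p _ => ?_
    by_cases hp : p = (a, b)
    · subst hp; simp [hab]
    · simp [hp]
  have h2 : permOp s ∘ₗ T.incl n (∏ p : Fin n × Fin n, if p.1 < p.2 ∧ p ≠ (a, b)
        then T.pairOp n p.1 p.2 else 1) =
      T.incl n (∏ p : Fin n × Fin n, if p.1 < p.2 ∧ p ≠ (a, b)
        then T.pairOp n (s p.1) (s p.2) else 1) ∘ₗ permOp s := by
    refine comp_finset_prod (T.incl n) (T.incl n) (permOp s) _ _ _ fun p _ => ?_
    split_ifs with h
    · exact T.permOp_pairOp s p.1 p.2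
    · simp [Module.End.one_eq_id]
  have h3 : (∏ p : Fin n × Fin n, if p.1 < p.2 ∧ p ≠ (a, b)
        then T.pairOp n (s p.1) (s p.2) else 1) =
      ∏ p : Fin n × Fin n, if p.1 < p.2 ∧ p ≠ (a, b) then T.pairOp n p.1 p.2 else 1 := by
    refine Fintype.prod_equiv (Equiv.prodCongr s s) _ _ ?_
    rintro ⟨i, j⟩
    -- Adjacency of the two positions is essential: a transposition of distant positions would
    -- reverse the order of further pairs.
    have key : (i < j ∧ (i, j) ≠ (a, b)) ↔ (s i < s j ∧ (s i, s j) ≠ (a, b)) := by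
      simp only [s, Equiv.swap_apply_def, a, b, Fin.ext_iff, ne_eq, Prod.mk.injEq, Fin.lt_def]
      split_ifs <;> simp_all <;> omega
    simp only [Equiv.prodCongr_apply, Prod.map]
    by_cases h : i < j ∧ (i, j) ≠ (a, b)
    · rw [if_pos h, if_pos (key.1 h)]
    · rw [if_neg h, if_neg (fun h' => h (key.2 h'))]
  refine ⟨_, T.isUnit_incl_prod (fun p => p.1 < p.2 ∧ p ≠ (a, b)) fun _ h => h.1.ne, ?_, ?_⟩
  · rw [sort, h1, map_mul, T.incl_pairOp hab.ne]
  · rw [h3] at h2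
    exact h2

end Twist

end Quadratic

/-! ### Letters at the ends of a tensor and the operator `sort`. -/

namespace Quadratic

section Tensors

variable {ι : Type} [Fintype ι] [DecidableEq ι]

/-- The coefficient `w_i` of `w = ∑ x_i ⊗ w_i`. -/
def headSlice (n : ℕ) (i : ι) : Tensor ι (n + 1) →ₗ[ℂ] Tensor ι n :=
  LinearMap.funLeft ℂ ℂ (fun f : Fin n → ι => (Fin.cons i f : Fin (n + 1) → ι))

omit [Fintype ι] [DecidableEq ι] in
theorem headSlice_apply {n : ℕ} (i : ι) (w : Tensor ι (n + 1)) (f : Fin n → ι) :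
    headSlice n i w f = w (Fin.cons i f) := rfl

/-- The map `t ↦ x_i ⊗ t`. -/
def tensLeft (n : ℕ) (i : ι) : Tensor ι n →ₗ[ℂ] Tensor ι (n + 1) where
  toFun t f := if f 0 = i then t (Fin.tail f) else 0
  map_add' v w := by ext f; by_cases h : f 0 = i <;> simp [h]
  map_smul' c w := by ext f; by_cases h : f 0 = i <;> simp [h]

omit [Fintype ι] in
theorem tensLeft_apply {n : ℕ} (i : ι) (t : Tensor ι n) (f : Fin (n + 1) → ι) :
    tensLeft n i t f = if f 0 = i then t (Fin.tail f) else 0 := rfl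

/-- The map `t ↦ t ⊗ x_i`. -/
def tensRight (n : ℕ) (i : ι) : Tensor ι n →ₗ[ℂ] Tensor ι (n + 1) where
  toFun t f := if f (Fin.last n) = i then t (Fin.init f) else 0
  map_add' v w := by ext f; by_cases h : f (Fin.last n) = i <;> simp [h]
  map_smul' c w := by ext f; by_cases h : f (Fin.last n) = i <;> simp [h]

theorem tensRight_apply {n : ℕ} (i : ι) (t : Tensor ι n) (f : Fin (n + 1) → ι) :
    tensRight n i t f = if f (Fin.last n) = i then t (Fin.init f) else 0 := rfl

/-- The number of letters of `f` which are in `S`. -/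
def letterCount (S : Finset ι) {n : ℕ} (f : Fin n → ι) : ℕ := ∑ j, if f j ∈ S then 1 else 0

theorem letterCount_congr {S : Finset ι} {n : ℕ} {f g : Fin n → ι}
    (h : ∀ j, f j ∈ S ↔ g j ∈ S) : letterCount S f = letterCount S g := by
  simp only [letterCount, h]

theorem letterCount_cons (S : Finset ι) {n : ℕ} (i : ι) (f : Fin n → ι) :
    letterCount S (Fin.cons i f : Fin (n + 1) → ι) = (if i ∈ S then 1 else 0) + letterCount S f := by
  simp only [letterCount, Fin.sum_univ_succ, Fin.cons_zero, Fin.cons_succ]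

/-- Multiplication by a function of the words. -/
def diagOp {n : ℕ} (φ : (Fin n → ι) → ℂ) : Module.End ℂ (Tensor ι n) where
  toFun w f := φ f * w f
  map_add' v w := by ext f; simp [mul_add]
  map_smul' c w := by ext f; simp [mul_left_comm]

theorem diagOp_apply {n : ℕ} (φ : (Fin n → ι) → ℂ) (w : Tensor ι n) (f : Fin n → ι) :
    diagOp φ w f = φ f * w f := rfl

/-- Multiplication by the number of letters in `S`. -/
def countOp (S : Finset ι) (n : ℕ) : Module.End ℂ (Tensor ι n) :=
  diagOp fun f => (letterCount S f : ℂ)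

theorem countOp_apply {n : ℕ} (S : Finset ι) (w : Tensor ι n) (f : Fin n → ι) :
    countOp S n w f = (letterCount S f : ℂ) * w f := rfl

/-- The projection onto the span of the words with exactly `c` letters in `S`. -/
def countProj (S : Finset ι) (n c : ℕ) : Module.End ℂ (Tensor ι n) :=
  diagOp fun f => if letterCount S f = c then 1 else 0

theorem countProj_apply {n : ℕ} (S : Finset ι) (c : ℕ) (w : Tensor ι n) (f : Fin n → ι) :
    countProj S n c w f = (if letterCount S f = c then 1 else 0) * w f := rfl

theorem letterCount_le (S : Finset ι) {n : ℕ} (f : Fin n → ι) : letterCount S f ≤ n := by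
  rw [letterCount]
  refine (Finset.sum_le_sum (g := fun _ => 1) fun j _ => ?_).trans (by simp)
  split_ifs <;> simp

theorem letterCount_comp_perm (S : Finset ι) {n : ℕ} (f : Fin n → ι) (s : Equiv.Perm (Fin n)) :
    letterCount S (f ∘ s) = letterCount S f := by
  exact Equiv.sum_comp s fun j => if f j ∈ S then 1 else 0

theorem sum_countProj (S : Finset ι) (n : ℕ) (w : Tensor ι n) :
    ∑ c ∈ Finset.range (n + 1), countProj S n c w = w := by
  ext f
  simp only [Finset.sum_apply, countProj_apply, ite_mul, one_mul, zero_mul]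
  rw [Finset.sum_ite_eq, if_pos (Finset.mem_range.2 (Nat.lt_succ_of_le (letterCount_le S f)))]

theorem countOp_countProj (S : Finset ι) (n c : ℕ) (w : Tensor ι n) :
    countOp S n (countProj S n c w) = (c : ℂ) • countProj S n c w := by
  ext f
  simp only [countOp_apply, countProj_apply, Pi.smul_apply]
  split_ifs with h <;> simp [h]

theorem countProj_countOp (S : Finset ι) (n c : ℕ) (w : Tensor ι n) :
    countProj S n c (countOp S n w) = (c : ℂ) • countProj S n c w := by
  ext f
  simp only [countOp_apply, countProj_apply, Pi.smul_apply]
  split_ifs with h <;> simp [h]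

/-- The set `S` is one of `∅`, `L`, its complement and the whole set of letters. -/
def Saturated (L S : Finset ι) : Prop := ∀ a b, (a ∈ L ↔ b ∈ L) → (a ∈ S ↔ b ∈ S)

theorem Saturated.letterCount_congr {L S : Finset ι} (hS : Saturated L S) {n : ℕ}
    {f g : Fin n → ι} (h : ∀ j, f j ∈ L ↔ g j ∈ L) : letterCount S f = letterCount S g :=
  Quadratic.letterCount_congr fun j => hS _ _ (h j)

theorem headSlice_twoSite_succ {n : ℕ} (l : ι) (i j : Fin n) (M : Matrix (ι × ι) (ι × ι) ℂ) :
    headSlice n l ∘ₗ twoSite (n + 1) i.succ j.succ M = twoSite n i j M ∘ₗ headSlice n l := by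
  refine LinearMap.ext fun w => funext fun f => ?_
  simp [headSlice_apply, twoSite_apply, Fin.cons_update]

theorem tensLeft_twoSite_succ {n : ℕ} (l : ι) (i j : Fin n) (M : Matrix (ι × ι) (ι × ι) ℂ) :
    tensLeft n l ∘ₗ twoSite n i j M = twoSite (n + 1) i.succ j.succ M ∘ₗ tensLeft n l := by
  refine LinearMap.ext fun w => funext fun f => ?_
  refine Fin.consCases (fun a f => ?_) f
  by_cases h : a = l <;> simp [tensLeft_apply, twoSite_apply, ← Fin.cons_update, h]

theorem tensRight_twoSite_castSucc {n : ℕ} (l : ι) (i j : Fin n)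
    (M : Matrix (ι × ι) (ι × ι) ℂ) :
    tensRight n l ∘ₗ twoSite n i j M = twoSite (n + 1) i.castSucc j.castSucc M ∘ₗ tensRight n l := by
  refine LinearMap.ext fun w => funext fun f => ?_
  refine Fin.snocCases (fun f a => ?_) f
  by_cases h : a = l <;> simp [tensRight_apply, twoSite_apply, ← Fin.snoc_update, h]

end Tensors

namespace Twist

variable {ι : Type} [Fintype ι] [DecidableEq ι] {L : Finset ι} (T : Twist L)

theorem mat_eq_one (p q : ι × ι) (h : ¬ (p.1 ∉ L ∧ p.2 ∈ L ∧ q.1 ∉ L ∧ q.2 ∈ L)) :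
    T.mat p q = if p = q then 1 else 0 := by
  rw [mat, T.block p q h, Matrix.one_apply]

/-- The twist moves only products whose first letter is outside `L`. A letter of `L` in the first
position is therefore left alone by every factor involving that position. -/
theorem headSlice_twoSite_zero {n : ℕ} {l : ι} (hl : l ∈ L) (k : Fin n) :
    headSlice n l ∘ₗ twoSite (n + 1) 0 k.succ T.mat = headSlice n l := by
  refine LinearMap.ext fun w => funext fun f => ?_
  have : ∀ p, T.mat (l, f k) p = if (l, f k) = p then 1 else 0 :=
    fun p => T.mat_eq_one _ _ (by simp [hl])
  simp only [LinearMap.comp_apply, headSlice_apply, twoSite_apply, Fin.cons_zero, Fin.cons_succ,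
    this]
  simp [← Fin.cons_update]

theorem tensLeft_twoSite_zero {n : ℕ} {l : ι} (hl : l ∈ L) (k : Fin n) :
    twoSite (n + 1) 0 k.succ T.mat ∘ₗ tensLeft n l = tensLeft n l := by
  refine LinearMap.ext fun w => funext fun f => ?_
  simp only [LinearMap.comp_apply, twoSite_apply]
  rw [Finset.sum_eq_single (f 0, f k.succ)]
  · by_cases h : f 0 = l
    · rw [T.mat_eq_one _ _ (by simp [h, hl])]
      simp
    · simp [tensLeft_apply, h]
  · intro p _ hp
    by_cases h : p.1 = l
    · rw [T.mat_eq_one _ _ (by simp [h, hl]), if_neg hp.symm, zero_mul]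
    · simp [tensLeft_apply, h, Function.update_of_ne (Fin.succ_ne_zero k).symm]
  · simp

/-- Mirror image: the twist moves only products whose second letter is in `L`, so a last letter
outside `L` stays in place. -/
theorem tensRight_twoSite_last {n : ℕ} {l : ι} (hl : l ∉ L) (k : Fin n) :
    twoSite (n + 1) k.castSucc (Fin.last n) T.mat ∘ₗ tensRight n l = tensRight n l := by
  refine LinearMap.ext fun w => funext fun f => ?_
  simp only [LinearMap.comp_apply, twoSite_apply]
  rw [Finset.sum_eq_single (f k.castSucc, f (Fin.last n))]
  · by_cases h : f (Fin.last n) = l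
    · rw [T.mat_eq_one _ _ (by simp [h, hl])]
      simp
    · simp [tensRight_apply, h]
  · intro p _ hp
    by_cases h : p.2 = l
    · rw [T.mat_eq_one _ _ (by simp [h, hl]), if_neg hp.symm, zero_mul]
    · simp [tensRight_apply, h]
  · simp

open scoped IsMulCommutative

/-- The factors of `sortEl n`, at the positions shifted by one. -/
noncomputable def shiftFactor (n : ℕ) (p : Fin (n + 1) × Fin (n + 1)) : T.siteAlg n :=
  Fin.cases 1 (fun i => Fin.cases 1 (fun j => if i < j then T.pairOp n i j else 1) p.2) p.1

theorem prod_shiftFactor (n : ℕ) : ∏ p, T.shiftFactor n p = T.sortEl n := by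
  simp [sortEl, shiftFactor, Fintype.prod_prod_type, Fin.prod_univ_succ]

/-- The factors of `sortEl n`, with factors `1` for the last position. -/
noncomputable def initFactor (n : ℕ) (p : Fin (n + 1) × Fin (n + 1)) : T.siteAlg n :=
  Fin.lastCases 1 (fun i => Fin.lastCases 1
    (fun j => if i < j then T.pairOp n i j else 1) p.2) p.1

theorem prod_initFactor (n : ℕ) : ∏ p, T.initFactor n p = T.sortEl n := by
  simp [sortEl, initFactor, Fintype.prod_prod_type, Fin.prod_univ_castSucc]

/-- The factors at position 0 are invisible after slicing off a letter of `L`, and the others are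
the factors of `sort n` shifted by one. Both products are indexed by the same pairs, padded by `1`,
so that they can be compared factor by factor. -/
theorem headSlice_sort {n : ℕ} {l : ι} (hl : l ∈ L) :
    headSlice n l ∘ₗ T.sort (n + 1) = T.sort n ∘ₗ headSlice n l := by
  rw [sort, sort, sortEl, ← prod_shiftFactor]
  refine comp_finset_prod (T.incl (n + 1)) (T.incl n) (headSlice n l) _ _ _ ?_
  rintro ⟨i, j⟩ -
  refine Fin.cases ?_ (fun i => ?_) i <;> refine Fin.cases ?_ (fun j => ?_) j
  · simp [shiftFactor, Module.End.one_eq_id]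
  · simp only [Fin.succ_pos, if_true, T.incl_pairOp (Fin.succ_ne_zero j).symm,
      T.headSlice_twoSite_zero hl]
    simp [shiftFactor, Module.End.one_eq_id]
  · simp [shiftFactor, Module.End.one_eq_id]
  · by_cases h : i < j
    · simp only [Fin.succ_lt_succ_iff, h, if_true, shiftFactor, Fin.cases_succ,
        T.incl_pairOp h.ne, T.incl_pairOp (Fin.succ_lt_succ_iff.2 h).ne, headSlice_twoSite_succ]
    · simp [shiftFactor, Module.End.one_eq_id, h]

theorem tensLeft_sort {n : ℕ} {l : ι} (hl : l ∈ L) :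
    tensLeft n l ∘ₗ T.sort n = T.sort (n + 1) ∘ₗ tensLeft n l := by
  rw [sort, sort, ← prod_shiftFactor, sortEl]
  refine comp_finset_prod (T.incl n) (T.incl (n + 1)) (tensLeft n l) _ _ _ ?_
  rintro ⟨i, j⟩ -
  refine Fin.cases ?_ (fun i => ?_) i <;> refine Fin.cases ?_ (fun j => ?_) j
  · simp [shiftFactor, Module.End.one_eq_id]
  · simp only [Fin.succ_pos, if_true, T.incl_pairOp (Fin.succ_ne_zero j).symm,
      T.tensLeft_twoSite_zero hl]
    simp [shiftFactor, Module.End.one_eq_id]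
  · simp [shiftFactor, Module.End.one_eq_id]
  · by_cases h : i < j
    · simp only [Fin.succ_lt_succ_iff, h, if_true, shiftFactor, Fin.cases_succ,
        T.incl_pairOp h.ne, T.incl_pairOp (Fin.succ_lt_succ_iff.2 h).ne, tensLeft_twoSite_succ]
    · simp [shiftFactor, Module.End.one_eq_id, h]

theorem tensRight_sort {n : ℕ} {l : ι} (hl : l ∉ L) :
    tensRight n l ∘ₗ T.sort n = T.sort (n + 1) ∘ₗ tensRight n l := by
  rw [sort, sort, ← prod_initFactor, sortEl]
  refine comp_finset_prod (T.incl n) (T.incl (n + 1)) (tensRight n l) _ _ _ ?_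
  rintro ⟨i, j⟩ -
  refine Fin.lastCases ?_ (fun i => ?_) i <;> refine Fin.lastCases ?_ (fun j => ?_) j
  · simp [initFactor, Module.End.one_eq_id]
  · simp [initFactor, Module.End.one_eq_id, (Fin.castSucc_lt_last j).le.not_gt]
  · simp only [Fin.castSucc_lt_last, if_true, T.incl_pairOp (Fin.castSucc_lt_last i).ne,
      T.tensRight_twoSite_last hl]
    simp [initFactor, Module.End.one_eq_id]
  · by_cases h : i < j
    · simp only [Fin.castSucc_lt_castSucc_iff, h, if_true, initFactor, Fin.lastCases_castSucc,
        T.incl_pairOp h.ne, T.incl_pairOp (Fin.castSucc_lt_castSucc_iff.2 h).ne,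
        tensRight_twoSite_castSucc]
    · simp [initFactor, Module.End.one_eq_id, h]

/-- Nontrivial matrix entries of the twist replace a letter outside `L` by one outside `L`, and a
letter of `L` by a letter of `L`. The pattern of membership in `L` along the word is preserved. -/
theorem diagOp_sort {n : ℕ} {φ : (Fin n → ι) → ℂ}
    (hφ : ∀ f g : Fin n → ι, (∀ j, f j ∈ L ↔ g j ∈ L) → φ f = φ g) :
    diagOp φ ∘ₗ T.sort n = T.sort n ∘ₗ diagOp φ := by
  rw [sort, sortEl]
  refine comp_finset_prod (T.incl n) (T.incl n) (diagOp φ) _ _ _ ?_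
  rintro ⟨i, j⟩ -
  by_cases h : i < j
  · simp only [h, if_true, T.incl_pairOp h.ne]
    refine LinearMap.ext fun w => funext fun f => ?_
    simp only [LinearMap.comp_apply, diagOp_apply, twoSite_apply, Finset.mul_sum]
    refine Finset.sum_congr rfl fun p _ => ?_
    by_cases hp : (f i ∉ L ∧ f j ∈ L ∧ p.1 ∉ L ∧ p.2 ∈ L)
    · rw [hφ f (Function.update (Function.update f i p.1) j p.2)]
      · ring
      · intro k
        rcases eq_or_ne k j with rfl | hkj
        · simp only [Function.update_self]; tauto
        · rcases eq_or_ne k i with rfl | hki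
          · simp only [Function.update_of_ne hkj, Function.update_self]; tauto
          · simp [hkj, hki]
    · rw [T.mat_eq_one _ _ hp]
      split_ifs with hq
      · subst hq
        simp
      · simp
  · simp [h, Module.End.one_eq_id]

/-- The operator `∑ A_e ⊗ B_e` turns `R` into the antisymmetric tensors. -/
def Compatible (R : Submodule ℂ (ι × ι → ℂ)) : Prop :=
  ∀ r, r ∈ R ↔ ∀ i j, T.mat.mulVec r (i, j) = - T.mat.mulVec r (j, i)

variable {T}

/-- The factor of `sort` at the positions k, k + 1 converts membership in `R` into antisymmetry
there. The complementary factor is injective and commutes with the transposition, hence does not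
affect the condition. -/
theorem Compatible.slices_mem_iff {R : Submodule ℂ (ι × ι → ℂ)} (hR : T.Compatible R) {n : ℕ}
    (k : ℕ) (hk : k + 1 < n) (w : Tensor ι n) :
    (∀ f : Fin n → ι, (fun p : ι × ι => w (Function.update (Function.update f
        ⟨k, Nat.lt_of_succ_lt hk⟩ p.1) ⟨k + 1, hk⟩ p.2)) ∈ R) ↔
      permOp (Equiv.swap ⟨k, Nat.lt_of_succ_lt hk⟩ ⟨k + 1, hk⟩) (T.sort n w) = - T.sort n w := by
  obtain ⟨G, hG, h1, h2⟩ := T.exists_sort_eq_mul k hk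
  set a : Fin n := ⟨k, Nat.lt_of_succ_lt hk⟩
  set b : Fin n := ⟨k + 1, hk⟩
  have hab : a ≠ b := by simp [a, b]
  set s := Equiv.swap a b
  have hinj : Function.Injective G := ((Module.End.isUnit_iff G).1 hG).1
  have h3 : permOp s (T.sort n w) = - T.sort n w ↔
      permOp s (twoSite n a b T.mat w) = - twoSite n a b T.mat w := by
    rw [h1, Module.End.mul_apply, ← Module.End.mul_apply, h2, Module.End.mul_apply, ← map_neg]
    exact hinj.eq_iff
  have h4 : ∀ f : Fin n → ι, twoSite n a b T.mat w f = T.mat.mulVec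
      (fun p : ι × ι => w (Function.update (Function.update f a p.1) b p.2)) (f a, f b) := by
    intro f
    simp [twoSite_apply, Matrix.mulVec, dotProduct]
  have h5 : ∀ f : Fin n → ι, ∀ c d, Function.update (Function.update (f ∘ s) a c) b d =
      Function.update (Function.update f a c) b d := by
    intro f c d
    ext x
    simp only [Function.update_apply, Function.comp_apply, s, Equiv.swap_apply_def]
    split_ifs <;> simp_all
  rw [h3]
  constructor
  · intro h
    ext f
    rw [permOp_apply, Pi.neg_apply, h4, h4]
    simp only [h5]
    have := (hR _).1 (h f) (f b) (f a)
    simpa [s] using this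
  · intro h f
    refine (hR _).2 fun i j => ?_
    have h6 := congrFun h (Function.update (Function.update f a j) b i)
    rw [permOp_apply, Pi.neg_apply, h4, h4] at h6
    simpa [h5, update_update_update hab, s, hab] using h6

end Twist

end Quadratic

/-! ### Alternating tensors, contractions and exterior products. -/

namespace Quadratic

section Alternating

variable {ι : Type}

/-- The alternating tensors. -/
def altPart (ι : Type) (n : ℕ) : Submodule ℂ (Tensor ι n) where
  carrier := {w | ∀ (k : ℕ) (hk : k + 1 < n),
    permOp (Equiv.swap ⟨k, Nat.lt_of_succ_lt hk⟩ ⟨k + 1, hk⟩) w = -w}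
  zero_mem' := by simp
  add_mem' ha hb k hk := by rw [map_add, ha k hk, hb k hk, neg_add]
  smul_mem' c a ha k hk := by rw [map_smul, ha k hk, smul_neg]

theorem apply_comp_perm_of_mem_altPart {n : ℕ} {w : Tensor ι n} (hw : w ∈ altPart ι n)
    (s : Equiv.Perm (Fin n)) (f : Fin n → ι) :
    w (f ∘ s) = (Equiv.Perm.sign s : ℤ) * w f := by
  cases n with
  | zero =>
    rw [Subsingleton.elim s 1]
    simp
  | succ n =>
    have hs : s ∈ Submonoid.closure
        (Set.range fun i : Fin n => Equiv.swap i.castSucc i.succ) := by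
      rw [Equiv.Perm.mclosure_swap_castSucc_succ]; trivial
    induction hs using Submonoid.closure_induction generalizing f with
    | mem x hx =>
      obtain ⟨i, rfl⟩ := hx
      have h1 : w (f ∘ Equiv.swap i.castSucc i.succ) = -w f :=
        congrFun (hw i.1 (by omega)) f
      have h2 : Equiv.Perm.sign (Equiv.swap i.castSucc i.succ) = -1 :=
        Equiv.Perm.sign_swap (Fin.castSucc_lt_succ (i := i)).ne
      rw [h2]
      simpa using h1
    | one => simp
    | mul x y _ _ hx hy =>
      rw [Equiv.Perm.coe_mul, ← Function.comp_assoc, hy, hx, map_mul]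
      push_cast
      ring

theorem eq_zero_of_not_injective {n : ℕ} {w : Tensor ι n} (hw : w ∈ altPart ι n)
    {f : Fin n → ι} (hf : ¬ Function.Injective f) : w f = 0 := by
  simp only [Function.Injective, not_forall] at hf
  obtain ⟨i, j, hij, hne⟩ := hf
  have h := apply_comp_perm_of_mem_altPart hw (Equiv.swap i j) f
  have h2 : f ∘ Equiv.swap i j = f := by
    ext x
    simp only [Function.comp_apply, Equiv.swap_apply_def]
    split_ifs <;> simp_all
  rw [h2, Equiv.Perm.sign_swap hne] at h
  simp only [Units.val_neg, Units.val_one, Int.cast_neg, Int.cast_one, neg_mul, one_mul] at h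
  linear_combination h / 2

theorem det_mem_altPart [DecidableEq ι] {n : ℕ} (e : Fin n → ι) :
    (fun f : Fin n → ι => (Matrix.of fun i j => if f i = e j then (1 : ℂ) else 0).det) ∈
      altPart ι n := by
  intro k hk
  ext f
  rw [permOp_apply, Pi.neg_apply]
  have := Matrix.det_permute (Equiv.swap (⟨k, Nat.lt_of_succ_lt hk⟩ : Fin n) ⟨k + 1, hk⟩)
    (Matrix.of fun i j => if f i = e j then (1 : ℂ) else 0)
  rw [Equiv.Perm.sign_swap (by simp)] at this
  exact this.trans (by simp)

/-- An alternating tensor is determined by its values on the increasing words, one for each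
n-element subset of letters. The determinants of `det_mem_altPart` show that these values can be
prescribed. -/
theorem finrank_altPart_of_linearOrder [Fintype ι] [LinearOrder ι] (n : ℕ) :
    Module.finrank ℂ (altPart ι n) = (Fintype.card ι).choose n := by
  let P := {S : Finset ι // S.card = n}
  let ev : altPart ι n →ₗ[ℂ] (P → ℂ) :=
    { toFun := fun w S => w.1 (S.1.orderEmbOfFin S.2)
      map_add' := fun _ _ => rfl
      map_smul' := fun _ _ => rfl }
  have hinj : Function.Injective ev := by
    rw [injective_iff_map_eq_zero]
    intro w hw
    ext f
    by_cases hf : Function.Injective f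
    · have hmono : StrictMono (f ∘ Tuple.sort f) :=
        (Tuple.monotone_sort f).strictMono_of_injective (hf.comp (Tuple.sort f).injective)
      have hcard : (Finset.univ.image f).card = n := by
        rw [Finset.card_image_of_injective _ hf]; simp
      have h1 := Finset.orderEmbOfFin_unique hcard (f := f ∘ Tuple.sort f) (by simp) hmono
      have h2 := apply_comp_perm_of_mem_altPart w.2 (Tuple.sort f) f
      have h3 : w.1 ((Finset.univ.image f).orderEmbOfFin hcard) = 0 :=
        congrFun hw ⟨_, hcard⟩
      rw [h1, h3] at h2
      have h4 : (((Equiv.Perm.sign (Tuple.sort f) : ℤˣ) : ℤ) : ℂ) ≠ 0 := by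
        exact_mod_cast Units.ne_zero _
      simpa [h4] using h2.symm
    · exact eq_zero_of_not_injective w.2 hf
  have hsurj : Function.Surjective ev := by
    intro φ
    refine ⟨∑ S : P, φ S • ⟨_, det_mem_altPart (S.1.orderEmbOfFin S.2)⟩, ?_⟩
    ext U
    rw [map_sum, Finset.sum_apply, Finset.sum_eq_single U]
    · have : (Matrix.of fun i j => if (U.1.orderEmbOfFin U.2) i = (U.1.orderEmbOfFin U.2) j
          then (1 : ℂ) else 0) = 1 := by
        ext i j
        simp [Matrix.one_apply]
      rw [map_smul, Pi.smul_apply]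
      change φ U • Matrix.det _ = _
      rw [this]
      simp
    · intro S _ hS
      rw [map_smul, Pi.smul_apply]
      change φ S • Matrix.det _ = _
      -- Distinct subsets of equal size: some letter of `U` is not in `S` and produces a zero row of
      -- the determinant.
      have : ¬ U.1 ⊆ S.1 := fun h => hS (Subtype.ext
        (Finset.eq_of_subset_of_card_le h (by rw [S.2, U.2])).symm)
      obtain ⟨x, hxU, hxS⟩ := Finset.not_subset.1 this
      have hx : x ∈ Set.range (U.1.orderEmbOfFin U.2) := by simpa using hxU
      obtain ⟨i, rfl⟩ := hx
      rw [Matrix.det_eq_zero_of_row_eq_zero i, smul_zero]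
      intro j
      rw [Matrix.of_apply, if_neg]
      intro h
      rw [h] at hxS
      exact hxS (by simp)
    · simp
  rw [(LinearEquiv.ofBijective ev ⟨hinj, hsurj⟩).finrank_eq, Module.finrank_fintype_fun_eq_card]
  simp only [P, Fintype.card_subtype]
  rw [← Finset.card_univ, ← Finset.card_powersetCard]
  congr 1
  ext S
  simp [Finset.mem_powersetCard]

theorem finrank_altPart [Fintype ι] (n : ℕ) :
    Module.finrank ℂ (altPart ι n) = (Fintype.card ι).choose n := by
  letI : LinearOrder ι := LinearOrder.lift' (Fintype.equivFin ι) (Fintype.equivFin ι).injective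
  exact finrank_altPart_of_linearOrder n

/-- An adjacent transposition either avoids position 0, and then acts on the slices, or exchanges
positions 0 and 1. This recursive criterion matches the recursive definition of `wedge`. -/
theorem mem_altPart_succ_succ {n : ℕ} {w : Tensor ι (n + 2)} :
    w ∈ altPart ι (n + 2) ↔ (∀ i, headSlice (n + 1) i w ∈ altPart ι (n + 1)) ∧
      ∀ i j, headSlice n i (headSlice (n + 1) j w) = - headSlice n j (headSlice (n + 1) i w) := by
  have key : ∀ (k : ℕ) (hk : k + 1 < n + 1) (i : ι) (f : Fin (n + 1) → ι),
      (Fin.cons i f : Fin (n + 2) → ι) ∘ Equiv.swap (⟨k + 1, by omega⟩ : Fin (n + 2))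
        ⟨k + 1 + 1, by omega⟩ =
      Fin.cons i (f ∘ Equiv.swap (⟨k, by omega⟩ : Fin (n + 1)) ⟨k + 1, by omega⟩) := by
    intro k hk i f
    ext x
    refine Fin.cases ?_ (fun x => ?_) x
    · rw [Function.comp_apply, Equiv.swap_apply_of_ne_of_ne] <;> simp [Fin.ext_iff]
    · have : Equiv.swap (⟨k + 1, by omega⟩ : Fin (n + 2)) ⟨k + 1 + 1, by omega⟩ x.succ =
          (Equiv.swap (⟨k, by omega⟩ : Fin (n + 1)) ⟨k + 1, by omega⟩ x).succ := by
        simp only [Equiv.swap_apply_def, Fin.ext_iff, Fin.val_succ]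
        split_ifs <;> simp_all
      rw [Function.comp_apply, this, Fin.cons_succ, Fin.cons_succ, Function.comp_apply]
  have key0 : ∀ (i j : ι) (f : Fin n → ι),
      (Fin.cons i (Fin.cons j f : Fin (n + 1) → ι) : Fin (n + 2) → ι) ∘
        Equiv.swap (⟨0, by omega⟩ : Fin (n + 2)) ⟨0 + 1, by omega⟩ =
      Fin.cons j (Fin.cons i f : Fin (n + 1) → ι) := by
    intro i j f
    ext x
    refine Fin.cases ?_ (fun x => Fin.cases ?_ (fun x => ?_) x) x
    · rw [Function.comp_apply]
      erw [Equiv.swap_apply_left]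
      rfl
    · rw [Function.comp_apply]
      erw [Equiv.swap_apply_right]
      rfl
    · rw [Function.comp_apply, Equiv.swap_apply_of_ne_of_ne]
      · rfl
      · simp [Fin.ext_iff]
      · simp [Fin.ext_iff]
  constructor
  · intro hw
    refine ⟨fun i k hk => ?_, fun i j => ?_⟩
    · ext f
      have := congrFun (hw (k + 1) (by omega)) (Fin.cons i f)
      rw [permOp_apply, key k hk] at this
      exact this
    · ext f
      have := congrFun (hw 0 (by omega)) (Fin.cons i (Fin.cons j f : Fin (n + 1) → ι))
      rw [permOp_apply, key0] at this
      exact this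
  · rintro ⟨h1, h2⟩ k hk
    ext f
    refine Fin.consCases (fun i f => ?_) f
    cases k with
    | zero =>
      refine Fin.consCases (fun j f => ?_) f
      rw [permOp_apply]
      exact (congrArg w (key0 i j f)).trans (congrFun (h2 i j) f)
    | succ k =>
      rw [permOp_apply]
      exact (congrArg w (key k (by omega) i f)).trans (congrFun (h1 i k (by omega)) f)

theorem headSlice_mem_altPart {n : ℕ} (i : ι) {w : Tensor ι (n + 1)}
    (hw : w ∈ altPart ι (n + 1)) : headSlice n i w ∈ altPart ι n := by
  cases n with
  | zero => exact fun k hk => absurd hk (by omega)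
  | succ n => exact (mem_altPart_succ_succ.1 hw).1 i

variable [DecidableEq ι]

/-- The exterior product with `x_i`, normalized so that the contractions are the `headSlice`. -/
def wedge (i : ι) : (n : ℕ) → Tensor ι n →ₗ[ℂ] Tensor ι (n + 1)
  | 0 => tensLeft 0 i
  | n + 1 => tensLeft (n + 1) i -
    { toFun := fun w f => wedge i n (headSlice n (f 0) w) (Fin.tail f)
      map_add' := fun v w => by ext f; simp
      map_smul' := fun c w => by ext f; simp }

theorem wedge_zero_apply (i : ι) (w : Tensor ι 0) (f : Fin 1 → ι) :
    wedge i 0 w f = if f 0 = i then w (Fin.tail f) else 0 := rfl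

theorem wedge_succ_apply (i : ι) {n : ℕ} (w : Tensor ι (n + 1)) (f : Fin (n + 2) → ι) :
    wedge i (n + 1) w f = (if f 0 = i then w (Fin.tail f) else 0) -
      wedge i n (headSlice n (f 0) w) (Fin.tail f) := rfl

theorem headSlice_wedge_zero (i j : ι) (w : Tensor ι 0) :
    headSlice 0 j (wedge i 0 w) = if j = i then w else 0 := by
  ext f
  rw [headSlice_apply, wedge_zero_apply]
  split_ifs <;> simp_all

/-- The anticommutation relation of contractions and exterior products; `wedge` is defined by
recursion precisely so that it holds. -/
theorem headSlice_wedge_succ (i j : ι) {n : ℕ} (w : Tensor ι (n + 1)) :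
    headSlice (n + 1) j (wedge i (n + 1) w) =
      (if j = i then w else 0) - wedge i n (headSlice n j w) := by
  ext f
  rw [headSlice_apply, wedge_succ_apply]
  split_ifs <;> simp_all

theorem wedge_mem_altPart (i : ι) {n : ℕ} {w : Tensor ι n} (hw : w ∈ altPart ι n) :
    wedge i n w ∈ altPart ι (n + 1) := by
  induction n with
  | zero => exact fun k hk => absurd hk (by omega)
  | succ n ih =>
    rw [mem_altPart_succ_succ]
    refine ⟨fun j => ?_, fun j k => ?_⟩
    · rw [headSlice_wedge_succ]
      refine Submodule.sub_mem _ ?_ (ih (headSlice_mem_altPart j hw))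
      split_ifs
      exacts [hw, Submodule.zero_mem _]
    · rw [headSlice_wedge_succ, headSlice_wedge_succ, map_sub, map_sub]
      cases n with
      | zero =>
        rw [headSlice_wedge_zero, headSlice_wedge_zero]
        split_ifs <;> simp
      | succ n =>
        rw [headSlice_wedge_succ, headSlice_wedge_succ, (mem_altPart_succ_succ.1 hw).2 j k]
        split_ifs <;> simp <;> abel

variable [Fintype ι]

/-- The exterior form of Euler's identity. In the induction step, antisymmetry exchanges the two
contractions and turns the minus sign in `wedge` into a plus. -/
theorem sum_wedge_headSlice (S : Finset ι) {n : ℕ} {w : Tensor ι (n + 1)}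
    (hw : w ∈ altPart ι (n + 1)) :
    ∑ s ∈ S, wedge s n (headSlice n s w) = countOp S (n + 1) w := by
  induction n with
  | zero =>
    ext f
    refine Fin.consCases (fun a f => ?_) f
    simp only [Finset.sum_apply, wedge_zero_apply, countOp_apply, headSlice_apply,
      letterCount_cons]
    simp [letterCount]
  | succ n ih =>
    ext f
    refine Fin.consCases (fun a f => ?_) f
    simp only [Finset.sum_apply, wedge_succ_apply, countOp_apply, headSlice_apply,
      letterCount_cons, Fin.cons_zero, Fin.tail_cons, (mem_altPart_succ_succ.1 hw).2 a, map_neg,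
      Pi.neg_apply, sub_neg_eq_add, Finset.sum_add_distrib]
    have h := congrFun (ih (headSlice_mem_altPart a hw)) f
    rw [Finset.sum_apply] at h
    rw [h, countOp_apply, headSlice_apply, Nat.cast_add, add_mul]
    simp

theorem countOp_headSlice (S : Finset ι) {n : ℕ} (i : ι) (w : Tensor ι (n + 1)) :
    headSlice n i (countOp S (n + 1) w) =
      countOp S n (headSlice n i w) + (if i ∈ S then (1 : ℂ) else 0) • headSlice n i w := by
  ext f
  simp only [headSlice_apply, countOp_apply, letterCount_cons, Pi.add_apply, Pi.smul_apply]
  split_ifs <;> simp <;> ring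

theorem countOp_tensLeft (S : Finset ι) {n : ℕ} (i : ι) (w : Tensor ι n) :
    countOp S (n + 1) (tensLeft n i w) =
      tensLeft n i (countOp S n w) + (if i ∈ S then (1 : ℂ) else 0) • tensLeft n i w := by
  ext f
  refine Fin.consCases (fun a f => ?_) f
  simp only [tensLeft_apply, countOp_apply, letterCount_cons, Pi.add_apply, Pi.smul_apply]
  by_cases h : a = i
  · subst h
    simp only [Fin.cons_zero, Fin.tail_cons, if_true, smul_eq_mul]
    push_cast
    ring
  · simp [h]

theorem countOp_wedge (S : Finset ι) {n : ℕ} (i : ι) (w : Tensor ι n) :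
    countOp S (n + 1) (wedge i n w) =
      wedge i n (countOp S n w) + (if i ∈ S then (1 : ℂ) else 0) • wedge i n w := by
  induction n with
  | zero => exact countOp_tensLeft S i w
  | succ n ih =>
    ext f
    refine Fin.consCases (fun a f => ?_) f
    have h1 := congrFun (countOp_tensLeft S i w) (Fin.cons a f)
    have h2 := congrFun (ih (headSlice n a w)) f
    simp only [wedge_succ_apply, tensLeft_apply, countOp_apply, letterCount_cons, Pi.add_apply,
      Pi.smul_apply, Fin.cons_zero, Fin.tail_cons, countOp_headSlice, map_add, map_smul,
      smul_eq_mul] at h1 h2 ⊢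
    push_cast at h1 h2 ⊢
    linear_combination h1 - h2

end Alternating

end Quadratic

/-! ### Transport of the exterior calculus to the spaces `dualPart R n`. -/

namespace Quadratic

variable {ι : Type} [Fintype ι] [DecidableEq ι] {L : Finset ι}

omit [DecidableEq ι] in
theorem slice_val {R : Submodule ℂ (ι × ι → ℂ)} {n : ℕ} (i : ι) (w : dualPart R (n + 1)) :
    (slice R n i w).1 = headSlice n i w.1 := rfl

theorem diagOp_mem_altPart {n : ℕ} {φ : (Fin n → ι) → ℂ}
    (hφ : ∀ (f : Fin n → ι) (s : Equiv.Perm (Fin n)), φ (f ∘ s) = φ f) {w : Tensor ι n}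
    (hw : w ∈ altPart ι n) : diagOp φ w ∈ altPart ι n := by
  intro k hk
  ext f
  have := congrFun (hw k hk) f
  rw [permOp_apply] at this ⊢
  rw [diagOp_apply, hφ, this, Pi.neg_apply, Pi.neg_apply, diagOp_apply, mul_neg]

namespace Twist

variable {T : Twist L} {R : Submodule ℂ (ι × ι → ℂ)}

/-- One and the same operator `sort n` handles all neighbouring positions, so the intersection
defining `dualPart` is straightened as a whole. -/
theorem Compatible.mem_dualPart_iff (hR : T.Compatible R) {n : ℕ} {w : Tensor ι n} :
    w ∈ dualPart R n ↔ T.sort n w ∈ altPart ι n :=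
  ⟨fun h k hk => (hR.slices_mem_iff k hk w).1 (h k hk),
    fun h k hk => (hR.slices_mem_iff k hk w).2 (h k hk)⟩

variable (T) in
/-- The operator `sort` as an equivalence. -/
noncomputable def sortEquiv (n : ℕ) : Tensor ι n ≃ₗ[ℂ] Tensor ι n :=
  LinearEquiv.ofBijective (T.sort n) ((Module.End.isUnit_iff _).1 (T.isUnit_sort n))

variable (T) in
theorem sortEquiv_apply (n : ℕ) (w : Tensor ι n) : T.sortEquiv n w = T.sort n w := rfl

variable (T) in
theorem sort_sortEquiv_symm (n : ℕ) (w : Tensor ι n) : T.sort n ((T.sortEquiv n).symm w) = w :=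
  (T.sortEquiv n).apply_symm_apply w

variable (T) in
theorem sort_injective (n : ℕ) : Function.Injective (T.sort n) := (T.sortEquiv n).injective

theorem Compatible.map_sortEquiv (hR : T.Compatible R) (n : ℕ) :
    (dualPart R n).map (T.sortEquiv n : Tensor ι n →ₗ[ℂ] Tensor ι n) = altPart ι n := by
  ext w
  constructor
  · rintro ⟨v, hv, rfl⟩
    exact hR.mem_dualPart_iff.1 hv
  · intro hw
    exact ⟨(T.sortEquiv n).symm w, hR.mem_dualPart_iff.2 (by rwa [sort_sortEquiv_symm]),
      T.sort_sortEquiv_symm n w⟩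

theorem Compatible.finrank_dualPart (hR : T.Compatible R) (n : ℕ) :
    Module.finrank ℂ (dualPart R n) = (Fintype.card ι).choose n := by
  rw [← finrank_altPart n, ← hR.map_sortEquiv n]
  exact ((T.sortEquiv n).submoduleMap _).finrank_eq

/-- The exterior product with `x_s` on the tensors which are antisymmetric in the twisted sense. -/
noncomputable def Compatible.creation (hR : T.Compatible R) (s : ι) (n : ℕ) :
    dualPart R n →ₗ[ℂ] dualPart R (n + 1) :=
  LinearMap.restrict ((T.sortEquiv (n + 1)).symm.toLinearMap ∘ₗ wedge s n ∘ₗ T.sort n) fun w hw =>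
    hR.mem_dualPart_iff.2 (by
      simp only [LinearMap.comp_apply, LinearEquiv.coe_coe, sort_sortEquiv_symm]
      exact wedge_mem_altPart s (hR.mem_dualPart_iff.1 hw))

theorem Compatible.sort_creation (hR : T.Compatible R) (s : ι) (n : ℕ) (w : dualPart R n) :
    T.sort (n + 1) (hR.creation s n w).1 = wedge s n (T.sort n w.1) :=
  T.sort_sortEquiv_symm _ _

variable (T) in
theorem sort_headSlice {n : ℕ} {l : ι} (hl : l ∈ L) (w : Tensor ι (n + 1)) :
    T.sort n (headSlice n l w) = headSlice n l (T.sort (n + 1) w) :=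
  (LinearMap.congr_fun (T.headSlice_sort hl) w).symm

theorem Compatible.slice_creation_zero (hR : T.Compatible R) {t : ι} (ht : t ∈ L) (s : ι)
    (w : dualPart R 0) :
    slice R 0 t (hR.creation s 0 w) = (if t = s then (1 : ℂ) else 0) • w := by
  refine Subtype.ext (T.sort_injective 0 ?_)
  rw [slice_val, T.sort_headSlice ht, hR.sort_creation, headSlice_wedge_zero]
  split_ifs <;> simp

/-- Only slices by letters of `L` commute with `sort`, so the anticommutation relation survives the
transport only for `t ∈ L`; the letter `s` is arbitrary. -/
theorem Compatible.slice_creation_succ (hR : T.Compatible R) {t : ι} (ht : t ∈ L) (s : ι) {n : ℕ}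
    (w : dualPart R (n + 1)) :
    slice R (n + 1) t (hR.creation s (n + 1) w) + hR.creation s n (slice R n t w) =
      (if t = s then (1 : ℂ) else 0) • w := by
  refine Subtype.ext (T.sort_injective (n + 1) ?_)
  rw [Submodule.coe_add, map_add, slice_val, T.sort_headSlice ht, hR.sort_creation,
    hR.sort_creation, slice_val, T.sort_headSlice ht, headSlice_wedge_succ]
  split_ifs <;> simp

variable (T) in
theorem sort_countOp {S : Finset ι} (hS : Saturated L S) {n : ℕ} (w : Tensor ι n) :
    T.sort n (countOp S n w) = countOp S n (T.sort n w) := by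
  refine (LinearMap.congr_fun (T.diagOp_sort fun f g h => ?_) w).symm
  rw [hS.letterCount_congr h]

theorem Compatible.countOp_mem (hR : T.Compatible R) {S : Finset ι} (hS : Saturated L S) {n : ℕ}
    {w : Tensor ι n} (hw : w ∈ dualPart R n) : countOp S n w ∈ dualPart R n := by
  rw [hR.mem_dualPart_iff, T.sort_countOp hS]
  exact diagOp_mem_altPart (fun f s => by rw [letterCount_comp_perm]) (hR.mem_dualPart_iff.1 hw)

theorem Compatible.countProj_mem (hR : T.Compatible R) {S : Finset ι} (hS : Saturated L S)
    {n : ℕ} (c : ℕ) {w : Tensor ι n} (hw : w ∈ dualPart R n) :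
    countProj S n c w ∈ dualPart R n := by
  have : T.sort n (countProj S n c w) = countProj S n c (T.sort n w) := by
    refine (LinearMap.congr_fun (T.diagOp_sort fun f g h => ?_) w).symm
    rw [hS.letterCount_congr h]
  rw [hR.mem_dualPart_iff, this]
  exact diagOp_mem_altPart (fun f s => by rw [letterCount_comp_perm]) (hR.mem_dualPart_iff.1 hw)

/-- The operator counting the letters in `S`. -/
noncomputable def Compatible.dualCount (hR : T.Compatible R) {S : Finset ι} (hS : Saturated L S)
    (n : ℕ) : Module.End ℂ (dualPart R n) :=
  (countOp S n).restrict fun _ hw => hR.countOp_mem hS hw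

/-- The projection to the words with `c` letters in `S`. -/
noncomputable def Compatible.dualProj (hR : T.Compatible R) {S : Finset ι} (hS : Saturated L S)
    (n c : ℕ) : Module.End ℂ (dualPart R n) :=
  (countProj S n c).restrict fun _ hw => hR.countProj_mem hS c hw

theorem Compatible.dualCount_val (hR : T.Compatible R) {S : Finset ι} (hS : Saturated L S) {n : ℕ}
    (w : dualPart R n) : (hR.dualCount hS n w).1 = countOp S n w.1 := rfl

theorem Compatible.sum_dualProj (hR : T.Compatible R) {S : Finset ι} (hS : Saturated L S) {n : ℕ}
    (w : dualPart R n) : ∑ c ∈ Finset.range (n + 1), hR.dualProj hS n c w = w := by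
  refine Subtype.ext ?_
  rw [AddSubmonoidClass.coe_finsetSum]
  exact sum_countProj S n w.1

theorem Compatible.dualCount_dualProj (hR : T.Compatible R) {S : Finset ι} (hS : Saturated L S)
    {n : ℕ} (c : ℕ) (w : dualPart R n) :
    hR.dualCount hS n (hR.dualProj hS n c w) = (c : ℂ) • hR.dualProj hS n c w :=
  Subtype.ext (countOp_countProj S n c w.1)

theorem Compatible.dualProj_dualCount (hR : T.Compatible R) {S : Finset ι} (hS : Saturated L S)
    {n : ℕ} (c : ℕ) (w : dualPart R n) :
    hR.dualProj hS n c (hR.dualCount hS n w) = (c : ℂ) • hR.dualProj hS n c w :=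
  Subtype.ext (countProj_countOp S n c w.1)

theorem Compatible.slice_dualCount (hR : T.Compatible R) {S : Finset ι} (hS : Saturated L S)
    {n : ℕ} (i : ι) (w : dualPart R (n + 1)) :
    slice R n i (hR.dualCount hS (n + 1) w) =
      hR.dualCount hS n (slice R n i w) + (if i ∈ S then (1 : ℂ) else 0) • slice R n i w :=
  Subtype.ext (countOp_headSlice S i w.1)

theorem Compatible.dualCount_creation (hR : T.Compatible R) {S : Finset ι} (hS : Saturated L S)
    {n : ℕ} (i : ι) (w : dualPart R n) :
    hR.dualCount hS (n + 1) (hR.creation i n w) =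
      hR.creation i n (hR.dualCount hS n w) +
        (if i ∈ S then (1 : ℂ) else 0) • hR.creation i n w := by
  refine Subtype.ext (T.sort_injective (n + 1) ?_)
  rw [dualCount_val, T.sort_countOp hS, hR.sort_creation, countOp_wedge, Submodule.coe_add,
    Submodule.coe_smul, map_add, map_smul, hR.sort_creation, hR.sort_creation, dualCount_val,
    T.sort_countOp hS]

theorem Compatible.sum_creation_slice (hR : T.Compatible R) (hL : Saturated L L) {n : ℕ}
    (w : dualPart R (n + 1)) :
    ∑ s ∈ L, hR.creation s n (slice R n s w) = hR.dualCount hL (n + 1) w := by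
  refine Subtype.ext (T.sort_injective (n + 1) ?_)
  rw [dualCount_val, T.sort_countOp hL, ← sum_wedge_headSlice L (hR.mem_dualPart_iff.1 w.2),
    AddSubmonoidClass.coe_finsetSum, map_sum]
  refine Finset.sum_congr rfl fun s hs => ?_
  rw [hR.sort_creation, slice_val, T.sort_headSlice hs]

end Twist

end Quadratic

/-! ### Linear maps out of a quadratic algebra, and its grading. -/

namespace Quadratic

section Words

variable {ι : Type}

theorem basisFreeMonoid_apply (l : FreeMonoid ι) :
    FreeAlgebra.basisFreeMonoid ℂ ι l = FreeMonoid.lift (FreeAlgebra.ι ℂ) l := by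
  have h : (FreeAlgebra.equivMonoidAlgebraFreeMonoid (R := ℂ) (X := ι)).symm
      (MonoidAlgebra.single l 1) = FreeMonoid.lift (FreeAlgebra.ι ℂ) l :=
    (MonoidAlgebra.lift_single _ l 1).trans (one_smul _ _)
  rw [← h]
  simp [FreeAlgebra.basisFreeMonoid]

/-- The linear functional on the free algebra with given values on the words. -/
noncomputable def freeFunctional {V : Type*} [AddCommGroup V] [Module ℂ V] (g : List ι → V) :
    FreeAlgebra ℂ ι →ₗ[ℂ] V :=
  (FreeAlgebra.basisFreeMonoid ℂ ι).constr ℂ fun l => g l.toList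

theorem freeFunctional_word {V : Type*} [AddCommGroup V] [Module ℂ V] (g : List ι → V)
    (l : List ι) : freeFunctional g (l.map (FreeAlgebra.ι ℂ)).prod = g l := by
  have := (FreeAlgebra.basisFreeMonoid ℂ ι).constr_basis ℂ (fun l => g l.toList)
    (FreeMonoid.ofList l)
  rw [basisFreeMonoid_apply, FreeMonoid.lift_apply] at this
  exact this

theorem span_freeWords :
    Submodule.span ℂ (Set.range fun l : List ι => (l.map (FreeAlgebra.ι ℂ)).prod) = ⊤ := by
  rw [← (FreeAlgebra.basisFreeMonoid ℂ ι).span_eq]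
  congr 1
  ext x
  constructor
  · rintro ⟨l, rfl⟩
    exact ⟨FreeMonoid.ofList l, by rw [basisFreeMonoid_apply, FreeMonoid.lift_apply]; rfl⟩
  · rintro ⟨l, rfl⟩
    exact ⟨l.toList, by rw [basisFreeMonoid_apply, FreeMonoid.lift_apply]⟩

variable [Fintype ι] (R : Submodule ℂ (ι × ι → ℂ))

/-- The product of generators along a word. -/
noncomputable def word (l : List ι) : Alg R := (l.map (gen R)).prod

theorem proj_freeWord (l : List ι) : proj R (l.map (FreeAlgebra.ι ℂ)).prod = word R l := by
  rw [map_list_prod, List.map_map]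
  rfl

theorem proj_surjective : Function.Surjective (proj R) := RingQuot.mkAlgHom_surjective ℂ _

theorem span_words : Submodule.span ℂ (Set.range (word R)) = ⊤ := by
  have : Set.range (word R) =
      (proj R).toLinearMap '' (Set.range fun l : List ι => (l.map (FreeAlgebra.ι ℂ)).prod) := by
    rw [← Set.range_comp]
    congr 1
    ext l
    exact (proj_freeWord R l).symm
  rw [this, Submodule.span_image, span_freeWords, Submodule.map_top, LinearMap.range_eq_top]
  exact proj_surjective R

variable {R} in
theorem linearMap_ext_words {V : Type*} [AddCommGroup V] [Module ℂ V] {f g : Alg R →ₗ[ℂ] V}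
    (h : ∀ l, f (word R l) = g (word R l)) : f = g :=
  LinearMap.ext_on (span_words R) (by rintro _ ⟨l, rfl⟩; exact h l)

variable {R} in
theorem word_induction {P : Alg R → Prop} (a : Alg R) (h : ∀ l, P (word R l))
    (h0 : P 0) (hadd : ∀ x y, P x → P y → P (x + y)) (hsmul : ∀ (c : ℂ) x, P x → P (c • x)) :
    P a := by
  have ha : a ∈ Submodule.span ℂ (Set.range (word R)) := by rw [span_words]; trivial
  exact Submodule.span_induction (by rintro _ ⟨l, rfl⟩; exact h l) h0
    (fun x y _ _ => hadd x y) (fun c x _ => hsmul c x) ha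

theorem word_nil : word R [] = 1 := rfl

theorem word_cons (i : ι) (l : List ι) : word R (i :: l) = gen R i * word R l := by
  simp [word]

theorem word_append (l l' : List ι) : word R (l ++ l') = word R l * word R l' := by
  simp [word]

theorem word_concat (l : List ι) (i : ι) : word R (l ++ [i]) = word R l * gen R i := by
  simp [word]

variable {R} in
theorem sum_smul_gen_mul_gen {r : ι × ι → ℂ} (hr : r ∈ R) :
    ∑ p : ι × ι, r p • (gen R p.1 * gen R p.2) = 0 := by
  have h : proj R (quadraticElement r) = proj R 0 := RingQuot.mkAlgHom_rel ℂ (IsRelation.of r hr)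
  rw [map_zero, quadraticElement, map_sum] at h
  rw [← h]
  refine Finset.sum_congr rfl fun p _ => ?_
  rw [map_smul, map_mul]
  rfl

variable {R} in
theorem sum_smul_word {r : ι × ι → ℂ} (hr : r ∈ R) (l₁ l₂ : List ι) :
    ∑ p : ι × ι, r p • word R (l₁ ++ p.1 :: p.2 :: l₂) = 0 := by
  have h : ∀ p : ι × ι, r p • word R (l₁ ++ p.1 :: p.2 :: l₂) =
      word R l₁ * (r p • (gen R p.1 * gen R p.2)) * word R l₂ := by
    intro p
    rw [word_append, word_cons, word_cons, mul_smul_comm, smul_mul_assoc]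
    simp only [mul_assoc]
  simp only [h]
  rw [← Finset.sum_mul, ← Finset.mul_sum, sum_smul_gen_mul_gen hr, mul_zero, zero_mul]

/-- The values on the words are compatible with the relations. -/
def RespectsRelations {V : Type*} [AddCommGroup V] [Module ℂ V] (g : List ι → V) : Prop :=
  ∀ l₁ l₂ : List ι, ∀ r ∈ R, ∑ p : ι × ι, r p • g (l₁ ++ p.1 :: p.2 :: l₂) = 0

variable {R} in
theorem freeFunctional_mul_quadraticElement_mul {V : Type*} [AddCommGroup V] [Module ℂ V]
    {g : List ι → V} (hg : RespectsRelations R g) {r : ι × ι → ℂ} (hr : r ∈ R)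
    (x y : FreeAlgebra ℂ ι) : freeFunctional g (x * quadraticElement r * y) = 0 := by
  have hx : x ∈ Submodule.span ℂ
      (Set.range fun l : List ι => (l.map (FreeAlgebra.ι ℂ)).prod) := by
    rw [span_freeWords]; trivial
  have hy : y ∈ Submodule.span ℂ
      (Set.range fun l : List ι => (l.map (FreeAlgebra.ι ℂ)).prod) := by
    rw [span_freeWords]; trivial
  induction hx using Submodule.span_induction with
  | zero => simp
  | add a b _ _ ha hb => rw [add_mul, add_mul, map_add, ha, hb, add_zero]
  | smul c a _ ha => rw [smul_mul_assoc, smul_mul_assoc, map_smul, ha, smul_zero]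
  | mem a ha =>
    obtain ⟨l₁, rfl⟩ := ha
    induction hy using Submodule.span_induction with
    | zero => simp
    | add a b _ _ ha hb => rw [mul_add, map_add, ha, hb, add_zero]
    | smul c a _ ha => rw [mul_smul_comm, map_smul, ha, smul_zero]
    | mem b hb =>
      obtain ⟨l₂, rfl⟩ := hb
      rw [← hg l₁ l₂ r hr, quadraticElement, Finset.mul_sum, Finset.sum_mul, map_sum]
      refine Finset.sum_congr rfl fun p _ => ?_
      rw [mul_smul_comm, smul_mul_assoc, map_smul, ← freeFunctional_word g]
      simp [mul_assoc]

variable {R} in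
-- The arbitrary outer factors `x` and `y` make the statement stable under the closure rules of
-- `RingQuot.Rel`. Since `V` is only a vector space, the universal property for algebra maps does
-- not apply.
theorem freeFunctional_eq_of_rel {V : Type*} [AddCommGroup V] [Module ℂ V]
    {g : List ι → V} (hg : RespectsRelations R g) {u v : FreeAlgebra ℂ ι}
    (h : RingQuot.Rel (IsRelation R) u v) (x y : FreeAlgebra ℂ ι) :
    freeFunctional g (x * u * y) = freeFunctional g (x * v * y) := by
  induction h generalizing x y with
  | of h =>
    obtain ⟨r, hr⟩ := h
    rw [freeFunctional_mul_quadraticElement_mul hg hr, mul_zero, zero_mul, map_zero]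
  | add_left _ ih => rw [mul_add, mul_add, add_mul, add_mul, map_add, map_add, ih]
  | mul_left _ ih => rw [← mul_assoc, ← mul_assoc, mul_assoc _ _ y, mul_assoc _ _ y, ih]
  | mul_right _ ih => rw [← mul_assoc, ← mul_assoc, ih]

variable {R} in
theorem freeFunctional_eq_of_proj_eq {V : Type*} [AddCommGroup V] [Module ℂ V]
    {g : List ι → V} (hg : RespectsRelations R g) {u v : FreeAlgebra ℂ ι}
    (h : proj R u = proj R v) : freeFunctional g u = freeFunctional g v := by
  have h1 : RingQuot.mkRingHom (IsRelation R) u = RingQuot.mkRingHom (IsRelation R) v := by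
    rw [← RingQuot.mkAlgHom_coe ℂ]
    exact h
  rw [RingQuot.mkRingHom_def] at h1
  have h2 : Quot.mk (RingQuot.Rel (IsRelation R)) u = Quot.mk _ v :=
    congrArg RingQuot.toQuot h1
  have h3 := Quot.eqvGen_exact h2
  clear h h1 h2
  induction h3 with
  | rel a b hab => simpa using freeFunctional_eq_of_rel hg hab 1 1
  | refl => rfl
  | symm a b _ ih => exact ih.symm
  | trans a b c _ _ ih ih' => exact ih.trans ih'

variable {R} in
/-- The linear map on the quadratic algebra with given values on the words. -/
noncomputable def RespectsRelations.lift {V : Type*} [AddCommGroup V] [Module ℂ V]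
    {g : List ι → V} (hg : RespectsRelations R g) : Alg R →ₗ[ℂ] V where
  toFun a := freeFunctional g (Function.surjInv (proj_surjective R) a)
  map_add' a b := by
    rw [← map_add]
    refine freeFunctional_eq_of_proj_eq hg ?_
    simp only [map_add, Function.surjInv_eq]
  map_smul' c a := by
    rw [RingHom.id_apply, ← map_smul]
    refine freeFunctional_eq_of_proj_eq hg ?_
    simp only [map_smul, Function.surjInv_eq]

variable {R} in
theorem RespectsRelations.lift_word {V : Type*} [AddCommGroup V] [Module ℂ V]
    {g : List ι → V} (hg : RespectsRelations R g) (l : List ι) : hg.lift (word R l) = g l := by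
  rw [← freeFunctional_word g]
  refine freeFunctional_eq_of_proj_eq hg ?_
  rw [Function.surjInv_eq (proj_surjective R), proj_freeWord]

/-- The projection to the component of degree `k`. -/
theorem respectsRelations_degree (k : ℕ) :
    RespectsRelations R fun l : List ι => if l.length = k then word R l else 0 := by
  intro l₁ l₂ r hr
  by_cases h : (l₁.length + (l₂.length + 1 + 1)) = k
  · simpa [h] using sum_smul_word hr l₁ l₂
  · simp [h]

/-- The projection to the component of degree `k`. -/
noncomputable def degreeProj (k : ℕ) : Alg R →ₗ[ℂ] Alg R := (respectsRelations_degree R k).lift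

theorem degreeProj_word (k : ℕ) (l : List ι) :
    degreeProj R k (word R l) = if l.length = k then word R l else 0 :=
  (respectsRelations_degree R k).lift_word l

variable {R}

theorem degreeProj_succ_mul_gen (k : ℕ) (a : Alg R) (i : ι) :
    degreeProj R (k + 1) (a * gen R i) = degreeProj R k a * gen R i := by
  have : degreeProj R (k + 1) ∘ₗ LinearMap.mulRight ℂ (gen R i) =
      LinearMap.mulRight ℂ (gen R i) ∘ₗ degreeProj R k := by
    refine linearMap_ext_words fun l => ?_
    simp only [LinearMap.comp_apply, LinearMap.mulRight_apply, ← word_concat, degreeProj_word,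
      List.length_append, List.length_singleton, add_left_inj]
    split_ifs <;> simp [word_concat]
  exact LinearMap.congr_fun this a

theorem degreeProj_zero_mul_gen (a : Alg R) (i : ι) : degreeProj R 0 (a * gen R i) = 0 := by
  have : degreeProj R 0 ∘ₗ LinearMap.mulRight ℂ (gen R i) = 0 := by
    refine linearMap_ext_words fun l => ?_
    simp [← word_concat, degreeProj_word]
  exact LinearMap.congr_fun this a

theorem degreeProj_degreeProj (k m : ℕ) (a : Alg R) :
    degreeProj R k (degreeProj R m a) = if k = m then degreeProj R k a else 0 := by
  have : degreeProj R k ∘ₗ degreeProj R m = if k = m then degreeProj R k else 0 := by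
    refine linearMap_ext_words fun l => ?_
    rw [LinearMap.comp_apply, degreeProj_word]
    by_cases h1 : l.length = m <;> by_cases h2 : k = m <;>
      simp_all [degreeProj_word, eq_comm]
  have h := LinearMap.congr_fun this a
  rw [LinearMap.comp_apply] at h
  rw [h]
  split_ifs <;> rfl

/-- Every element has finitely many components. The form "for all large `M`" lets two elements share
a bound in the additive step. -/
theorem exists_sum_degreeProj (a : Alg R) :
    ∃ N, ∀ M, N ≤ M → ∑ k ∈ Finset.range M, degreeProj R k a = a := by
  induction a using word_induction with
  | h l =>
    refine ⟨l.length + 1, fun M hM => ?_⟩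
    simp only [degreeProj_word]
    rw [Finset.sum_ite_eq, if_pos (Finset.mem_range.2 hM)]
  | h0 => exact ⟨0, fun M _ => by simp⟩
  | hadd x y hx hy =>
    obtain ⟨N, hN⟩ := hx
    obtain ⟨N', hN'⟩ := hy
    refine ⟨max N N', fun M hM => ?_⟩
    simp only [map_add, Finset.sum_add_distrib]
    rw [hN M (le_of_max_le_left hM), hN' M (le_of_max_le_right hM)]
  | hsmul c x hx =>
    obtain ⟨N, hN⟩ := hx
    refine ⟨N, fun M hM => ?_⟩
    simp only [map_smul]
    rw [← Finset.smul_sum, hN M hM]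

end Words
end Quadratic

/-! ### Tensors evaluated in the quadratic algebra and in the polynomial ring. -/

namespace Quadratic

section Tensors

variable {ι : Type} [Fintype ι] [DecidableEq ι]

theorem ofFn_update_update {n : ℕ} (f : Fin n → ι) (k : ℕ) (hk : k + 1 < n) (a b : ι) :
    List.ofFn (Function.update (Function.update f ⟨k, Nat.lt_of_succ_lt hk⟩ a) ⟨k + 1, hk⟩ b) =
      (List.ofFn f).take k ++ a :: b :: (List.ofFn f).drop (k + 2) := by
  refine List.ext_getElem ?_ fun i h1 h2 => ?_
  · simp; omega
  · rw [List.length_ofFn] at h1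
    simp only [List.getElem_ofFn, Function.update_apply, Fin.mk.injEq, List.getElem_append,
      List.length_take, List.length_ofFn, List.getElem_take, List.getElem_cons, List.getElem_drop]
    have h3 : min k n = k := by omega
    simp only [h3]
    by_cases h4 : i < k
    · simp [h4, show i ≠ k + 1 by omega, show i ≠ k by omega]
    · by_cases h5 : i = k
      · subst h5; simp
      · by_cases h6 : i = k + 1
        · subst h6; simp
        · simp only [h4, h5, h6, if_false, dif_neg, not_false_eq_true,
            show ¬ (i - k = 0) by omega, show ¬ (i - k - 1 = 0) by omega]
          congr 2
          omega

/-- The image of a tensor in the quadratic algebra. -/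
noncomputable def evalTensor (R : Submodule ℂ (ι × ι → ℂ)) (n : ℕ) : Tensor ι n →ₗ[ℂ] Alg R :=
  Fintype.linearCombination ℂ fun f : Fin n → ι => word R (List.ofFn f)

theorem evalTensor_apply (R : Submodule ℂ (ι × ι → ℂ)) {n : ℕ} (t : Tensor ι n) :
    evalTensor R n t = ∑ f, t f • word R (List.ofFn f) := rfl

/-- Exchanging the two inserted letters with those they overwrite is an involution on pairs (word,
two letters), so each word is counted equally often. -/
theorem sum_update_update {V : Type*} [AddCommGroup V] {n : ℕ} {j k : Fin n} (h : j ≠ k)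
    (F : (Fin n → ι) → V) :
    ∑ f, ∑ p : ι × ι, F (Function.update (Function.update f j p.1) k p.2) =
      Fintype.card (ι × ι) • ∑ f, F f := by
  have h1 : ∑ f, ∑ _p : ι × ι, F f = Fintype.card (ι × ι) • ∑ f, F f := by
    simp [Finset.smul_sum]
  rw [← h1, ← Fintype.sum_prod_type', ← Fintype.sum_prod_type']
  let e : (Fin n → ι) × (ι × ι) → (Fin n → ι) × (ι × ι) := fun x =>
    (Function.update (Function.update x.1 j x.2.1) k x.2.2, (x.1 j, x.1 k))
  have he : Function.Involutive e := by
    rintro ⟨f, a, b⟩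
    simp only [e, update_update_update h, Function.update_eq_self, Function.update_self,
      Function.update_of_ne h]
  exact Fintype.sum_equiv he.toPerm _ _ fun x => rfl

/-- Summing over all words and over all replacements of the letters at k, k + 1 gives a positive
multiple of the evaluation, while each inner sum vanishes by a relation. -/
theorem evalTensor_eq_zero {R : Submodule ℂ (ι × ι → ℂ)} {n : ℕ} {t : Tensor ι n} (k : ℕ)
    (hk : k + 1 < n) (ht : ∀ f : Fin n → ι, (fun p : ι × ι => t (Function.update
      (Function.update f ⟨k, Nat.lt_of_succ_lt hk⟩ p.1) ⟨k + 1, hk⟩ p.2)) ∈ R) :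
    evalTensor R n t = 0 := by
  have h := sum_update_update (j := (⟨k, Nat.lt_of_succ_lt hk⟩ : Fin n)) (k := ⟨k + 1, hk⟩)
    (by simp) fun f => t f • word R (List.ofFn f)
  have h2 : ∀ f : Fin n → ι, ∑ p : ι × ι, t (Function.update (Function.update f
      ⟨k, Nat.lt_of_succ_lt hk⟩ p.1) ⟨k + 1, hk⟩ p.2) • word R (List.ofFn (Function.update
        (Function.update f ⟨k, Nat.lt_of_succ_lt hk⟩ p.1) ⟨k + 1, hk⟩ p.2)) = 0 := by
    intro f
    simp only [ofFn_update_update]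
    exact sum_smul_word (ht f) _ _
  simp only [h2, Finset.sum_const_zero] at h
  rw [evalTensor_apply]
  -- The multiple can be cancelled unless there are no letters, in which case there are no words of
  -- length n at all.
  by_cases hι : Fintype.card (ι × ι) = 0
  · have : IsEmpty (Fin n → ι) := by
      refine ⟨fun f => ?_⟩
      have := Fintype.card_eq_zero_iff.1 hι
      exact this.false (f ⟨k + 1, hk⟩, f ⟨k + 1, hk⟩)
    simp
  · rw [← Nat.cast_smul_eq_nsmul ℂ] at h
    exact (smul_eq_zero.1 h.symm).resolve_left (by exact_mod_cast hι)

/-- The tensor given by a word. -/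
def wordTensor (n : ℕ) (l : List ι) : Tensor ι n := fun f => if List.ofFn f = l then 1 else 0

theorem wordTensor_apply (n : ℕ) (l : List ι) (f : Fin n → ι) :
    wordTensor n l f = if List.ofFn f = l then 1 else 0 := rfl

theorem wordTensor_ofFn {n : ℕ} (f : Fin n → ι) : wordTensor n (List.ofFn f) = Pi.single f 1 := by
  ext g
  rw [wordTensor_apply, Pi.single_apply]
  simp [List.ofFn_inj]

theorem exists_ofFn_eq {n : ℕ} {l : List ι} (h : l.length = n) :
    ∃ f : Fin n → ι, List.ofFn f = l := by
  subst h
  exact ⟨l.get, List.ofFn_get l⟩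

theorem evalTensor_wordTensor (R : Submodule ℂ (ι × ι → ℂ)) {n : ℕ} {l : List ι}
    (h : l.length = n) : evalTensor R n (wordTensor n l) = word R l := by
  obtain ⟨f, rfl⟩ := exists_ofFn_eq h
  rw [wordTensor_ofFn, evalTensor_apply]
  simp [Pi.single_apply]

theorem tensor_eq_sum_wordTensor {n : ℕ} (t : Tensor ι n) :
    t = ∑ f, t f • wordTensor n (List.ofFn f) := by
  ext g
  simp [wordTensor_ofFn, Pi.single_apply]

theorem tensor_linearMap_ext {n : ℕ} {V : Type*} [AddCommGroup V] [Module ℂ V]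
    {φ ψ : Tensor ι n →ₗ[ℂ] V}
    (h : ∀ l : List ι, l.length = n → φ (wordTensor n l) = ψ (wordTensor n l)) : φ = ψ := by
  refine LinearMap.ext fun t => ?_
  rw [tensor_eq_sum_wordTensor t, map_sum, map_sum]
  exact Finset.sum_congr rfl fun f _ => by rw [map_smul, map_smul, h _ (by simp)]

theorem tensLeft_wordTensor {n : ℕ} (i : ι) (l : List ι) :
    tensLeft n i (wordTensor n l) = wordTensor (n + 1) (i :: l) := by
  ext f
  refine Fin.consCases (fun a f => ?_) f
  simp only [tensLeft_apply, wordTensor_apply, List.ofFn_succ, Fin.cons_zero, Fin.cons_succ,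
    Fin.tail_cons, List.cons.injEq]
  split_ifs <;> simp_all

theorem tensRight_wordTensor {n : ℕ} (i : ι) (l : List ι) :
    tensRight n i (wordTensor n l) = wordTensor (n + 1) (l ++ [i]) := by
  ext f
  refine Fin.snocCases (fun f a => ?_) f
  simp only [tensRight_apply, wordTensor_apply, List.ofFn_succ', Fin.snoc_last, Fin.snoc_castSucc,
    Fin.init_snoc, List.concat_eq_append, List.append_singleton_inj]
  split_ifs <;> simp_all

theorem permOp_wordTensor (l₁ l₂ : List ι) (a b : ι) {n : ℕ} (hk : l₁.length + 1 < n) :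
    permOp (Equiv.swap ⟨l₁.length, Nat.lt_of_succ_lt hk⟩ ⟨l₁.length + 1, hk⟩)
        (wordTensor n (l₁ ++ a :: b :: l₂)) = wordTensor n (l₁ ++ b :: a :: l₂) := by
  ext f
  set j : Fin n := ⟨l₁.length, Nat.lt_of_succ_lt hk⟩
  set k : Fin n := ⟨l₁.length + 1, hk⟩
  have hjk : j ≠ k := by simp [j, k]
  have h1 : f ∘ Equiv.swap j k = Function.update (Function.update f j (f k)) k (f j) := by
    ext x
    simp only [Function.update_apply, Function.comp_apply, Equiv.swap_apply_def]
    split_ifs <;> simp_all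
  have h2 : f = Function.update (Function.update f j (f j)) k (f k) := by simp
  rw [permOp_apply, wordTensor_apply, wordTensor_apply, h1, ofFn_update_update]
  conv_rhs => rw [h2, ofFn_update_update]
  have h3 : ((List.ofFn f).take l₁.length).length = l₁.length := by
    simp; omega
  have h4 : ∀ (c d c' d' : ι), ((List.ofFn f).take l₁.length ++ c :: d ::
      (List.ofFn f).drop (l₁.length + 2) = l₁ ++ c' :: d' :: l₂) ↔
      ((List.ofFn f).take l₁.length = l₁ ∧ c = c' ∧ d = d' ∧
        (List.ofFn f).drop (l₁.length + 2) = l₂) := by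
    intro c d c' d'
    constructor
    · intro h
      have := List.append_inj h h3
      simpa using this
    · rintro ⟨h, rfl, rfl, h'⟩
      rw [h, h']
  simp only [h4]
  congr 1
  simp only [eq_iff_iff]
  tauto

theorem slice_sum_wordTensor {R : Submodule ℂ (ι × ι → ℂ)} {r : ι × ι → ℂ} (hr : r ∈ R)
    (l₁ l₂ : List ι) {n : ℕ} (hk : l₁.length + 1 < n) (f : Fin n → ι) :
    (fun p : ι × ι => (∑ q : ι × ι, r q • wordTensor n (l₁ ++ q.1 :: q.2 :: l₂))
      (Function.update (Function.update f ⟨l₁.length, Nat.lt_of_succ_lt hk⟩ p.1)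
        ⟨l₁.length + 1, hk⟩ p.2)) ∈ R := by
  have h3 : ((List.ofFn f).take l₁.length).length = l₁.length := by
    simp; omega
  by_cases h : (List.ofFn f).take l₁.length = l₁ ∧ (List.ofFn f).drop (l₁.length + 2) = l₂
  · convert hr using 1
    ext p
    rw [Finset.sum_apply, Finset.sum_eq_single p]
    · rw [Pi.smul_apply, wordTensor_apply, ofFn_update_update, h.1, h.2]
      simp
    · intro q _ hq
      rw [Pi.smul_apply, wordTensor_apply, ofFn_update_update, if_neg, smul_zero]
      intro h'
      have := List.append_inj h' h3
      simp only [List.cons.injEq] at this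
      exact hq (Prod.ext this.2.1.symm this.2.2.1.symm)
    · simp
  · convert R.zero_mem using 1
    ext p
    rw [Finset.sum_apply]
    refine Finset.sum_eq_zero fun q _ => ?_
    rw [Pi.smul_apply, wordTensor_apply, ofFn_update_update, if_neg, smul_zero]
    intro h'
    have := List.append_inj h' h3
    simp only [List.cons.injEq] at this
    exact h ⟨this.1, this.2.2.2⟩

/-- The image of a tensor in the polynomial ring. -/
noncomputable def polyTensor (ι : Type) [Fintype ι] [DecidableEq ι] (n : ℕ) :
    Tensor ι n →ₗ[ℂ] MvPolynomial ι ℂ :=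
  Fintype.linearCombination ℂ fun f : Fin n → ι => ∏ k, MvPolynomial.X (f k)

theorem polyTensor_apply {n : ℕ} (t : Tensor ι n) :
    polyTensor ι n t = ∑ f, t f • ∏ k, MvPolynomial.X (f k) := rfl

theorem polyTensor_permOp {n : ℕ} (s : Equiv.Perm (Fin n)) (t : Tensor ι n) :
    polyTensor ι n (permOp s t) = polyTensor ι n t := by
  rw [polyTensor_apply, polyTensor_apply]
  refine Fintype.sum_equiv (Equiv.arrowCongr s.symm (Equiv.refl ι)) _ _ fun f => ?_
  rw [permOp_apply]
  congr 1
  exact (Equiv.prod_comp s fun k => MvPolynomial.X (f k)).symm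

theorem polyTensor_wordTensor {n : ℕ} {l : List ι} (h : l.length = n) :
    polyTensor ι n (wordTensor n l) = (l.map MvPolynomial.X).prod := by
  obtain ⟨f, rfl⟩ := exists_ofFn_eq h
  rw [wordTensor_ofFn, polyTensor_apply]
  simp [Pi.single_apply, List.prod_ofFn, List.map_ofFn]

theorem polyTensor_tensLeft {n : ℕ} (i : ι) (t : Tensor ι n) :
    polyTensor ι (n + 1) (tensLeft n i t) = MvPolynomial.X i * polyTensor ι n t := by
  have : polyTensor ι (n + 1) ∘ₗ tensLeft n i =
      LinearMap.mulLeft ℂ (MvPolynomial.X i) ∘ₗ polyTensor ι n := by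
    refine tensor_linearMap_ext fun l hl => ?_
    rw [LinearMap.comp_apply, tensLeft_wordTensor, polyTensor_wordTensor (by simp [hl]),
      LinearMap.comp_apply, polyTensor_wordTensor hl]
    simp
  exact LinearMap.congr_fun this t

theorem polyTensor_tensRight {n : ℕ} (i : ι) (t : Tensor ι n) :
    polyTensor ι (n + 1) (tensRight n i t) = MvPolynomial.X i * polyTensor ι n t := by
  have : polyTensor ι (n + 1) ∘ₗ tensRight n i =
      LinearMap.mulLeft ℂ (MvPolynomial.X i) ∘ₗ polyTensor ι n := by
    refine tensor_linearMap_ext fun l hl => ?_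
    rw [LinearMap.comp_apply, tensRight_wordTensor, polyTensor_wordTensor (by simp [hl]),
      LinearMap.comp_apply, polyTensor_wordTensor hl]
    simp [mul_comm]
  exact LinearMap.congr_fun this t

end Tensors

end Quadratic

/-! ### The linear isomorphism with the polynomial ring, and the transported derivations. -/

namespace Quadratic

variable {ι : Type} [Fintype ι] [DecidableEq ι] {L : Finset ι}

namespace Twist

variable {T : Twist L} {R : Submodule ℂ (ι × ι → ℂ)}

/-- A relation inserted in a word becomes, after `sort`, antisymmetric at two positions. Passing to
commuting variables forgets the order of the letters, so the value equals its own negative. -/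
theorem Compatible.respectsRelations (hR : T.Compatible R) : RespectsRelations R
    fun l : List ι => polyTensor ι l.length (T.sort l.length (wordTensor l.length l)) := by
  intro l₁ l₂ r hr
  set n := l₁.length + 1 + 1 + l₂.length
  have hlen : ∀ l : List ι, l.length = n →
      polyTensor ι l.length (T.sort l.length (wordTensor l.length l)) =
        polyTensor ι n (T.sort n (wordTensor n l)) := by
    intro l hl
    rw [hl]
  have hk : l₁.length + 1 < n := by omega
  have h1 := (hR.slices_mem_iff l₁.length hk _).1 (slice_sum_wordTensor hr l₁ l₂ hk)
  have h2 := congrArg (polyTensor ι n) h1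
  rw [polyTensor_permOp, map_neg, self_eq_neg, map_sum, map_sum] at h2
  rw [← h2]
  refine Finset.sum_congr rfl fun p _ => ?_
  rw [map_smul, map_smul]
  exact congrArg (r p • ·) (hlen _ (by simp; omega))

/-- The identification of the quadratic algebra with the polynomial ring, as vector spaces. -/
noncomputable def Compatible.toPoly (hR : T.Compatible R) : Alg R →ₗ[ℂ] MvPolynomial ι ℂ :=
  hR.respectsRelations.lift

theorem Compatible.toPoly_word (hR : T.Compatible R) {n : ℕ} {l : List ι} (h : l.length = n) :
    hR.toPoly (word R l) = polyTensor ι n (T.sort n (wordTensor n l)) := by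
  subst h
  exact hR.respectsRelations.lift_word l

theorem Compatible.toPoly_evalTensor (hR : T.Compatible R) {n : ℕ} (t : Tensor ι n) :
    hR.toPoly (evalTensor R n t) = polyTensor ι n (T.sort n t) := by
  have : hR.toPoly ∘ₗ evalTensor R n = polyTensor ι n ∘ₗ T.sort n :=
    tensor_linearMap_ext fun l hl => by
      rw [LinearMap.comp_apply, evalTensor_wordTensor R hl, hR.toPoly_word hl,
        LinearMap.comp_apply]
  exact LinearMap.congr_fun this t

variable (T R) in
/-- The image of the sorted word in the quadratic algebra. -/
noncomputable def sortedWord (l : List ι) : Alg R :=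
  evalTensor R l.length ((T.sortEquiv l.length).symm (wordTensor l.length l))

theorem sortedWord_eq {n : ℕ} {l : List ι} (h : l.length = n) :
    sortedWord T R l = evalTensor R n ((T.sortEquiv n).symm (wordTensor n l)) := by
  subst h; rfl

/-- The difference of the two words is antisymmetric at the exchanged positions. Its preimage under
`sort` thus consists of relations there and vanishes in the algebra. -/
theorem Compatible.sortedWord_swap (hR : T.Compatible R) (l₁ l₂ : List ι) (a b : ι) :
    sortedWord T R (l₁ ++ a :: b :: l₂) = sortedWord T R (l₁ ++ b :: a :: l₂) := by
  set n := l₁.length + 1 + 1 + l₂.length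
  have hk : l₁.length + 1 < n := by omega
  rw [sortedWord_eq (n := n) (by simp; omega), sortedWord_eq (n := n) (by simp; omega), ← sub_eq_zero,
    ← map_sub, ← map_sub]
  refine evalTensor_eq_zero l₁.length hk ((hR.slices_mem_iff _ hk _).2 ?_)
  rw [T.sort_sortEquiv_symm, map_sub, permOp_wordTensor, permOp_wordTensor, neg_sub]

theorem Compatible.sortedWord_append_perm (hR : T.Compatible R) {l l' : List ι}
    (h : l.Perm l') : ∀ p : List ι, sortedWord T R (p ++ l) = sortedWord T R (p ++ l') := by
  induction h with
  | nil => exact fun p => rfl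
  | cons x _ ih => exact fun p => by simpa using ih (p ++ [x])
  | swap a b l => exact fun p => hR.sortedWord_swap p l b a
  | trans _ _ ih ih' => exact fun p => (ih p).trans (ih' p)

variable (T R) in
/-- The inverse of `toPoly`. -/
noncomputable def ofPoly : MvPolynomial ι ℂ →ₗ[ℂ] Alg R :=
  -- The order of the letters picked by `toList` is irrelevant, by
  -- `Compatible.sortedWord_append_perm`.
  (MvPolynomial.basisMonomials ι ℂ).constr ℂ fun m => sortedWord T R (Finsupp.toMultiset m).toList

theorem ofPoly_monomial (m : ι →₀ ℕ) :
    ofPoly T R (MvPolynomial.monomial m 1) = sortedWord T R (Finsupp.toMultiset m).toList := by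
  have h := congrFun (MvPolynomial.coe_basisMonomials ι ℂ) m
  rw [ofPoly, ← h, Module.Basis.constr_basis]

omit [Fintype ι] in
theorem prod_map_X_eq_monomial (l : List ι) :
    (l.map MvPolynomial.X).prod =
      MvPolynomial.monomial (Multiset.toFinsupp (l : Multiset ι)) (1 : ℂ) := by
  induction l with
  | nil => simp
  | cons a l ih =>
    rw [List.map_cons, List.prod_cons, ih, MvPolynomial.X, MvPolynomial.monomial_mul, one_mul,
      ← Multiset.cons_coe, ← Multiset.singleton_add, map_add, Multiset.toFinsupp_singleton]

theorem Compatible.ofPoly_prod_X (hR : T.Compatible R) (l : List ι) :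
    ofPoly T R (l.map MvPolynomial.X).prod = sortedWord T R l := by
  rw [prod_map_X_eq_monomial, ofPoly_monomial]
  have hp : (Finsupp.toMultiset (Multiset.toFinsupp (l : Multiset ι))).toList.Perm l :=
    Multiset.coe_eq_coe.1 (by rw [Multiset.coe_toList, Multiset.toFinsupp_toMultiset])
  exact hR.sortedWord_append_perm hp []

theorem Compatible.ofPoly_polyTensor (hR : T.Compatible R) {n : ℕ} (t : Tensor ι n) :
    ofPoly T R (polyTensor ι n t) = evalTensor R n ((T.sortEquiv n).symm t) := by
  have : ofPoly T R ∘ₗ polyTensor ι n = evalTensor R n ∘ₗ (T.sortEquiv n).symm.toLinearMap :=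
    tensor_linearMap_ext fun l hl => by
      rw [LinearMap.comp_apply, polyTensor_wordTensor hl, hR.ofPoly_prod_X, sortedWord_eq hl]
      rfl
  exact LinearMap.congr_fun this t

theorem Compatible.ofPoly_toPoly (hR : T.Compatible R) (a : Alg R) :
    ofPoly T R (hR.toPoly a) = a := by
  have : ofPoly T R ∘ₗ hR.toPoly = LinearMap.id := linearMap_ext_words fun l => by
    rw [LinearMap.comp_apply, hR.toPoly_word rfl, hR.ofPoly_polyTensor, LinearMap.id_apply,
      ← sortEquiv_apply, LinearEquiv.symm_apply_apply, evalTensor_wordTensor R rfl]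
  exact LinearMap.congr_fun this a

theorem Compatible.toPoly_sortedWord (hR : T.Compatible R) (l : List ι) :
    hR.toPoly (sortedWord T R l) = (l.map MvPolynomial.X).prod := by
  rw [sortedWord, hR.toPoly_evalTensor, sort_sortEquiv_symm, polyTensor_wordTensor rfl]

theorem Compatible.toPoly_ofPoly (hR : T.Compatible R) (p : MvPolynomial ι ℂ) :
    hR.toPoly (ofPoly T R p) = p := by
  have : hR.toPoly ∘ₗ ofPoly T R = LinearMap.id :=
    (MvPolynomial.basisMonomials ι ℂ).ext fun m => by
      rw [MvPolynomial.coe_basisMonomials, LinearMap.comp_apply, ofPoly_monomial,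
        hR.toPoly_sortedWord, prod_map_X_eq_monomial]
      simp
  exact LinearMap.congr_fun this p

/-- The identification of the quadratic algebra with the polynomial ring, as vector spaces. -/
noncomputable def Compatible.polyEquiv (hR : T.Compatible R) : Alg R ≃ₗ[ℂ] MvPolynomial ι ℂ :=
  LinearEquiv.ofLinearMap hR.toPoly (ofPoly T R) (LinearMap.ext hR.toPoly_ofPoly)
    (LinearMap.ext hR.ofPoly_toPoly)

theorem Compatible.polyEquiv_word (hR : T.Compatible R) {n : ℕ} {l : List ι} (h : l.length = n) :
    hR.polyEquiv (word R l) = polyTensor ι n (T.sort n (wordTensor n l)) := hR.toPoly_word h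

/-- Prefixing a letter of `L` commutes with `sort`; this is the part of the multiplication that the
isomorphism respects on the left. On the right it respects the letters outside `L`. -/
theorem Compatible.polyEquiv_gen_mul (hR : T.Compatible R) {i : ι} (hi : i ∈ L) (a : Alg R) :
    hR.polyEquiv (gen R i * a) = MvPolynomial.X i * hR.polyEquiv a := by
  have : hR.polyEquiv.toLinearMap ∘ₗ LinearMap.mulLeft ℂ (gen R i) =
      LinearMap.mulLeft ℂ (MvPolynomial.X i) ∘ₗ hR.polyEquiv.toLinearMap := by
    refine linearMap_ext_words fun l => ?_
    simp only [LinearMap.comp_apply, LinearMap.mulLeft_apply, ← word_cons, LinearEquiv.coe_coe]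
    rw [hR.polyEquiv_word (n := l.length + 1) (by simp), hR.polyEquiv_word rfl,
      ← tensLeft_wordTensor, ← polyTensor_tensLeft]
    exact congrArg _ (LinearMap.congr_fun (T.tensLeft_sort hi) _).symm
  exact LinearMap.congr_fun this a

theorem Compatible.polyEquiv_mul_gen (hR : T.Compatible R) {i : ι} (hi : i ∉ L) (a : Alg R) :
    hR.polyEquiv (a * gen R i) = MvPolynomial.X i * hR.polyEquiv a := by
  have : hR.polyEquiv.toLinearMap ∘ₗ LinearMap.mulRight ℂ (gen R i) =
      LinearMap.mulLeft ℂ (MvPolynomial.X i) ∘ₗ hR.polyEquiv.toLinearMap := by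
    refine linearMap_ext_words fun l => ?_
    simp only [LinearMap.comp_apply, LinearMap.mulLeft_apply, LinearMap.mulRight_apply,
      ← word_concat, LinearEquiv.coe_coe]
    rw [hR.polyEquiv_word (n := l.length + 1) (by simp), hR.polyEquiv_word rfl,
      ← tensRight_wordTensor, ← polyTensor_tensRight]
    exact congrArg _ (LinearMap.congr_fun (T.tensRight_sort hi) _).symm
  exact LinearMap.congr_fun this a

/-- The derivation `∂_i`, transported to the quadratic algebra. -/
noncomputable def Compatible.deriv (hR : T.Compatible R) (i : ι) : Module.End ℂ (Alg R) :=
  hR.polyEquiv.symm.toLinearMap ∘ₗ (MvPolynomial.pderiv i).toLinearMap ∘ₗ hR.polyEquiv.toLinearMap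

theorem Compatible.polyEquiv_deriv (hR : T.Compatible R) (i : ι) (a : Alg R) :
    hR.polyEquiv (hR.deriv i a) = MvPolynomial.pderiv i (hR.polyEquiv a) := by
  simp [deriv]

theorem Compatible.deriv_gen_mul (hR : T.Compatible R) {i : ι} (hi : i ∈ L) (j : ι) (a : Alg R) :
    hR.deriv j (gen R i * a) = gen R i * hR.deriv j a + (if i = j then (1 : ℂ) else 0) • a := by
  refine hR.polyEquiv.injective ?_
  rw [hR.polyEquiv_deriv, hR.polyEquiv_gen_mul hi, Derivation.leibniz, map_add,
    hR.polyEquiv_gen_mul hi, hR.polyEquiv_deriv, map_smul, MvPolynomial.pderiv_X, Pi.single_apply]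
  split_ifs <;> simp_all

theorem Compatible.deriv_mul_gen (hR : T.Compatible R) {i : ι} (hi : i ∉ L) (j : ι) (a : Alg R) :
    hR.deriv j (a * gen R i) = hR.deriv j a * gen R i + (if i = j then (1 : ℂ) else 0) • a := by
  refine hR.polyEquiv.injective ?_
  rw [hR.polyEquiv_deriv, hR.polyEquiv_mul_gen hi, Derivation.leibniz, map_add,
    hR.polyEquiv_mul_gen hi, hR.polyEquiv_deriv, map_smul, MvPolynomial.pderiv_X, Pi.single_apply]
  split_ifs <;> simp_all

omit [Fintype ι] in
theorem sum_X_mul_pderiv (S : Finset ι) (l : List ι) :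
    ∑ s ∈ S, MvPolynomial.X s * MvPolynomial.pderiv s ((l.map MvPolynomial.X).prod) =
      ((l.countP (· ∈ S) : ℕ) : ℂ) • (l.map (MvPolynomial.X (R := ℂ))).prod := by
  induction l with
  | nil => simp
  | cons a l ih =>
    simp only [List.map_cons, List.prod_cons, Derivation.leibniz, MvPolynomial.pderiv_X, mul_add,
      smul_eq_mul, Finset.sum_add_distrib, List.countP_cons, Nat.cast_add, add_smul,
      mul_left_comm _ (MvPolynomial.X a)]
    rw [← Finset.mul_sum, ih, mul_smul_comm]
    congr 1
    simp only [Pi.single_apply, mul_ite, mul_one, mul_zero]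
    rw [Finset.sum_ite_eq S a]
    by_cases h : a ∈ S <;> simp [h, mul_comm]

omit [Fintype ι] in
theorem letterCount_eq_countP (S : Finset ι) {n : ℕ} (f : Fin n → ι) :
    letterCount S f = (List.ofFn f).countP (· ∈ S) := by
  induction n with
  | zero => simp [letterCount]
  | succ n ih =>
    refine Fin.consCases (fun a f => ?_) f
    rw [letterCount, Fin.sum_univ_succ]
    have := ih f
    rw [letterCount] at this
    simp only [Fin.cons_zero, Fin.cons_succ, this, List.ofFn_succ, List.countP_cons]
    by_cases h : a ∈ S <;> simp [h, add_comm]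

theorem sum_X_mul_pderiv_polyTensor (S : Finset ι) {n : ℕ} (t : Tensor ι n) :
    ∑ s ∈ S, MvPolynomial.X s * MvPolynomial.pderiv s (polyTensor ι n t) =
      polyTensor ι n (countOp S n t) := by
  simp only [polyTensor_apply, map_sum, Derivation.map_smul, Finset.mul_sum, mul_smul_comm]
  rw [Finset.sum_comm]
  refine Finset.sum_congr rfl fun f _ => ?_
  have := sum_X_mul_pderiv S (List.ofFn f)
  rw [← letterCount_eq_countP, List.map_ofFn, List.prod_ofFn] at this
  simp only [Function.comp_apply] at this
  rw [← Finset.smul_sum, this, countOp_apply, smul_smul, mul_comm]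

/-- The operator counting the letters in `S` in the words. -/
noncomputable def Compatible.algCount (hR : T.Compatible R) (S : Finset ι) :
    Module.End ℂ (Alg R) :=
  hR.polyEquiv.symm.toLinearMap ∘ₗ (∑ s ∈ S, LinearMap.mulLeft ℂ (MvPolynomial.X s) ∘ₗ
    (MvPolynomial.pderiv s).toLinearMap) ∘ₗ hR.polyEquiv.toLinearMap

theorem Compatible.polyEquiv_algCount (hR : T.Compatible R) (S : Finset ι) (a : Alg R) :
    hR.polyEquiv (hR.algCount S a) =
      ∑ s ∈ S, MvPolynomial.X s * MvPolynomial.pderiv s (hR.polyEquiv a) := by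
  simp [algCount]

/-- Since `sort` preserves the number of letters in a saturated set, the Euler operator counts
letters in words of the algebra itself. In particular it does not depend on the twist, so results
from two twists can be added. -/
theorem Compatible.algCount_word (hR : T.Compatible R) {S : Finset ι} (hS : Saturated L S)
    (l : List ι) : hR.algCount S (word R l) = ((l.countP (· ∈ S) : ℕ) : ℂ) • word R l := by
  refine hR.polyEquiv.injective ?_
  obtain ⟨f, hf⟩ := exists_ofFn_eq (l := l) rfl
  rw [hR.polyEquiv_algCount, map_smul, hR.polyEquiv_word rfl, sum_X_mul_pderiv_polyTensor,
    ← T.sort_countOp hS, ← map_smul, ← map_smul]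
  congr 2
  rw [← hf, ← letterCount_eq_countP, hf]
  ext g
  rw [countOp_apply, Pi.smul_apply, wordTensor_apply]
  by_cases h : List.ofFn g = l
  · have h' : g = f := List.ofFn_injective (h.trans hf.symm)
    rw [if_pos h, h', smul_eq_mul]
  · simp [h]

omit [Fintype ι] [DecidableEq ι] in
theorem pderiv_comm (i j : ι) (p : MvPolynomial ι ℂ) :
    MvPolynomial.pderiv i (MvPolynomial.pderiv j p) =
      MvPolynomial.pderiv j (MvPolynomial.pderiv i p) := by
  classical
  have : ⁅MvPolynomial.pderiv (R := ℂ) i, MvPolynomial.pderiv (R := ℂ) j⁆ = 0 := by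
    refine MvPolynomial.derivation_ext fun k => ?_
    rw [Derivation.commutator_apply, MvPolynomial.pderiv_X, MvPolynomial.pderiv_X]
    simp only [Pi.single_apply]
    split_ifs <;> simp
  have h := congrArg (fun D => D p) this
  rw [Derivation.commutator_apply] at h
  exact sub_eq_zero.1 h

omit [Fintype ι] in
theorem sum_X_mul_pderiv_pderiv {S : Finset ι} {s : ι} (hs : s ∈ S) (p : MvPolynomial ι ℂ) :
    ∑ t ∈ S, MvPolynomial.X t * MvPolynomial.pderiv t (MvPolynomial.pderiv s p) =
      MvPolynomial.pderiv s (∑ t ∈ S, MvPolynomial.X t * MvPolynomial.pderiv t p) -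
        MvPolynomial.pderiv s p := by
  have h : ∀ t ∈ S, MvPolynomial.pderiv s (MvPolynomial.X t * MvPolynomial.pderiv t p) =
      MvPolynomial.X t * MvPolynomial.pderiv t (MvPolynomial.pderiv s p) +
        if t = s then MvPolynomial.pderiv s p else 0 := by
    intro t _
    rw [Derivation.leibniz, MvPolynomial.pderiv_X, Pi.single_apply, pderiv_comm s t, smul_eq_mul,
      smul_eq_mul]
    by_cases hts : t = s
    · rw [if_pos hts, if_pos hts, mul_one, hts]
    · rw [if_neg hts, if_neg hts, mul_zero]
  rw [map_sum, Finset.sum_congr rfl h, Finset.sum_add_distrib, Finset.sum_ite_eq', if_pos hs,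
    add_sub_cancel_right]

theorem Compatible.algCount_deriv (hR : T.Compatible R) {S : Finset ι} {s : ι} (hs : s ∈ S)
    (a : Alg R) : hR.algCount S (hR.deriv s a) = hR.deriv s (hR.algCount S a) - hR.deriv s a := by
  refine hR.polyEquiv.injective ?_
  rw [hR.polyEquiv_algCount, map_sub, hR.polyEquiv_deriv, hR.polyEquiv_deriv,
    hR.polyEquiv_algCount]
  exact sum_X_mul_pderiv_pderiv hs _

theorem Compatible.algCount_eq_gen_mul_deriv (hR : T.Compatible R) (a : Alg R) :
    hR.algCount L a = ∑ s ∈ L, gen R s * hR.deriv s a := by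
  refine hR.polyEquiv.injective ?_
  rw [hR.polyEquiv_algCount, map_sum]
  refine Finset.sum_congr rfl fun s hs => ?_
  rw [hR.polyEquiv_gen_mul hs, hR.polyEquiv_deriv]

theorem Compatible.algCount_eq_deriv_mul_gen (hR : T.Compatible R) (a : Alg R) :
    hR.algCount Lᶜ a = ∑ s ∈ Lᶜ, hR.deriv s a * gen R s := by
  refine hR.polyEquiv.injective ?_
  rw [hR.polyEquiv_algCount, map_sum]
  refine Finset.sum_congr rfl fun s hs => ?_
  rw [hR.polyEquiv_mul_gen (Finset.mem_compl.1 hs), hR.polyEquiv_deriv]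

end Twist

end Quadratic

/-! ### Diagonalizable operators and the partial Koszul homotopy. -/

namespace Quadratic

variable {ι : Type} [Fintype ι] [DecidableEq ι]

section Diagonalizable

variable {V : Type*} [AddCommGroup V] [Module ℂ V]

/-- Here `z₀` is the component of `z` of eigenvalue 0. On the other, finitely many, components a
power of `E` is inverted by an interpolation polynomial in `E`. -/
theorem exists_aeval_eq_of_mem_iSup_eigenspace (E : Module.End ℂ V) {z : V}
    (hz : z ∈ ⨆ c, Module.End.eigenspace E c) :
    ∃ z₀ : V, E z₀ = 0 ∧ ∀ k : ℕ, ∃ q : Polynomial ℂ,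
      Polynomial.aeval E q ((E ^ (k + 1)) z) = z - z₀ := by
  obtain ⟨f, hf, rfl⟩ := (Submodule.mem_iSup_iff_exists_finsupp _ _).1 hz
  have hE : ∀ c, E (f c) = c • f c := fun c => Module.End.mem_eigenspace_iff.1 (hf c)
  refine ⟨f 0, by rw [hE, zero_smul], fun k => ?_⟩
  -- At an eigenvalue 0 the prescribed value is `0⁻¹ = 0`; it is harmless, being multiplied by `0 ^
  -- (k + 1)`.
  refine ⟨Lagrange.interpolate f.support id fun c => (c ^ (k + 1))⁻¹, ?_⟩
  set q := Lagrange.interpolate f.support id fun c => (c ^ (k + 1))⁻¹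
  have hpow : ∀ c, (E ^ (k + 1)) (f c) = c ^ (k + 1) • f c := by
    intro c
    have h := (Module.End.HasEigenvector.pow_apply (f := E) (μ := c) (v := f c) · (k + 1))
    by_cases h0 : f c = 0
    · simp [h0]
    · exact h ⟨hf c, h0⟩
  have hq : ∀ c ∈ f.support, Polynomial.aeval E q (f c) = (c ^ (k + 1))⁻¹ • f c := by
    intro c hc
    rw [Module.End.aeval_apply_of_hasEigenvector ⟨hf c, Finsupp.mem_support_iff.1 hc⟩]
    congr 1
    exact Lagrange.eval_interpolate_at_node (v := id) _ (Function.injective_id.injOn) hc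
  have hsum : (f.sum fun _ x => id x) = ∑ c ∈ f.support, f c := rfl
  have hz0 : f 0 = ∑ c ∈ f.support, if c = 0 then f c else 0 := by
    rw [Finset.sum_ite_eq']
    split_ifs with h
    · rfl
    · exact Finsupp.notMem_support_iff.1 h
  change Polynomial.aeval E q ((E ^ (k + 1)) (∑ c ∈ f.support, f c)) = (∑ c ∈ f.support, f c) - f 0
  rw [hz0, map_sum, map_sum, ← Finset.sum_sub_distrib]
  refine Finset.sum_congr rfl fun c hc => ?_
  rw [hpow, map_smul, hq c hc, smul_smul]
  split_ifs with h
  · simp [h]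
  · rw [mul_inv_cancel₀ (pow_ne_zero _ h), one_smul, sub_zero]

/-- If a power of a diagonalizable operator maps `z` into a stable subspace, then `z` lies in this
subspace up to an element of the kernel. -/
theorem exists_sub_mem_of_pow_apply_mem {E : Module.End ℂ V}
    (hE : ⨆ c, Module.End.eigenspace E c = ⊤) {B : Submodule ℂ V} (hB : ∀ b ∈ B, E b ∈ B) (z : V) :
    ∃ z₀ : V, E z₀ = 0 ∧ ∀ k : ℕ, (E ^ (k + 1)) z ∈ B → z - z₀ ∈ B := by
  obtain ⟨z₀, h0, h⟩ := exists_aeval_eq_of_mem_iSup_eigenspace E (z := z) (hE ▸ trivial)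
  refine ⟨z₀, h0, fun k hk => ?_⟩
  obtain ⟨q, hq⟩ := h k
  rw [← hq]
  have hp : ∀ m : ℕ, ∀ b ∈ B, (E ^ m) b ∈ B := by
    intro m
    induction m with
    | zero => exact fun b hb => by simpa using hb
    | succ m ih =>
      intro b hb
      rw [pow_succ', Module.End.mul_apply]
      exact hB _ (ih b hb)
  rw [Polynomial.aeval_eq_sum_range, LinearMap.sum_apply]
  -- `z - z₀` is a polynomial in `E` applied to an element of `B`, and `B` is stable under `E`.
  refine B.sum_mem fun m _ => ?_
  rw [LinearMap.smul_apply]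
  exact B.smul_mem _ (hp m _ hk)

theorem map_add_map_eigenspace {A U : Type*} [AddCommGroup A] [Module ℂ A] [AddCommGroup U]
    [Module ℂ U] {ν : Module.End ℂ A} {μ : Module.End ℂ U}
    (hν : ⨆ c, Module.End.eigenspace ν c = ⊤) (hμ : ⨆ c, Module.End.eigenspace μ c = ⊤) :
    ⨆ c, Module.End.eigenspace
      (TensorProduct.map ν LinearMap.id + TensorProduct.map LinearMap.id μ) c = ⊤ := by
  set E := TensorProduct.map ν LinearMap.id + TensorProduct.map LinearMap.id μ
  have key : ∀ c c' : ℂ, ∀ a ∈ Module.End.eigenspace ν c, ∀ u ∈ Module.End.eigenspace μ c',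
      a ⊗ₜ[ℂ] u ∈ ⨆ c, Module.End.eigenspace E c := by
    intro c c' a ha u hu
    refine Submodule.mem_iSup_of_mem (c + c') (Module.End.mem_eigenspace_iff.2 ?_)
    rw [Module.End.mem_eigenspace_iff] at ha hu
    simp only [E, LinearMap.add_apply, TensorProduct.map_tmul, ha, hu, LinearMap.id_apply,
      TensorProduct.smul_tmul', TensorProduct.tmul_smul, add_smul]
  rw [eq_top_iff, ← TensorProduct.span_tmul_eq_top ℂ A U, Submodule.span_le]
  rintro _ ⟨a, u, rfl⟩
  have ha : a ∈ ⨆ c, Module.End.eigenspace ν c := hν ▸ trivial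
  have hu : u ∈ ⨆ c, Module.End.eigenspace μ c := hμ ▸ trivial
  refine Submodule.iSup_induction _ (motive := fun a => a ⊗ₜ[ℂ] u ∈ ⨆ c, Module.End.eigenspace E c)
    ha (fun c a ha => ?_) (by simp) fun a b ha hb => ?_
  · refine Submodule.iSup_induction _
      (motive := fun u => a ⊗ₜ[ℂ] u ∈ ⨆ c, Module.End.eigenspace E c)
      hu (fun c' u hu => key c c' a ha u hu) (by simp) fun u v hu hv => ?_
    rw [TensorProduct.tmul_add]
    exact Submodule.add_mem _ hu hv
  · rw [TensorProduct.add_tmul]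
    exact Submodule.add_mem _ ha hb

theorem iSup_eigenspace_eq_top_of_proj {μ : Module.End ℂ V} {m : ℕ} {P : ℕ → Module.End ℂ V}
    (hP : ∀ v, ∑ c ∈ Finset.range m, P c v = v) {e : ℕ → ℂ} (hμ : ∀ c v, μ (P c v) = e c • P c v) :
    ⨆ c, Module.End.eigenspace μ c = ⊤ := by
  refine eq_top_iff.2 fun v _ => ?_
  rw [← hP v]
  exact Submodule.sum_mem _ fun c _ =>
    Submodule.mem_iSup_of_mem (e c) (Module.End.mem_eigenspace_iff.2 (hμ c v))

/-- An operator lowering the eigenvalues of another one, which are natural numbers at most `m`, is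
nilpotent. -/
theorem pow_apply_eq_zero_of_lowering {M N : Module.End ℂ V} {m : ℕ} {P : ℕ → Module.End ℂ V}
    (hP : ∀ v, ∑ c ∈ Finset.range (m + 1), P c v = v) (h1 : ∀ c v, M (P c v) = (c : ℂ) • P c v)
    (h2 : ∀ c v, P c (M v) = (c : ℂ) • P c v) (hN : ∀ v, M (N v) = N (M v) - N v) (v : V) :
    (N ^ (m + 1)) v = 0 := by
  have hpow : ∀ (k : ℕ) (v : V), M ((N ^ k) v) = (N ^ k) (M v) - (k : ℂ) • (N ^ k) v := by
    intro k
    induction k with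
    | zero => simp
    | succ k ih =>
      intro v
      rw [pow_succ', Module.End.mul_apply, hN, ih, map_sub, map_smul, Module.End.mul_apply]
      push_cast
      module
  have hv : ∀ c ∈ Finset.range (m + 1), (N ^ (m + 1)) (P c v) = 0 := by
    intro c hc
    rw [← hP ((N ^ (m + 1)) (P c v))]
    refine Finset.sum_eq_zero fun c' _ => ?_
    -- The vector has eigenvalue c - (m + 1) < 0, so its component of eigenvalue c' ≥ 0 vanishes.
    have h := h2 c' ((N ^ (m + 1)) (P c v))
    rw [hpow, h1, map_smul, ← sub_smul, map_smul, ← sub_eq_zero, ← sub_smul, smul_eq_zero] at h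
    refine h.resolve_left fun h0 => ?_
    have h3 : (c : ℂ) = ((m + 1 + c' : ℕ) : ℂ) := by
      push_cast at h0 ⊢
      linear_combination h0
    have := Nat.cast_injective h3
    rw [Finset.mem_range] at hc
    omega
  rw [← hP v, map_sum, Finset.sum_eq_zero hv]

end Diagonalizable

section Homotopy

variable {A : Type*} [AddCommGroup A] [Module ℂ A]
  {U V W : Type*} [AddCommGroup U] [Module ℂ U] [AddCommGroup V] [Module ℂ V]
  [AddCommGroup W] [Module ℂ W]

/-- Operators `r i` and `δ s` satisfying the Weyl relations for indices in `S`, and the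
corresponding counting operator. -/
structure IsWeyl (S : Finset ι) (r δ : ι → Module.End ℂ A) (ν : Module.End ℂ A) : Prop where
  deriv_mul : ∀ i ∈ S, ∀ s ∈ S, ∀ a, δ s (r i a) = r i (δ s a) + (if i = s then (1 : ℂ) else 0) • a
  sum_mul_deriv : ∀ a, ∑ s ∈ S, r s (δ s a) = ν a
  count_mul : ∀ i a, ν (r i a) = r i (ν a) + (if i ∈ S then (1 : ℂ) else 0) • r i a
  count_deriv : ∀ s ∈ S, ∀ a, ν (δ s a) = δ s (ν a) - δ s a
  iSup_eigenspace : ⨆ c, Module.End.eigenspace ν c = ⊤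

/-- Operators lowering and raising the number of indices in `S` and of indices not in `S`. -/
structure IsLadder (S : Finset ι) (D : ι → V →ₗ[ℂ] W) (C : ι → W →ₗ[ℂ] V)
    (μ μc : Module.End ℂ V) (μ' μc' : Module.End ℂ W) : Prop where
  count_lower : ∀ i v, μ' (D i v) = D i (μ v) - (if i ∈ S then (1 : ℂ) else 0) • D i v
  count_raise : ∀ s ∈ S, ∀ w, μ (C s w) = C s (μ' w) + C s w
  cocount_lower : ∀ i ∉ S, ∀ v, μc' (D i v) = D i (μc v) - D i v
  cocount_raise : ∀ s ∈ S, ∀ w, μc (C s w) = C s (μc' w)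

/-- The differential `∑ r_i ⊗ D_i`. -/
noncomputable def koszulMap (r : ι → Module.End ℂ A) (D : ι → V →ₗ[ℂ] W) : A ⊗[ℂ] V →ₗ[ℂ] A ⊗[ℂ] W :=
  ∑ i, TensorProduct.map (r i) (D i)

theorem koszulMap_tmul (r : ι → Module.End ℂ A) (D : ι → V →ₗ[ℂ] W) (a : A) (v : V) :
    koszulMap r D (a ⊗ₜ v) = ∑ i, r i a ⊗ₜ D i v := by
  simp [koszulMap]

/-- The partial homotopy `∑ δ_s ⊗ C_s`. -/
noncomputable def homotopy (S : Finset ι) (δ : ι → Module.End ℂ A) (C : ι → W →ₗ[ℂ] V) :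
    A ⊗[ℂ] W →ₗ[ℂ] A ⊗[ℂ] V :=
  ∑ s ∈ S, TensorProduct.map (δ s) (C s)

theorem homotopy_tmul (S : Finset ι) (δ : ι → Module.End ℂ A) (C : ι → W →ₗ[ℂ] V) (a : A) (w : W) :
    homotopy S δ C (a ⊗ₜ w) = ∑ s ∈ S, δ s a ⊗ₜ C s w := by
  simp [homotopy]

/-- The operator `ν ⊗ 1 + 1 ⊗ μ`. -/
noncomputable def totalCount (ν : Module.End ℂ A) (μ : Module.End ℂ V) : Module.End ℂ (A ⊗[ℂ] V) :=
  TensorProduct.map ν LinearMap.id + TensorProduct.map LinearMap.id μ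

theorem totalCount_tmul (ν : Module.End ℂ A) (μ : Module.End ℂ V) (a : A) (v : V) :
    totalCount ν μ (a ⊗ₜ v) = ν a ⊗ₜ v + a ⊗ₜ μ v := by
  simp [totalCount]

variable {S : Finset ι} {r δ : ι → Module.End ℂ A} {ν : Module.End ℂ A}

/-- For an index in `S` the first factor gains the unit of the count that the second loses; for
other indices neither changes. -/
theorem totalCount_koszulMap (hA : IsWeyl S r δ ν) {D : ι → V →ₗ[ℂ] W} {C : ι → W →ₗ[ℂ] V}
    {μ μc : Module.End ℂ V} {μ' μc' : Module.End ℂ W} (h : IsLadder S D C μ μc μ' μc')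
    (z : A ⊗[ℂ] V) :
    totalCount ν μ' (koszulMap r D z) = koszulMap r D (totalCount ν μ z) := by
  have : totalCount ν μ' ∘ₗ koszulMap r D = koszulMap r D ∘ₗ totalCount ν μ := by
    refine TensorProduct.ext' fun a v => ?_
    simp only [LinearMap.comp_apply, totalCount_tmul, koszulMap_tmul, map_sum, map_add, hA.count_mul,
      h.count_lower]
    rw [← Finset.sum_add_distrib]
    refine Finset.sum_congr rfl fun i _ => ?_
    split_ifs <;> simp [TensorProduct.add_tmul, TensorProduct.tmul_sub]
  exact LinearMap.congr_fun this z

theorem totalCount_homotopy (hA : IsWeyl S r δ ν) {D : ι → V →ₗ[ℂ] W} {C : ι → W →ₗ[ℂ] V}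
    {μ μc : Module.End ℂ V} {μ' μc' : Module.End ℂ W} (h : IsLadder S D C μ μc μ' μc')
    (z : A ⊗[ℂ] W) :
    totalCount ν μ (homotopy S δ C z) = homotopy S δ C (totalCount ν μ' z) := by
  have : totalCount ν μ ∘ₗ homotopy S δ C = homotopy S δ C ∘ₗ totalCount ν μ' := by
    refine TensorProduct.ext' fun a v => ?_
    simp only [LinearMap.comp_apply, totalCount_tmul, homotopy_tmul, map_sum, map_add]
    rw [← Finset.sum_add_distrib]
    refine Finset.sum_congr rfl fun s hs => ?_
    rw [hA.count_deriv s hs, h.count_raise s hs, TensorProduct.sub_tmul, TensorProduct.tmul_add]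
    abel
  exact LinearMap.congr_fun this z

/-- The part of the homotopy formula mixing indices in `S` and not in `S`. -/
noncomputable def crossTerm (S : Finset ι) (r δ : ι → Module.End ℂ A) (D : ι → V →ₗ[ℂ] W)
    (C : ι → W →ₗ[ℂ] V) (D' : ι → U →ₗ[ℂ] V) (C' : ι → V →ₗ[ℂ] U) : Module.End ℂ (A ⊗[ℂ] V) :=
  ∑ i ∈ Sᶜ, ∑ s ∈ S, (TensorProduct.map (r i ∘ₗ δ s) (D' i ∘ₗ C' s) +
    TensorProduct.map (δ s ∘ₗ r i) (C s ∘ₗ D i))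

theorem crossTerm_tmul (S : Finset ι) (r δ : ι → Module.End ℂ A) (D : ι → V →ₗ[ℂ] W)
    (C : ι → W →ₗ[ℂ] V) (D' : ι → U →ₗ[ℂ] V) (C' : ι → V →ₗ[ℂ] U) (a : A) (v : V) :
    crossTerm S r δ D C D' C' (a ⊗ₜ v) = ∑ i ∈ Sᶜ, ∑ s ∈ S,
      (r i (δ s a) ⊗ₜ D' i (C' s v) + δ s (r i a) ⊗ₜ C s (D i v)) := by
  simp only [crossTerm, LinearMap.sum_apply, LinearMap.add_apply, TensorProduct.map_tmul,
    LinearMap.comp_apply]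

theorem koszulMap_homotopy_add (hA : IsWeyl S r δ ν) {D : ι → V →ₗ[ℂ] W} {C : ι → W →ₗ[ℂ] V}
    {D' : ι → U →ₗ[ℂ] V} {C' : ι → V →ₗ[ℂ] U} {μ : Module.End ℂ V}
    (hDC : ∀ s ∈ S, ∀ t ∈ S, ∀ v, D' t (C' s v) + C s (D t v) =
      (if t = s then (1 : ℂ) else 0) • v)
    (hμ : ∀ v, ∑ s ∈ S, C s (D s v) = μ v) (z : A ⊗[ℂ] V) :
    koszulMap r D' (homotopy S δ C' z) + homotopy S δ C (koszulMap r D z) =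
      totalCount ν μ z + crossTerm S r δ D C D' C' z := by
  have : koszulMap r D' ∘ₗ homotopy S δ C' + homotopy S δ C ∘ₗ koszulMap r D =
      totalCount ν μ + crossTerm S r δ D C D' C' := by
    refine TensorProduct.ext' fun a v => ?_
    simp only [LinearMap.add_apply, LinearMap.comp_apply, totalCount_tmul, homotopy_tmul, map_sum,
      koszulMap_tmul, crossTerm_tmul]
    rw [Finset.sum_comm, ← Finset.sum_add_distrib, ← Finset.sum_add_sum_compl S]
    congr 1
    · rw [← hA.sum_mul_deriv, ← hμ, TensorProduct.sum_tmul, TensorProduct.tmul_sum,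
        ← Finset.sum_add_distrib]
      refine Finset.sum_congr rfl fun i hi => ?_
      rw [← Finset.sum_add_distrib]
      have h : ∀ s ∈ S, r i (δ s a) ⊗ₜ[ℂ] D' i (C' s v) + δ s (r i a) ⊗ₜ[ℂ] C s (D i v) =
          if i = s then r i (δ s a) ⊗ₜ[ℂ] v + a ⊗ₜ[ℂ] C s (D i v) else 0 := by
        intro s hs
        rw [hA.deriv_mul i hi s hs, eq_sub_of_add_eq (hDC s hs i hi v), TensorProduct.tmul_sub,
          TensorProduct.add_tmul]
        split_ifs
        · rw [one_smul, one_smul]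
          abel
        · simp
      rw [Finset.sum_congr rfl h, Finset.sum_ite_eq, if_pos hi]
    · exact Finset.sum_congr rfl fun i _ => Finset.sum_add_distrib.symm
  exact LinearMap.congr_fun this z

/-- Each summand contains one lowering operator with an index outside `S` and one raising operator
with an index in `S`, so the count outside `S` drops by exactly one. This is the source of
nilpotency. -/
theorem cocount_crossTerm {D : ι → V →ₗ[ℂ] W} {C : ι → W →ₗ[ℂ] V} {D' : ι → U →ₗ[ℂ] V}
    {C' : ι → V →ₗ[ℂ] U} {μ₁ μc₁ : Module.End ℂ U} {μ μc : Module.End ℂ V}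
    {μ' μc' : Module.End ℂ W} (h : IsLadder S D C μ μc μ' μc') (h' : IsLadder S D' C' μ₁ μc₁ μ μc)
    (z : A ⊗[ℂ] V) :
    TensorProduct.map LinearMap.id μc (crossTerm S r δ D C D' C' z) =
      crossTerm S r δ D C D' C' (TensorProduct.map LinearMap.id μc z) -
        crossTerm S r δ D C D' C' z := by
  have : TensorProduct.map LinearMap.id μc ∘ₗ crossTerm S r δ D C D' C' =
      crossTerm S r δ D C D' C' ∘ₗ TensorProduct.map LinearMap.id μc -
        crossTerm S r δ D C D' C' := by
    refine TensorProduct.ext' fun a v => ?_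
    simp only [LinearMap.sub_apply, LinearMap.comp_apply, TensorProduct.map_tmul, map_sum,
      crossTerm_tmul, ← Finset.sum_sub_distrib, LinearMap.id_apply]
    refine Finset.sum_congr rfl fun i hi => Finset.sum_congr rfl fun s hs => ?_
    rw [Finset.mem_compl] at hi
    rw [map_add, TensorProduct.map_tmul, TensorProduct.map_tmul, h'.cocount_lower i hi,
      h'.cocount_raise s hs, h.cocount_raise s hs, h.cocount_lower i hi]
    simp only [LinearMap.id_apply, TensorProduct.tmul_sub, map_sub]
    abel
  exact LinearMap.congr_fun this z

/-- On cycles, the counting operator of the indices in `S` takes its values in the boundaries. -/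
theorem totalCount_mem_range (hA : IsWeyl S r δ ν) {D : ι → V →ₗ[ℂ] W} {C : ι → W →ₗ[ℂ] V}
    {D' : ι → U →ₗ[ℂ] V} {C' : ι → V →ₗ[ℂ] U} {μ₁ μc₁ : Module.End ℂ U} {μ μc : Module.End ℂ V}
    {μ' μc' : Module.End ℂ W} (h : IsLadder S D C μ μc μ' μc') (h' : IsLadder S D' C' μ₁ μc₁ μ μc)
    (hDC : ∀ s ∈ S, ∀ t ∈ S, ∀ v, D' t (C' s v) + C s (D t v) =
      (if t = s then (1 : ℂ) else 0) • v)
    (hμ : ∀ v, ∑ s ∈ S, C s (D s v) = μ v)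
    (hμdiag : ⨆ c, Module.End.eigenspace μ c = ⊤) {m : ℕ} {P : ℕ → Module.End ℂ V}
    (hP : ∀ v, ∑ c ∈ Finset.range (m + 1), P c v = v)
    (hP₁ : ∀ c v, μc (P c v) = (c : ℂ) • P c v) (hP₂ : ∀ c v, P c (μc v) = (c : ℂ) • P c v)
    (hdd : ∀ x, koszulMap r D (koszulMap r D' x) = 0) {z : A ⊗[ℂ] V} (hz : koszulMap r D z = 0) :
    totalCount ν μ z ∈ LinearMap.range (koszulMap r D') := by
  set B := LinearMap.range (koszulMap r D')
  set E := totalCount ν μ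
  set N := crossTerm S r δ D C D' C'
  have hB : ∀ b ∈ B, E b ∈ B := by
    rintro _ ⟨x, rfl⟩
    exact ⟨totalCount ν μ₁ x, (totalCount_koszulMap hA h' x).symm⟩
  have hform := koszulMap_homotopy_add hA hDC hμ (r := r) (δ := δ)
  -- `E` commutes with the differential and with the homotopy, hence with the remaining term of the
  -- homotopy formula.
  have hEN : ∀ x, E (N x) = N (E x) := by
    intro x
    have h1 := congrArg E (hform x)
    have h2 := hform (E x)
    rw [map_add, map_add, totalCount_koszulMap hA h', totalCount_homotopy hA h',
      totalCount_homotopy hA h, totalCount_koszulMap hA h, h2] at h1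
    exact (add_left_cancel h1).symm
  have hZ : ∀ x, koszulMap r D x = 0 → E x + N x ∈ B := by
    intro x hx
    rw [← hform x, hx, map_zero, add_zero]
    exact ⟨_, rfl⟩
  have hEZ : ∀ x, koszulMap r D x = 0 → koszulMap r D (E x) = 0 := by
    intro x hx
    rw [← totalCount_koszulMap hA h, hx, map_zero]
  have hBZ : ∀ b ∈ B, koszulMap r D b = 0 := by
    rintro _ ⟨x, rfl⟩
    exact hdd x
  have hNZ : ∀ x, koszulMap r D x = 0 → koszulMap r D (N x) = 0 := by
    intro x hx
    have := hBZ _ (hZ x hx)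
    rwa [map_add, hEZ x hx, zero_add] at this
  have hNB : ∀ b ∈ B, N b ∈ B := by
    intro b hb
    have := B.sub_mem (hZ b (hBZ b hb)) (hB b hb)
    rwa [add_sub_cancel_left] at this
  have hcomm : Commute E N := LinearMap.ext hEN
  -- Modulo boundaries `E` acts on cycles as `-N`.
  have hpow : ∀ k : ℕ, koszulMap r D ((N ^ k) z) = 0 ∧
      (E ^ k) z - (-1 : ℂ) ^ k • (N ^ k) z ∈ B := by
    intro k
    induction k with
    | zero => simp [hz]
    | succ k ih =>
      refine ⟨by rw [pow_succ', Module.End.mul_apply]; exact hNZ _ ih.1, ?_⟩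
      have h1 := hB _ ih.2
      have h2 := B.smul_mem ((-1 : ℂ) ^ k) (hZ _ ih.1)
      have h3 := B.add_mem h1 h2
      rw [map_sub, map_smul] at h3
      rw [pow_succ' E, pow_succ' N, Module.End.mul_apply, Module.End.mul_apply]
      convert h3 using 1
      rw [pow_succ]
      module
  have hnil : (N ^ (m + 1)) z = 0 := by
    refine pow_apply_eq_zero_of_lowering (M := TensorProduct.map LinearMap.id μc)
      (P := fun c => TensorProduct.map LinearMap.id (P c)) ?_ ?_ ?_
      (cocount_crossTerm h h') z
    · intro v
      rw [← LinearMap.sum_apply]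
      refine LinearMap.congr_fun (g := LinearMap.id) (TensorProduct.ext' fun a v => ?_) v
      simp only [LinearMap.sum_apply, TensorProduct.map_tmul, LinearMap.id_apply]
      rw [← TensorProduct.tmul_sum, hP]
    · intro c v
      rw [← LinearMap.smul_apply, ← LinearMap.comp_apply]
      refine LinearMap.congr_fun (TensorProduct.ext' fun a v => ?_) v
      simp [hP₁]
    · intro c v
      rw [← LinearMap.smul_apply, ← LinearMap.comp_apply]
      refine LinearMap.congr_fun (TensorProduct.ext' fun a v => ?_) v
      simp [hP₂]
  -- A power of `E` sends `z` to a boundary. By diagonalizability `z` is a boundary up to `ker E`,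
  -- so `E z` itself is a boundary.
  obtain ⟨z₀, hz₀, hz₁⟩ := exists_sub_mem_of_pow_apply_mem
    (map_add_map_eigenspace hA.iSup_eigenspace hμdiag) hB z
  have h1 := (hpow (m + 1)).2
  rw [hnil, smul_zero, sub_zero] at h1
  have h2 := hB _ (hz₁ m h1)
  change E z₀ = 0 at hz₀
  rwa [map_sub, hz₀, sub_zero] at h2

end Homotopy

end Quadratic

/-! ### Weyl and ladder relations for the algebra and for `dualPart`. -/

namespace Quadratic

variable {ι : Type} [Fintype ι] [DecidableEq ι]

theorem saturated_self (L : Finset ι) : Saturated L L := fun _ _ h => h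

theorem saturated_compl (L : Finset ι) : Saturated L Lᶜ := fun a b h => by
  rw [Finset.mem_compl, Finset.mem_compl, h]

theorem compl_saturated (L : Finset ι) : Saturated Lᶜ L := fun a b h => by
  rw [Finset.mem_compl, Finset.mem_compl] at h
  tauto

theorem saturated_univ (L : Finset ι) : Saturated L Finset.univ := fun a b _ => by simp

theorem letterCount_add_compl (L : Finset ι) {n : ℕ} (f : Fin n → ι) :
    letterCount L f + letterCount Lᶜ f = n := by
  simp only [letterCount, Finset.mem_compl]
  rw [← Finset.sum_add_distrib, Finset.sum_eq_card_nsmul (b := 1)]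
  · simp
  · intro j _
    split_ifs <;> rfl

theorem countP_add_compl (L : Finset ι) (l : List ι) :
    l.countP (· ∈ L) + l.countP (· ∈ Lᶜ) = l.length := by
  have := List.length_eq_countP_add_countP (fun i => decide (i ∈ L)) (l := l)
  rw [this]
  congr 2
  funext i
  simp

section Augmentation

variable (R : Submodule ℂ (ι × ι → ℂ))

theorem augmentation_gen (i : ι) : augmentation R (gen R i) = 0 := by
  have : augmentation R (proj R (FreeAlgebra.ι ℂ i)) = FreeAlgebra.lift ℂ (fun _ : ι => (0 : ℂ))
      (FreeAlgebra.ι ℂ i) := RingQuot.liftAlgHom_mkAlgHom_apply _ _ _ _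
  rw [gen, this, FreeAlgebra.lift_ι_apply]

theorem degreeProj_zero_eq (a : Alg R) :
    degreeProj R 0 a = augmentation R a • (1 : Alg R) := by
  have : degreeProj R 0 = (augmentation R).toLinearMap.smulRight (1 : Alg R) := by
    refine linearMap_ext_words fun l => ?_
    rw [degreeProj_word, LinearMap.smulRight_apply, AlgHom.toLinearMap_apply]
    cases l with
    | nil => simp [word_nil]
    | cons i l => simp [word_cons, augmentation_gen]
  exact LinearMap.congr_fun this a

end Augmentation

section Slices

variable {R : Submodule ℂ (ι × ι → ℂ)}

theorem slice_slice_mem {n : ℕ} (w : dualPart R (n + 2)) (f : Fin n → ι) :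
    (fun p : ι × ι => (slice R n p.2 (slice R (n + 1) p.1 w)).1 f) ∈ R := by
  rcases isEmpty_or_nonempty ι with h | ⟨⟨i₀⟩⟩
  · have h0 : (fun p : ι × ι => (slice R n p.2 (slice R (n + 1) p.1 w)).1 f) = 0 :=
      funext fun p => h.elim p.1
    rw [h0]
    exact R.zero_mem
  have h := w.2 0 (by omega) (Fin.cons i₀ (Fin.cons i₀ f))
  convert h using 2 with p
  change w.1 (Fin.cons p.1 (Fin.cons p.2 f)) = _
  refine congrArg w.1 (funext fun j => ?_)
  refine Fin.cases ?_ (fun j => ?_) j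
  · rw [Fin.cons_zero, Function.update_of_ne (by simp)]
    exact (Function.update_self (β := fun _ : Fin (n + 2) => ι) ⟨0, _⟩ p.1 _).symm
  · refine Fin.cases ?_ (fun j => ?_) j
    · exact (Function.update_self (β := fun _ : Fin (n + 2) => ι) ⟨0 + 1, _⟩ p.2 _).symm
    · rw [Function.update_of_ne (by simp [Fin.ext_iff]),
        Function.update_of_ne (by simp [Fin.ext_iff])]
      rfl

/-- The hypothesis concerns coefficients in the full tensor power. A linear retraction `ρ` onto
`dualPart` expands `u` along them, and the relation applies to each coefficient separately. -/
theorem sum_gen_mul_gen_tmul {n : ℕ} {u : ι × ι → dualPart R n}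
    (hu : ∀ f, (fun p => (u p).1 f) ∈ R) :
    ∑ p : ι × ι, (gen R p.1 * gen R p.2) ⊗ₜ[ℂ] u p = 0 := by
  obtain ⟨ρ, hρ⟩ := LinearMap.exists_leftInverse_of_injective (dualPart R n).subtype
    (Submodule.ker_subtype _)
  have h : ∀ u : dualPart R n, u = ∑ f, u.1 f • ρ (Pi.single f 1) := by
    intro u
    conv_lhs => rw [← LinearMap.id_apply (R := ℂ) u, ← hρ, LinearMap.comp_apply,
      Submodule.subtype_apply, pi_eq_sum_univ' u.1, map_sum]
    refine Finset.sum_congr rfl fun f _ => ?_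
    rw [map_smul]
  have h' : ∀ p : ι × ι, (gen R p.1 * gen R p.2) ⊗ₜ[ℂ] u p =
      ∑ f, ((u p).1 f • (gen R p.1 * gen R p.2)) ⊗ₜ[ℂ]
        ρ (Pi.single f 1) := by
    intro p
    conv_lhs => rw [h (u p), TensorProduct.tmul_sum]
    exact Finset.sum_congr rfl fun f _ => (TensorProduct.smul_tmul _ _ _).symm
  rw [Finset.sum_congr rfl fun p _ => h' p, Finset.sum_comm]
  refine Finset.sum_eq_zero fun f _ => ?_
  rw [← TensorProduct.sum_tmul, sum_smul_gen_mul_gen (hu f),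
    TensorProduct.zero_tmul]

theorem sum_gen_mul_gen_tmul_slice_slice {n : ℕ} (w : dualPart R (n + 2)) :
    ∑ p : ι × ι, (gen R p.1 * gen R p.2) ⊗ₜ[ℂ] slice R n p.2 (slice R (n + 1) p.1 w) = 0 :=
  sum_gen_mul_gen_tmul (slice_slice_mem w)

end Slices

namespace Twist

variable {L : Finset ι} {T : Twist L} {R : Submodule ℂ (ι × ι → ℂ)}

theorem Compatible.iSup_eigenspace_algCount (hR : T.Compatible R) {S : Finset ι}
    (hS : Saturated L S) : ⨆ c, Module.End.eigenspace (hR.algCount S) c = ⊤ := by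
  rw [eq_top_iff, ← span_words R, Submodule.span_le]
  rintro _ ⟨l, rfl⟩
  exact Submodule.mem_iSup_of_mem _ (Module.End.mem_eigenspace_iff.2 (hR.algCount_word hS l))

theorem Compatible.algCount_gen_mul (hR : T.Compatible R) {S : Finset ι} (hS : Saturated L S)
    (i : ι) (a : Alg R) : hR.algCount S (gen R i * a) =
      gen R i * hR.algCount S a + (if i ∈ S then (1 : ℂ) else 0) • (gen R i * a) := by
  have : hR.algCount S ∘ₗ LinearMap.mulLeft ℂ (gen R i) =
      LinearMap.mulLeft ℂ (gen R i) ∘ₗ hR.algCount S +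
        (if i ∈ S then (1 : ℂ) else 0) • LinearMap.mulLeft ℂ (gen R i) := by
    refine linearMap_ext_words fun l => ?_
    simp only [LinearMap.comp_apply, LinearMap.add_apply, LinearMap.smul_apply,
      LinearMap.mulLeft_apply, ← word_cons, hR.algCount_word hS, mul_smul_comm, List.countP_cons]
    rw [← add_smul]
    by_cases h : i ∈ S <;> simp [h]
  exact LinearMap.congr_fun this a

theorem Compatible.algCount_mul_gen (hR : T.Compatible R) {S : Finset ι} (hS : Saturated L S)
    (i : ι) (a : Alg R) : hR.algCount S (a * gen R i) =
      hR.algCount S a * gen R i + (if i ∈ S then (1 : ℂ) else 0) • (a * gen R i) := by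
  have : hR.algCount S ∘ₗ LinearMap.mulRight ℂ (gen R i) =
      LinearMap.mulRight ℂ (gen R i) ∘ₗ hR.algCount S +
        (if i ∈ S then (1 : ℂ) else 0) • LinearMap.mulRight ℂ (gen R i) := by
    refine linearMap_ext_words fun l => ?_
    simp only [LinearMap.comp_apply, LinearMap.add_apply, LinearMap.smul_apply,
      LinearMap.mulRight_apply, ← word_concat, hR.algCount_word hS, smul_mul_assoc,
      List.countP_append]
    rw [← add_smul]
    by_cases h : i ∈ S <;> simp [h]
  exact LinearMap.congr_fun this a

theorem Compatible.isWeyl_mulLeft (hR : T.Compatible R) :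
    IsWeyl L (fun i => LinearMap.mulLeft ℂ (gen R i)) hR.deriv (hR.algCount L) where
  deriv_mul _ hi s _ a := hR.deriv_gen_mul hi s a
  sum_mul_deriv a := (hR.algCount_eq_gen_mul_deriv a).symm
  count_mul := hR.algCount_gen_mul (saturated_self L)
  count_deriv _ hs a := hR.algCount_deriv hs a
  iSup_eigenspace := hR.iSup_eigenspace_algCount (saturated_self L)

/-- Right multiplications are controlled for the letters outside `L`. Applied to the twist of the
complementary set, this provides the right multiplications by letters of `L` needed in the Koszul
complex. -/
theorem Compatible.isWeyl_mulRight (hR : T.Compatible R) :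
    IsWeyl Lᶜ (fun i => LinearMap.mulRight ℂ (gen R i)) hR.deriv (hR.algCount Lᶜ) where
  deriv_mul _ hi s _ a := hR.deriv_mul_gen (Finset.mem_compl.1 hi) s a
  sum_mul_deriv a := (hR.algCount_eq_deriv_mul_gen a).symm
  count_mul := hR.algCount_mul_gen (saturated_compl L)
  count_deriv _ hs a := hR.algCount_deriv hs a
  iSup_eigenspace := hR.iSup_eigenspace_algCount (saturated_compl L)

theorem Compatible.isLadder_slice (hR : T.Compatible R) (n : ℕ) :
    IsLadder L (slice R n) (fun s => hR.creation s n)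
      (hR.dualCount (saturated_self L) (n + 1)) (hR.dualCount (saturated_compl L) (n + 1))
      (hR.dualCount (saturated_self L) n) (hR.dualCount (saturated_compl L) n) where
  count_lower i v := by rw [hR.slice_dualCount, add_sub_cancel_right]
  count_raise s hs w := by rw [hR.dualCount_creation, if_pos hs, one_smul]
  cocount_lower i hi v := by
    rw [hR.slice_dualCount, if_pos (Finset.mem_compl.2 hi), one_smul, add_sub_cancel_right]
  cocount_raise s hs w := by
    rw [hR.dualCount_creation, if_neg (fun h => Finset.mem_compl.1 h hs), zero_smul, add_zero]

/-- Transposition turns lowering into raising operators, and replacing a count by a constant minus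
the count reverses this again. The constants are free here: `b` will be the size of `L`, `k` the
degree in which nilpotency is needed. -/
theorem Compatible.isLadder_dualMap (hR : T.Compatible R) (n : ℕ) (b k : ℂ) :
    IsLadder L (fun i => (slice R n i).dualMap) (fun s => (hR.creation s n).dualMap)
      (b • LinearMap.id - (hR.dualCount (saturated_self L) n).dualMap)
      (k • LinearMap.id - (hR.dualCount (saturated_compl L) n).dualMap)
      (b • LinearMap.id - (hR.dualCount (saturated_self L) (n + 1)).dualMap)
      (k • LinearMap.id - (hR.dualCount (saturated_compl L) (n + 1)).dualMap) where
  count_lower i v := by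
    ext w
    by_cases h : i ∈ L <;> simp [hR.slice_dualCount, h]
    ring
  count_raise s hs w := by
    ext v
    simp [hR.dualCount_creation, hs]
    ring
  cocount_lower i hi v := by
    ext w
    simp [hR.slice_dualCount, hi]
    ring
  cocount_raise s hs w := by
    ext v
    simp [hR.dualCount_creation, hs]

end Twist

section Cycles

variable {R : Submodule ℂ (ι × ι → ℂ)} {U : Type*} [AddCommGroup U] [Module ℂ U]

theorem exists_sum_map_degreeProj (z : Alg R ⊗[ℂ] U) :
    ∃ N, ∀ M, N ≤ M →
      ∑ k ∈ Finset.range M, TensorProduct.map (degreeProj R k) LinearMap.id z = z := by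
  induction z with
  | zero => exact ⟨0, fun M _ => by simp⟩
  | tmul a u =>
    obtain ⟨N, hN⟩ := exists_sum_degreeProj a
    refine ⟨N, fun M hM => ?_⟩
    simp only [TensorProduct.map_tmul]
    rw [← TensorProduct.sum_tmul, hN M hM, LinearMap.id_apply]
  | add x y hx hy =>
    obtain ⟨N, hN⟩ := hx
    obtain ⟨N', hN'⟩ := hy
    refine ⟨max N N', fun M hM => ?_⟩
    simp only [map_add, Finset.sum_add_distrib]
    rw [hN M (le_of_max_le_left hM), hN' M (le_of_max_le_right hM)]

/-- The component of degree zero, for the grading of the algebra. -/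
noncomputable def augmentLeft (R : Submodule ℂ (ι × ι → ℂ)) (U : Type*) [AddCommGroup U]
    [Module ℂ U] : Alg R ⊗[ℂ] U →ₗ[ℂ] U :=
  TensorProduct.lift ((LinearMap.lsmul ℂ U).comp (augmentation R).toLinearMap)

theorem augmentLeft_tmul (a : Alg R) (u : U) :
    augmentLeft R U (a ⊗ₜ u) = augmentation R a • u := rfl

theorem map_degreeProj_zero (z : Alg R ⊗[ℂ] U) :
    TensorProduct.map (degreeProj R 0) LinearMap.id z = 1 ⊗ₜ augmentLeft R U z := by
  have : TensorProduct.map (degreeProj R 0) LinearMap.id =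
      TensorProduct.mk ℂ (Alg R) U 1 ∘ₗ augmentLeft R U := by
    refine TensorProduct.ext' fun a u => ?_
    rw [TensorProduct.map_tmul, LinearMap.comp_apply, augmentLeft_tmul, degreeProj_zero_eq,
      TensorProduct.mk_apply, LinearMap.id_apply, TensorProduct.smul_tmul]
  exact LinearMap.congr_fun this z

/-- If the operator counting all letters, shifted by `c`, maps `z` into a stable subspace, then `z`
lies in it, provided that `c ≠ 0` or that everything lives in positive degrees. -/
theorem mem_of_totalCount_mem {L : Finset ι} {T : Twist L} (hR : T.Compatible R)
    {c : ℕ} {B : Submodule ℂ (Alg R ⊗[ℂ] U)}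
    (hB : ∀ b ∈ B, totalCount (hR.algCount Finset.univ) ((c : ℂ) • LinearMap.id) b ∈ B)
    {z : Alg R ⊗[ℂ] U}
    (hz : totalCount (hR.algCount Finset.univ) ((c : ℂ) • LinearMap.id) z ∈ B)
    (hc : c ≠ 0 ∨ augmentLeft R U z = 0 ∧ ∀ b ∈ B, augmentLeft R U b = 0) : z ∈ B := by
  have hdiag : ⨆ c', Module.End.eigenspace ((c : ℂ) • (LinearMap.id : Module.End ℂ U)) c' = ⊤ :=
    eq_top_iff.2 fun u _ => Submodule.mem_iSup_of_mem (c : ℂ)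
      (Module.End.mem_eigenspace_iff.2 rfl)
  obtain ⟨z₀, h0, h1⟩ := exists_sub_mem_of_pow_apply_mem
    (map_add_map_eigenspace (hR.iSup_eigenspace_algCount (saturated_univ L)) hdiag) hB z
  have h2 := h1 0 (by rwa [zero_add, pow_one])
  -- On the component of degree `k` the operator is the scalar `k + c`, so a kernel can only come
  -- from `k = c = 0`.
  have hk : ∀ (k : ℕ) (x : Alg R ⊗[ℂ] U), TensorProduct.map (degreeProj R k) LinearMap.id
      (totalCount (hR.algCount Finset.univ) ((c : ℂ) • LinearMap.id) x) =
      ((k + c : ℕ) : ℂ) • TensorProduct.map (degreeProj R k) LinearMap.id x := by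
    intro k x
    have hdeg : ∀ a, degreeProj R k (hR.algCount Finset.univ a) = (k : ℂ) • degreeProj R k a := by
      intro a
      refine LinearMap.congr_fun (f := degreeProj R k ∘ₗ hR.algCount Finset.univ)
        (g := (k : ℂ) • degreeProj R k) (linearMap_ext_words fun l => ?_) a
      rw [LinearMap.comp_apply, hR.algCount_word (saturated_univ L), map_smul,
        LinearMap.smul_apply, degreeProj_word]
      split_ifs with h
      · simp [← h]
      · simp
    rw [← LinearMap.smul_apply, ← LinearMap.comp_apply]
    refine LinearMap.congr_fun (TensorProduct.ext' fun a u => ?_) x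
    simp only [LinearMap.comp_apply, totalCount_tmul, map_add, TensorProduct.map_tmul,
      LinearMap.smul_apply, LinearMap.add_apply, map_smul, LinearMap.id_apply, hdeg, Nat.cast_add, add_smul,
      TensorProduct.tmul_smul, TensorProduct.smul_tmul']
  have hz0 : ∀ k : ℕ, k + c ≠ 0 →
      TensorProduct.map (degreeProj R k) LinearMap.id z₀ = 0 := by
    intro k hkc
    have := hk k z₀
    change totalCount (hR.algCount Finset.univ) ((c : ℂ) • LinearMap.id) z₀ = 0 at h0
    rw [h0, map_zero, eq_comm, smul_eq_zero] at this
    exact this.resolve_left (by exact_mod_cast hkc)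
  have hz1 : z₀ = 0 := by
    obtain ⟨N, hN⟩ := exists_sum_map_degreeProj z₀
    rw [← hN N le_rfl]
    refine Finset.sum_eq_zero fun k _ => ?_
    rcases Nat.eq_zero_or_pos (k + c) with h | h
    · have hk0 : k = 0 := by omega
      have hc0 : c = 0 := by omega
      obtain ⟨h3, h4⟩ := hc.resolve_left (not_not.2 hc0)
      have h5 := h4 _ h2
      rw [map_sub, h3, zero_sub, neg_eq_zero] at h5
      rw [hk0, map_degreeProj_zero, h5, TensorProduct.tmul_zero]
    · exact hz0 k h.ne'
  rwa [hz1, sub_zero] at h2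

end Cycles

end Quadratic

/-! ### The Koszul complex, its dual complex, and Koszulness. -/

namespace Quadratic

variable {ι : Type} [Fintype ι] [DecidableEq ι]

section Complexes

variable (R : Submodule ℂ (ι × ι → ℂ))

/-- The operators of right multiplication by the generators. -/
noncomputable def rightOps (i : ι) : Module.End ℂ (Alg R) := LinearMap.mulRight ℂ (gen R i)

/-- The operators of left multiplication by the generators. -/
noncomputable def leftOps (i : ι) : Module.End ℂ (Alg R) := LinearMap.mulLeft ℂ (gen R i)

theorem koszulDifferential_apply (n : ℕ) (z : Alg R ⊗[ℂ] dualPart R (n + 1)) :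
    koszulDifferential R n z = koszulMap (rightOps R) (slice R n) z := by
  refine LinearMap.congr_fun (f := (koszulDifferential R n).restrictScalars ℂ)
    (g := koszulMap (rightOps R) (slice R n)) (TensorProduct.ext' fun a w => ?_) z
  rw [koszulMap_tmul, LinearMap.restrictScalars_apply, koszulDifferential, LinearMap.sum_apply]
  rfl

theorem koszulMap_right_koszulMap (n : ℕ) (z : Alg R ⊗[ℂ] dualPart R (n + 2)) :
    koszulMap (rightOps R) (slice R n) (koszulMap (rightOps R) (slice R (n + 1)) z) = 0 := by
  refine LinearMap.congr_fun (f := koszulMap (rightOps R) (slice R n) ∘ₗ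
    koszulMap (rightOps R) (slice R (n + 1))) (g := 0) (TensorProduct.ext' fun a w => ?_) z
  have h := congrArg (TensorProduct.map (LinearMap.mulLeft ℂ a) LinearMap.id)
    (sum_gen_mul_gen_tmul_slice_slice w)
  rw [map_sum, map_zero, Fintype.sum_prod_type] at h
  rw [LinearMap.comp_apply, koszulMap_tmul, map_sum, LinearMap.zero_apply, ← h]
  refine Finset.sum_congr rfl fun i _ => ?_
  rw [koszulMap_tmul]
  refine Finset.sum_congr rfl fun j _ => ?_
  rw [TensorProduct.map_tmul, LinearMap.mulLeft_apply, ← mul_assoc]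
  rfl

/-- The component of the transposed slices. -/
noncomputable def dualSlice (n : ℕ) (i : ι) :
    Module.Dual ℂ (dualPart R n) →ₗ[ℂ] Module.Dual ℂ (dualPart R (n + 1)) := (slice R n i).dualMap

/-- The identification of `A ⊗ Wₙ*` with the space of linear maps from `Wₙ` to `A`. -/
noncomputable def cochainEquiv (n : ℕ) :
    Alg R ⊗[ℂ] Module.Dual ℂ (dualPart R n) ≃ₗ[ℂ] (dualPart R n →ₗ[ℂ] Alg R) :=
  TensorProduct.comm ℂ _ _ ≪≫ₗ dualTensorHomEquiv ℂ (dualPart R n) (Alg R)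

theorem cochainEquiv_tmul (n : ℕ) (a : Alg R) (f : Module.Dual ℂ (dualPart R n))
    (w : dualPart R n) : cochainEquiv R n (a ⊗ₜ f) w = f w • a := rfl

/-- The differential of the complex of linear maps from `Wₙ` to `A`. -/
noncomputable def coboundary (n : ℕ) :
    (dualPart R n →ₗ[ℂ] Alg R) →ₗ[ℂ] (dualPart R (n + 1) →ₗ[ℂ] Alg R) where
  toFun φ := ∑ i, leftOps R i ∘ₗ φ ∘ₗ slice R n i
  map_add' φ ψ := by
    ext w
    simp [Finset.sum_add_distrib]
  map_smul' c φ := by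
    ext w
    simp [Finset.smul_sum]

theorem coboundary_apply (n : ℕ) (φ : dualPart R n →ₗ[ℂ] Alg R) (w : dualPart R (n + 1)) :
    coboundary R n φ w = ∑ i, gen R i * φ (slice R n i w) := by
  change (∑ i, leftOps R i ∘ₗ φ ∘ₗ slice R n i) w = _
  rw [LinearMap.sum_apply]
  rfl

theorem cochainEquiv_koszulMap (n : ℕ) (z : Alg R ⊗[ℂ] Module.Dual ℂ (dualPart R n)) :
    cochainEquiv R (n + 1) (koszulMap (leftOps R) (dualSlice R n) z) =
      coboundary R n (cochainEquiv R n z) := by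
  refine LinearMap.congr_fun (f := (cochainEquiv R (n + 1)).toLinearMap ∘ₗ
    koszulMap (leftOps R) (dualSlice R n)) (g := coboundary R n ∘ₗ (cochainEquiv R n).toLinearMap)
    (TensorProduct.ext' fun a f => LinearMap.ext fun w => ?_) z
  simp only [LinearMap.comp_apply, LinearEquiv.coe_coe, koszulMap_tmul, map_sum,
    coboundary_apply, LinearMap.sum_apply, cochainEquiv_tmul, mul_smul_comm]
  rfl

theorem coboundary_coboundary (n : ℕ) (φ : dualPart R n →ₗ[ℂ] Alg R) :
    coboundary R (n + 1) (coboundary R n φ) = 0 := by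
  ext w
  have h := congrArg (TensorProduct.lift ((LinearMap.mul ℂ (Alg R)).compl₂ φ))
    (sum_gen_mul_gen_tmul_slice_slice w)
  rw [map_sum, map_zero, Fintype.sum_prod_type] at h
  rw [coboundary_apply, LinearMap.zero_apply, ← h]
  refine Finset.sum_congr rfl fun i _ => ?_
  rw [coboundary_apply, Finset.mul_sum]
  refine Finset.sum_congr rfl fun j _ => ?_
  rw [← mul_assoc]
  rfl

theorem koszulMap_left_koszulMap (n : ℕ) (z : Alg R ⊗[ℂ] Module.Dual ℂ (dualPart R n)) :
    koszulMap (leftOps R) (dualSlice R (n + 1)) (koszulMap (leftOps R) (dualSlice R n) z) = 0 := by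
  refine (cochainEquiv R (n + 2)).injective ?_
  rw [cochainEquiv_koszulMap, cochainEquiv_koszulMap, coboundary_coboundary, map_zero]

theorem augmentation_cochainEquiv (n : ℕ) (z : Alg R ⊗[ℂ] Module.Dual ℂ (dualPart R n))
    (w : dualPart R n) :
    augmentation R (cochainEquiv R n z w) = augmentLeft R _ z w := by
  refine LinearMap.congr_fun (f := (augmentation R).toLinearMap ∘ₗ LinearMap.applyₗ w ∘ₗ
    (cochainEquiv R n).toLinearMap) (g := LinearMap.applyₗ w ∘ₗ augmentLeft R _)
    (TensorProduct.ext' fun a f => ?_) z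
  simp only [LinearMap.comp_apply, LinearEquiv.coe_coe, augmentLeft_tmul, AlgHom.toLinearMap_apply,
    LinearMap.applyₗ_apply_apply, cochainEquiv_tmul, map_smul, smul_eq_mul]
  exact mul_comm _ _

theorem augmentLeft_koszulMap_left {V W : Type*} [AddCommGroup V] [Module ℂ V] [AddCommGroup W]
    [Module ℂ W] (D : ι → V →ₗ[ℂ] W) (z : Alg R ⊗[ℂ] V) :
    augmentLeft R W (koszulMap (leftOps R) D z) = 0 := by
  refine LinearMap.congr_fun (f := augmentLeft R W ∘ₗ koszulMap (leftOps R) D) (g := 0)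
    (TensorProduct.ext' fun a v => ?_) z
  rw [LinearMap.comp_apply, koszulMap_tmul, map_sum, LinearMap.zero_apply]
  refine Finset.sum_eq_zero fun i _ => ?_
  rw [augmentLeft_tmul, leftOps, LinearMap.mulLeft_apply, map_mul, augmentation_gen, zero_mul,
    zero_smul]

end Complexes

theorem totalCount_add_totalCount {A V : Type*} [AddCommGroup A] [Module ℂ A] [AddCommGroup V]
    [Module ℂ V] (ν ν' : Module.End ℂ A) (μ μ' : Module.End ℂ V) (z : A ⊗[ℂ] V) :
    totalCount ν μ z + totalCount ν' μ' z = totalCount (ν + ν') (μ + μ') z := by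
  refine LinearMap.congr_fun (f := totalCount ν μ + totalCount ν' μ')
    (TensorProduct.ext' fun a v => ?_) z
  simp only [LinearMap.add_apply, totalCount_tmul, TensorProduct.add_tmul, TensorProduct.tmul_add]
  abel

namespace Twist

variable {L L' : Finset ι} {T : Twist L} {T' : Twist L'} {R : Submodule ℂ (ι × ι → ℂ)}

theorem Compatible.algCount_add_compl (hR : T.Compatible R) (hR' : T'.Compatible R) (h : L' = Lᶜ) :
    hR'.algCount L + hR.algCount L' = hR.algCount Finset.univ := by
  subst h
  refine linearMap_ext_words fun l => ?_
  rw [LinearMap.add_apply, hR'.algCount_word (compl_saturated L),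
    hR.algCount_word (saturated_compl L), hR.algCount_word (saturated_univ L), ← add_smul,
    ← Nat.cast_add, countP_add_compl]
  congr 2
  simp

theorem Compatible.algCount_add_compl' (hR : T.Compatible R) (hR' : T'.Compatible R) (h : L' = Lᶜ) :
    hR.algCount L + hR'.algCount L' = hR.algCount Finset.univ := by
  subst h
  refine linearMap_ext_words fun l => ?_
  rw [LinearMap.add_apply, hR.algCount_word (saturated_self L),
    hR'.algCount_word (saturated_self Lᶜ), hR.algCount_word (saturated_univ L), ← add_smul,
    ← Nat.cast_add, countP_add_compl]
  congr 2
  simp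

theorem Compatible.dualCount_add_compl (hR : T.Compatible R) (hR' : T'.Compatible R) (h : L' = Lᶜ)
    (n : ℕ) : hR.dualCount (saturated_self L) n + hR'.dualCount (saturated_self L') n =
      (n : ℂ) • LinearMap.id := by
  subst h
  ext w f
  change (letterCount L f : ℂ) * w.1 f + (letterCount Lᶜ f : ℂ) * w.1 f = (n : ℂ) * w.1 f
  rw [← add_mul, ← Nat.cast_add, letterCount_add_compl]

/-- Both twists are needed: slices by letters of `L` are controlled by the twist for `L`, right
multiplications by the same letters by the twist for the complement. -/
theorem Compatible.totalCount_mem_range_right (hR : T.Compatible R) (hR' : T'.Compatible R)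
    (h : L'ᶜ = L) (n : ℕ) {z : Alg R ⊗[ℂ] dualPart R (n + 1)}
    (hz : koszulMap (rightOps R) (slice R n) z = 0) :
    totalCount (hR'.algCount L) (hR.dualCount (saturated_self L) (n + 1)) z ∈
      LinearMap.range (koszulMap (rightOps R) (slice R (n + 1))) := by
  subst h
  refine totalCount_mem_range (m := n + 1)
    (P := hR.dualProj (saturated_compl L'ᶜ) (n + 1)) hR'.isWeyl_mulRight (hR.isLadder_slice n)
    (hR.isLadder_slice (n + 1)) (fun s _ t ht v => hR.slice_creation_succ ht s v)
    (hR.sum_creation_slice _) ?_ (hR.sum_dualProj _) (hR.dualCount_dualProj _)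
    (hR.dualProj_dualCount _) (koszulMap_right_koszulMap R n) hz
  exact iSup_eigenspace_eq_top_of_proj (hR.sum_dualProj (saturated_self _))
    (hR.dualCount_dualProj (saturated_self _))

/-- The counts for `L` and for its complement add up to the degree in the algebra plus n + 1. This
is always positive, so the operator mapping cycles to boundaries is invertible. -/
theorem Compatible.isKoszul (hR : T.Compatible R) (hR' : T'.Compatible R) (h : L' = Lᶜ) :
    IsKoszul R := by
  intro n z
  rw [koszulDifferential_apply]
  constructor
  · intro hz
    have key : ∀ x : Alg R ⊗[ℂ] dualPart R (n + 1), koszulMap (rightOps R) (slice R n) x = 0 →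
        totalCount (hR.algCount Finset.univ) (((n + 1 : ℕ) : ℂ) • LinearMap.id) x ∈
          LinearMap.range (koszulMap (rightOps R) (slice R (n + 1))) := by
      intro x hx
      have := Submodule.add_mem _ (hR.totalCount_mem_range_right hR' (by rw [h, compl_compl]) n hx)
        (hR'.totalCount_mem_range_right hR h.symm n hx)
      rwa [totalCount_add_totalCount, hR.algCount_add_compl hR' h,
        hR.dualCount_add_compl hR' h] at this
    obtain ⟨y, hy⟩ := mem_of_totalCount_mem hR (c := n + 1)
      (B := LinearMap.range (koszulMap (rightOps R) (slice R (n + 1))))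
      (by rintro _ ⟨y, rfl⟩; exact key _ (koszulMap_right_koszulMap R n y)) (key z hz)
      (Or.inl n.succ_ne_zero)
    exact ⟨y, by rw [koszulDifferential_apply, hy]⟩
  · rintro ⟨y, rfl⟩
    rw [koszulDifferential_apply, koszulMap_right_koszulMap]

end Twist

end Quadratic

/-! ### Cohomology of the dual complex. -/

namespace Quadratic

variable {ι : Type} [Fintype ι] [DecidableEq ι]

namespace Twist

variable {L L' : Finset ι} {T : Twist L} {T' : Twist L'} {R : Submodule ℂ (ι × ι → ℂ)}

/-- The projection, on the dual space, to the words with `c` letters not in `S`. -/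
noncomputable def Compatible.coProj (hR : T.Compatible R) {S : Finset ι} (hS : Saturated L S)
    (n c : ℕ) : Module.End ℂ (Module.Dual ℂ (dualPart R n)) :=
  if c ≤ n then (hR.dualProj hS n (n - c)).dualMap else 0

theorem Compatible.sum_coProj (hR : T.Compatible R) {S : Finset ι} (hS : Saturated L S) {n : ℕ}
    (v : Module.Dual ℂ (dualPart R n)) :
    ∑ c ∈ Finset.range (n + 1), hR.coProj hS n c v = v := by
  ext w
  conv_rhs => rw [← hR.sum_dualProj hS w, map_sum, ← Finset.sum_range_reflect]
  rw [LinearMap.sum_apply]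
  refine Finset.sum_congr rfl fun c hc => ?_
  rw [coProj, if_pos (Nat.le_of_lt_succ (Finset.mem_range.1 hc))]
  rfl

theorem Compatible.coProj_apply_sub (hR : T.Compatible R) {S : Finset ι} (hS : Saturated L S)
    {n : ℕ} (c : ℕ) (v : Module.Dual ℂ (dualPart R n)) :
    hR.coProj hS n c (((n : ℂ) • LinearMap.id - (hR.dualCount hS n).dualMap :
      Module.End ℂ (Module.Dual ℂ (dualPart R n))) v) = (c : ℂ) • hR.coProj hS n c v := by
  ext w
  rw [coProj]
  split_ifs with h
  · simp [hR.dualCount_dualProj, Nat.cast_sub h]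
    ring
  · simp

theorem Compatible.sub_coProj (hR : T.Compatible R) {S : Finset ι} (hS : Saturated L S)
    {n : ℕ} (b : ℂ) (c : ℕ) (v : Module.Dual ℂ (dualPart R n)) :
    (b • LinearMap.id - (hR.dualCount hS n).dualMap :
      Module.End ℂ (Module.Dual ℂ (dualPart R n))) (hR.coProj hS n c v) =
        (b - n + c) • hR.coProj hS n c v := by
  ext w
  rw [coProj]
  split_ifs with h
  · simp [hR.dualProj_dualCount, Nat.cast_sub h]
    ring
  · simp

/-- Left multiplications and slices by letters of `L` are controlled by the same twist, so one twist
suffices for each half. -/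
theorem Compatible.totalCount_mem_range_left_succ (hR : T.Compatible R) (n : ℕ)
    {z : Alg R ⊗[ℂ] Module.Dual ℂ (dualPart R (n + 1))}
    (hz : koszulMap (leftOps R) (dualSlice R (n + 1)) z = 0) :
    totalCount (hR.algCount L)
        ((L.card : ℂ) • LinearMap.id - (hR.dualCount (saturated_self L) (n + 1)).dualMap) z ∈
      LinearMap.range (koszulMap (leftOps R) (dualSlice R n)) := by
  refine totalCount_mem_range (m := n + 1)
    (P := hR.coProj (saturated_compl L) (n + 1)) hR.isWeyl_mulLeft
    (hR.isLadder_dualMap (n + 1) L.card ((n + 1 : ℕ) : ℂ))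
    (hR.isLadder_dualMap n L.card ((n + 1 : ℕ) : ℂ)) ?_ ?_ ?_ (hR.sum_coProj _) ?_
    (hR.coProj_apply_sub _) (koszulMap_left_koszulMap R n) hz
  · intro s _ t ht v
    ext w
    have := congrArg v (hR.slice_creation_succ ht s w)
    rw [map_add, map_smul] at this
    rw [LinearMap.smul_apply, ← this]
    exact add_comm _ _
  -- Transposition reverses the order of slice and creation. Since slice ∘ creation = 1 - creation ∘
  -- slice for equal letters of `L`, summing gives the size of `L` minus the count.
  · intro v
    ext w
    have h : ∀ s ∈ L, slice R (n + 1) s (hR.creation s (n + 1) w) =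
        w - hR.creation s n (slice R n s w) := fun s hs => by
      have := hR.slice_creation_succ hs s w
      rwa [if_pos rfl, one_smul, ← eq_sub_iff_add_eq] at this
    rw [LinearMap.sum_apply]
    refine (Finset.sum_congr rfl fun s hs => congrArg v (h s hs)).trans ?_
    rw [← map_sum, Finset.sum_sub_distrib, hR.sum_creation_slice (saturated_self L)]
    simp
  · exact iSup_eigenspace_eq_top_of_proj (hR.sum_coProj (saturated_self L))
      (hR.sub_coProj (saturated_self L) _)
  · intro c v
    rw [hR.sub_coProj, sub_self, zero_add]

/-- The left end of the complex is treated by putting the zero space `PUnit` before it, so that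
there are no boundaries but 0. -/
theorem Compatible.totalCount_eq_zero_left (hR : T.Compatible R)
    {z : Alg R ⊗[ℂ] Module.Dual ℂ (dualPart R 0)}
    (hz : koszulMap (leftOps R) (dualSlice R 0) z = 0) :
    totalCount (hR.algCount L)
        ((L.card : ℂ) • LinearMap.id - (hR.dualCount (saturated_self L) 0).dualMap) z = 0 := by
  have key : totalCount (hR.algCount L)
      ((L.card : ℂ) • LinearMap.id - (hR.dualCount (saturated_self L) 0).dualMap) z ∈
      LinearMap.range (koszulMap (leftOps R)
        (0 : ι → PUnit.{1} →ₗ[ℂ] Module.Dual ℂ (dualPart R 0))) := by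
    refine totalCount_mem_range (m := 0) (μ₁ := (0 : Module.End ℂ PUnit.{1})) (μc₁ := 0) (C' := 0)
      (P := hR.coProj (saturated_compl L) 0) hR.isWeyl_mulLeft
      (hR.isLadder_dualMap 0 L.card ((0 : ℕ) : ℂ)) ?_ ?_ ?_ ?_ (hR.sum_coProj _) ?_
      (hR.coProj_apply_sub _) ?_ hz
    · constructor <;> intros <;> simp
    · intro s _ t ht v
      ext w
      have := congrArg v (hR.slice_creation_zero ht s w)
      rw [map_smul] at this
      exact (zero_add _).trans this
    · intro v
      ext w
      have h0 : hR.dualCount (saturated_self L) 0 w = 0 := by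
        ext f
        change (letterCount L f : ℂ) * w.1 f = 0
        simp [letterCount]
      rw [LinearMap.sum_apply]
      refine (Finset.sum_congr rfl fun s hs =>
        congrArg v (hR.slice_creation_zero hs s w)).trans ?_
      simp [h0]
    · exact iSup_eigenspace_eq_top_of_proj (hR.sum_coProj (saturated_self L))
        (hR.sub_coProj (saturated_self L) _)
    · intro c v
      rw [hR.sub_coProj, sub_self, zero_add]
    · intro x
      simp [koszulMap]
  obtain ⟨y, hy⟩ := key
  rw [← hy]
  simp [koszulMap]

theorem Compatible.totalCount_add_left (hR : T.Compatible R) (hR' : T'.Compatible R) (h : L' = Lᶜ)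
    {n : ℕ} (hn : n ≤ Fintype.card ι) (z : Alg R ⊗[ℂ] Module.Dual ℂ (dualPart R n)) :
    totalCount (hR.algCount L)
        ((L.card : ℂ) • LinearMap.id - (hR.dualCount (saturated_self L) n).dualMap) z +
      totalCount (hR'.algCount L')
        ((L'.card : ℂ) • LinearMap.id - (hR'.dualCount (saturated_self L') n).dualMap) z =
    totalCount (hR.algCount Finset.univ)
      (((Fintype.card ι - n : ℕ) : ℂ) • LinearMap.id) z := by
  rw [totalCount_add_totalCount, hR.algCount_add_compl' hR' h]
  congr 2
  have h1 := congrArg LinearMap.dualMap (hR.dualCount_add_compl hR' h n)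
  have h2 : (L.card : ℂ) + L'.card = Fintype.card ι := by
    rw [h, ← Nat.cast_add, Finset.card_add_card_compl]
  ext v w
  have h3 := congrArg v (LinearMap.congr_fun (hR.dualCount_add_compl hR' h n) w)
  rw [LinearMap.add_apply, map_add, LinearMap.smul_apply, LinearMap.id_apply, map_smul,
    smul_eq_mul] at h3
  simp only [LinearMap.add_apply, LinearMap.sub_apply, LinearMap.smul_apply, LinearMap.id_apply,
    LinearMap.dualMap_apply, smul_eq_mul, Nat.cast_sub hn]
  linear_combination v w * h2 - h3

theorem Compatible.eq_zero_of_coboundary_zero (hR : T.Compatible R) (hR' : T'.Compatible R)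
    (h : L' = Lᶜ) {φ : dualPart R 0 →ₗ[ℂ] Alg R} (hφ : coboundary R 0 φ = 0)
    (hc : Fintype.card ι ≠ 0 ∨ ∀ w, augmentation R (φ w) = 0) : φ = 0 := by
  obtain ⟨z, rfl⟩ := (cochainEquiv R 0).surjective φ
  rw [← cochainEquiv_koszulMap, LinearEquiv.map_eq_zero_iff] at hφ
  have h0 := hR.totalCount_add_left hR' h (Nat.zero_le _) z
  rw [hR.totalCount_eq_zero_left hφ, hR'.totalCount_eq_zero_left hφ, add_zero] at h0
  have := mem_of_totalCount_mem hR (B := ⊥) (c := Fintype.card ι - 0) (z := z)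
    (by
      intro b hb
      rw [(Submodule.mem_bot ℂ).1 hb, map_zero]
      exact Submodule.zero_mem _)
    ((Submodule.mem_bot ℂ).2 h0.symm) (hc.imp (by simp) fun hw =>
      ⟨LinearMap.ext fun w => by rw [← augmentation_cochainEquiv, hw, LinearMap.zero_apply],
        fun b hb => by rw [(Submodule.mem_bot ℂ).1 hb, map_zero]⟩)
  rw [(Submodule.mem_bot ℂ).1 this, map_zero]

theorem Compatible.subsingleton_dualPart (hR : T.Compatible R) {n : ℕ} (hn : Fintype.card ι < n) :
    Subsingleton (dualPart R n) := by
  rw [← Module.finrank_zero_iff (R := ℂ), hR.finrank_dualPart, Nat.choose_eq_zero_of_lt hn]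

/-- The two halves add up to the degree in the algebra plus the number of letters minus the
cohomological degree. This vanishes only for constants in the top degree, where the augmentation
condition takes over; beyond the top degree the cochains are zero. -/
theorem Compatible.exists_coboundary_eq (hR : T.Compatible R) (hR' : T'.Compatible R)
    (h : L' = Lᶜ) {n : ℕ} {φ : dualPart R (n + 1) →ₗ[ℂ] Alg R} (hφ : coboundary R (n + 1) φ = 0)
    (hc : Fintype.card ι ≠ n + 1 ∨ ∀ w, augmentation R (φ w) = 0) :
    ∃ ψ, coboundary R n ψ = φ := by
  rcases lt_or_ge (Fintype.card ι) (n + 1) with hn | hn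
  · have := hR.subsingleton_dualPart hn
    exact ⟨0, LinearMap.ext fun w => by rw [Subsingleton.elim w 0, map_zero, map_zero]⟩
  obtain ⟨z, rfl⟩ := (cochainEquiv R (n + 1)).surjective φ
  rw [← cochainEquiv_koszulMap, LinearEquiv.map_eq_zero_iff] at hφ
  have key : ∀ x, koszulMap (leftOps R) (dualSlice R (n + 1)) x = 0 →
      totalCount (hR.algCount Finset.univ)
        (((Fintype.card ι - (n + 1) : ℕ) : ℂ) • LinearMap.id) x ∈
        LinearMap.range (koszulMap (leftOps R) (dualSlice R n)) := by
    intro x hx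
    rw [← hR.totalCount_add_left hR' h hn x]
    exact Submodule.add_mem _ (hR.totalCount_mem_range_left_succ n hx)
      (hR'.totalCount_mem_range_left_succ n hx)
  obtain ⟨y, hy⟩ := mem_of_totalCount_mem hR (c := Fintype.card ι - (n + 1))
      (B := LinearMap.range (koszulMap (leftOps R) (dualSlice R n)))
      (by rintro _ ⟨y, rfl⟩; exact key _ (koszulMap_left_koszulMap R n y)) (key z hφ)
      (hc.imp (fun _ => by omega) fun hw =>
        ⟨LinearMap.ext fun w => by rw [← augmentation_cochainEquiv, hw, LinearMap.zero_apply],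
          by rintro _ ⟨y, rfl⟩; exact augmentLeft_koszulMap_left R _ y⟩)
  exact ⟨cochainEquiv R n y, by rw [← cochainEquiv_koszulMap, hy]⟩

end Twist

end Quadratic

/-! ### Twists built from commuting matrices supported on two blocks. -/

namespace Quadratic

variable {ι : Type} [Fintype ι] [DecidableEq ι]

/-- The projector to the span of the `x_i` with `i ∈ S`. -/
def coordProj (S : Finset ι) : Matrix ι ι ℂ := Matrix.diagonal fun i => if i ∈ S then 1 else 0

theorem commute_coordProj {S : Finset ι} {X : Matrix ι ι ℂ}
    (hX : ∀ i j, ¬ (i ∈ S ↔ j ∈ S) → X i j = 0) : Commute X (coordProj S) := by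
  ext i j
  rw [coordProj, Matrix.mul_diagonal, Matrix.diagonal_mul]
  by_cases h : i ∈ S ↔ j ∈ S
  · simp only [h, mul_comm]
  · rw [hX i j h, mul_zero, zero_mul]

theorem mul_eq_zero_of_blocks {S : Finset ι} {X Y : Matrix ι ι ℂ}
    (hX : ∀ i j, j ∈ S → X i j = 0) (hY : ∀ i j, i ∉ S → Y i j = 0) : X * Y = 0 := by
  ext i j
  rw [Matrix.mul_apply, Matrix.zero_apply]
  refine Finset.sum_eq_zero fun k _ => ?_
  by_cases h : k ∈ S
  · rw [hX i k h, zero_mul]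
  · rw [hY k j h, mul_zero]

theorem sum_kronecker_apply {κ : Type} [Fintype κ] (A B : κ → Matrix ι ι ℂ) (p q : ι × ι) :
    (∑ e, Matrix.kroneckerMap (· * ·) (A e) (B e)) p q = ∑ e, A e p.1 q.1 * B e p.2 q.2 := by
  rw [Matrix.sum_apply]
  rfl

section OfBlocks

variable {L : Finset ι} {κ : Type} [Fintype κ]

/-- The first tensor factors of the operator extended by the identity. -/
def extendFst (L : Finset ι) (A : κ → Matrix ι ι ℂ) : κ ⊕ Bool → Matrix ι ι ℂ :=
  Sum.elim A fun b => cond b (coordProj L) (coordProj Lᶜ)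

/-- The second tensor factors of the operator extended by the identity. -/
def extendSnd (L : Finset ι) (B : κ → Matrix ι ι ℂ) : κ ⊕ Bool → Matrix ι ι ℂ :=
  Sum.elim B fun b => cond b 1 (coordProj Lᶜ)

/-- With p_S the projector to the letters of S, the two added terms p_L ⊗ 1 and p_{Lᶜ} ⊗ p_{Lᶜ} sum
to the identity on the products not of type Lᶜ ⊗ L. Being pure tensors, they keep the operator a sum
of tensor products. -/
theorem sum_kronecker_extend (A B : κ → Matrix ι ι ℂ) (p q : ι × ι) :
    (∑ e, Matrix.kroneckerMap (· * ·) (extendFst L A e) (extendSnd L B e)) p q =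
      ∑ e, A e p.1 q.1 * B e p.2 q.2 +
        if p.1 ∉ L ∧ p.2 ∈ L then 0 else (1 : Matrix (ι × ι) (ι × ι) ℂ) p q := by
  rw [sum_kronecker_apply, Fintype.sum_sum_type, Fintype.sum_bool]
  simp only [extendFst, extendSnd, Sum.elim_inl, Sum.elim_inr, cond_true, cond_false, coordProj,
    Matrix.diagonal_apply, Matrix.one_apply, Finset.mem_compl, Prod.ext_iff]
  congr 1
  by_cases h1 : p.1 = q.1 <;> by_cases h2 : p.2 = q.2 <;> by_cases h3 : p.1 ∈ L <;>
    by_cases h4 : p.2 ∈ L <;> simp_all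

theorem sum_mul_eq_zero_of_blocks {A B : κ → Matrix ι ι ℂ}
    (hA : ∀ e i j, i ∈ L ∨ j ∈ L → A e i j = 0) (hB : ∀ e i j, i ∉ L ∨ j ∉ L → B e i j = 0)
    (p q : ι × ι) (h : ¬ (p.1 ∉ L ∧ p.2 ∈ L ∧ q.1 ∉ L ∧ q.2 ∈ L)) :
    ∑ e, A e p.1 q.1 * B e p.2 q.2 = 0 :=
  Finset.sum_eq_zero fun e _ => by
    by_cases h1 : p.1 ∈ L ∨ q.1 ∈ L
    · rw [hA e _ _ h1, zero_mul]
    · rw [hB e _ _ (by tauto), mul_zero]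

theorem sum_kronecker_extend_mulVec {A B : κ → Matrix ι ι ℂ}
    (hA : ∀ e i j, i ∈ L ∨ j ∈ L → A e i j = 0) (hB : ∀ e i j, i ∉ L ∨ j ∉ L → B e i j = 0)
    (v : ι × ι → ℂ) (p : ι × ι) :
    (∑ e, Matrix.kroneckerMap (· * ·) (extendFst L A e) (extendSnd L B e)).mulVec v p =
      if p.1 ∉ L ∧ p.2 ∈ L then ∑ q : ι × ι, (∑ e, A e p.1 q.1 * B e p.2 q.2) * v q else v p := by
  rw [Matrix.mulVec, dotProduct]
  simp only [sum_kronecker_extend]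
  split_ifs with h1
  · simp
  · have h0 : ∀ q : ι × ι, ∑ e, A e p.1 q.1 * B e p.2 q.2 = 0 := fun q =>
      sum_mul_eq_zero_of_blocks hA hB p q fun h => h1 ⟨h.1, h.2.1⟩
    simp [h0, Matrix.one_apply]

theorem isUnit_sum_kronecker_extend {A B : κ → Matrix ι ι ℂ}
    (hA : ∀ e i j, i ∈ L ∨ j ∈ L → A e i j = 0) (hB : ∀ e i j, i ∉ L ∨ j ∉ L → B e i j = 0)
    (hinj : ∀ v : ι × ι → ℂ, (∀ p : ι × ι, p.1 ∉ L → p.2 ∈ L →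
      ∑ q : ι × ι, (∑ e, A e p.1 q.1 * B e p.2 q.2) * v q = 0) →
      (∀ p : ι × ι, ¬ (p.1 ∉ L ∧ p.2 ∈ L) → v p = 0) → v = 0) :
    IsUnit (∑ e, Matrix.kroneckerMap (· * ·) (extendFst L A e) (extendSnd L B e)) := by
  rw [← Matrix.mulVec_injective_iff_isUnit, ← Matrix.coe_mulVecLin, ← LinearMap.ker_eq_bot,
    LinearMap.ker_eq_bot']
  intro v hv
  have hp : ∀ p : ι × ι, _ = (0 : ℂ) := fun p =>
    (sum_kronecker_extend_mulVec hA hB v p).symm.trans (congrFun hv p)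
  refine hinj v (fun p h1 h2 => ?_) fun p h => ?_
  · simpa only [if_pos (And.intro h1 h2)] using hp p
  · simpa only [if_neg h] using hp p

/-- The twist given by commuting matrices supported on the two blocks. -/
def Twist.ofBlocks (A B : κ → Matrix ι ι ℂ)
    (hA : ∀ e i j, i ∈ L ∨ j ∈ L → A e i j = 0) (hB : ∀ e i j, i ∉ L ∨ j ∉ L → B e i j = 0)
    (commA : ∀ e e', Commute (A e) (A e')) (commB : ∀ e e', Commute (B e) (B e'))
    (hinj : ∀ v : ι × ι → ℂ, (∀ p : ι × ι, p.1 ∉ L → p.2 ∈ L →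
      ∑ q : ι × ι, (∑ e, A e p.1 q.1 * B e p.2 q.2) * v q = 0) →
      (∀ p : ι × ι, ¬ (p.1 ∉ L ∧ p.2 ∈ L) → v p = 0) → v = 0) :
    Twist L where
  κ := κ ⊕ Bool
  A := extendFst L A
  B := extendSnd L B
  commA := by
    have h : ∀ (e : κ) (b : Bool), Commute (A e) (cond b (coordProj L) (coordProj Lᶜ)) := by
      intro e b
      cases b <;> exact commute_coordProj fun i j hij => hA e i j (by
        first | tauto | (simp only [Finset.mem_compl] at hij; tauto))
    rintro (e | b) (e' | b')
    · exact commA e e'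
    · exact h e b'
    · exact (h e' b).symm
    · cases b <;> cases b' <;> exact Matrix.commute_diagonal _ _
  commB := by
    have h : ∀ (e : κ) (b : Bool), Commute (B e) (cond b 1 (coordProj Lᶜ)) := by
      intro e b
      cases b
      · exact commute_coordProj fun i j hij => hB e i j (by
          simp only [Finset.mem_compl] at hij; tauto)
      · exact Commute.one_right _
    rintro (e | b) (e' | b')
    · exact commB e e'
    · exact h e b'
    · exact (h e' b).symm
    · cases b <;> cases b' <;>
        first
        | exact Commute.one_right _
        | exact Commute.one_left _
        | exact Matrix.commute_diagonal _ _
  commAB := by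
    rintro (e | b) (e' | b')
    -- The supports of the blocks are complementary, so the products vanish in both orders.
    · have h1 : A e * B e' = 0 := mul_eq_zero_of_blocks (S := L)
        (fun i j h => hA e i j (Or.inr h)) fun i j h => hB e' i j (Or.inl h)
      have h2 : B e' * A e = 0 := mul_eq_zero_of_blocks (S := Lᶜ)
        (fun i j h => hB e' i j (Or.inr (Finset.mem_compl.1 h)))
        fun i j h => hA e i j (Or.inl (by simpa using h))
      exact h1.trans h2.symm
    · cases b'
      · exact commute_coordProj fun i j hij => hA e i j (by
          simp only [Finset.mem_compl] at hij; tauto)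
      · exact Commute.one_right _
    · cases b <;> exact (commute_coordProj fun i j hij => hB e' i j (by
        first | tauto | (simp only [Finset.mem_compl] at hij; tauto))).symm
    · cases b <;> cases b' <;>
        first
        | exact Commute.one_right _
        | exact Matrix.commute_diagonal _ _
  isUnit := isUnit_sum_kronecker_extend hA hB hinj
  block p q h := by
    rw [sum_kronecker_extend]
    rw [sum_mul_eq_zero_of_blocks hA hB p q h, zero_add]
    split_ifs with h1
    · rw [Matrix.one_apply_ne]
      rintro rfl
      exact h ⟨h1.1, h1.2, h1.1, h1.2⟩
    · rfl

theorem Twist.ofBlocks_mulVec (A B : κ → Matrix ι ι ℂ) (hA hB commA commB hinj) (v : ι × ι → ℂ)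
    (p : ι × ι) : (Twist.ofBlocks (L := L) A B hA hB commA commB hinj).mat.mulVec v p =
      if p.1 ∉ L ∧ p.2 ∈ L then ∑ q : ι × ι, (∑ e, A e p.1 q.1 * B e p.2 q.2) * v q else v p :=
  sum_kronecker_extend_mulVec hA hB v p

end OfBlocks

end Quadratic

/-! ### Commuting decomposition of the array R. -/

namespace NCProduct

open ComplexConjugate Quadratic

variable {N₁ N₂ : ℕ}

/-- An array satisfying the two Yang-Baxter conditions is a sum of tensor products of commuting
matrices. -/
theorem exists_commuting_decomposition (X : Fin N₁ → Fin N₂ → Fin N₂ → Fin N₁ → ℂ)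
    (h1 : ∀ lam mu al be ga de, ∑ rho, X lam al ga rho * X rho be de mu =
      ∑ rho, X lam be de rho * X rho al ga mu)
    (h2 : ∀ lam mu nu rho al be, ∑ ga, X lam al ga nu * X mu ga be rho =
      ∑ ga, X mu al ga rho * X lam ga be nu) :
    ∃ (d : ℕ) (P : Fin d → Matrix (Fin N₁) (Fin N₁) ℂ) (Q : Fin d → Matrix (Fin N₂) (Fin N₂) ℂ),
      (∀ e e', Commute (P e) (P e')) ∧ (∀ e e', Commute (Q e) (Q e')) ∧
      ∀ lam al be mu, X lam al be mu = ∑ e, P e mu lam * Q e be al := by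
  let M : Fin N₂ × Fin N₂ → Matrix (Fin N₁) (Fin N₁) ℂ :=
    fun p => Matrix.of fun mu lam => X lam p.1 p.2 mu
  let N : Fin N₁ × Fin N₁ → Matrix (Fin N₂) (Fin N₂) ℂ :=
    fun p => Matrix.of fun be al => X p.2 al be p.1
  have hM : ∀ p q, Commute (M p) (M q) := by
    intro p q
    ext mu lam
    simp only [M, Matrix.mul_apply, Matrix.of_apply]
    rw [Finset.sum_congr rfl fun rho _ => mul_comm (X rho p.1 p.2 mu) _, h1]
    exact Finset.sum_congr rfl fun rho _ => mul_comm _ _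
  have hN : ∀ p q, Commute (N p) (N q) := by
    intro p q
    ext be al
    simp only [N, Matrix.mul_apply, Matrix.of_apply]
    rw [Finset.sum_congr rfl fun ga _ => mul_comm (X p.2 ga be p.1) _, h2]
    exact Finset.sum_congr rfl fun ga _ => mul_comm _ _
  let V := Submodule.span ℂ (Set.range M)
  have hV : ∀ x ∈ V, ∀ y ∈ V, Commute x y := by
    intro x hx y hy
    refine Submodule.span_induction (p := fun x _ => Commute x y) ?_ (Commute.zero_left _)
      (fun _ _ _ _ h h' => h.add_left h') (fun c _ _ h => h.smul_left c) hx
    rintro _ ⟨p, rfl⟩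
    refine Submodule.span_induction (p := fun y _ => Commute (M p) y) ?_ (Commute.zero_right _)
      (fun _ _ _ _ h h' => h.add_right h') (fun c _ _ h => h.smul_right c) hy
    rintro _ ⟨q, rfl⟩
    exact hM p q
  let b := Module.finBasis ℂ V
  -- Extending the coordinate functionals from `V` to all matrices expresses the second factors as
  -- linear combinations of the matrices `N`, which commute by the second Yang-Baxter condition.
  choose f hf using fun e => LinearMap.exists_extend (b.coord e)
  have hfM : ∀ e (Y : Matrix (Fin N₁) (Fin N₁) ℂ),
      f e Y = ∑ p : Fin N₁ × Fin N₁, f e (Matrix.single p.1 p.2 1) * Y p.1 p.2 := by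
    intro e Y
    conv_lhs => rw [Matrix.matrix_eq_sum_single Y]
    rw [map_sum, Fintype.sum_prod_type]
    refine Finset.sum_congr rfl fun i _ => ?_
    rw [map_sum]
    refine Finset.sum_congr rfl fun j _ => ?_
    rw [← mul_one (Y i j), ← smul_eq_mul, ← Matrix.smul_single, map_smul]
    simp [mul_comm]
  refine ⟨_, fun e => (b e : Matrix (Fin N₁) (Fin N₁) ℂ),
    fun e => Matrix.of fun be al => f e (M (al, be)), fun e e' => hV _ (b e).2 _ (b e').2, ?_, ?_⟩
  · have hQ : ∀ e, (Matrix.of fun be al => f e (M (al, be)) : Matrix (Fin N₂) (Fin N₂) ℂ) =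
        ∑ p : Fin N₁ × Fin N₁, f e (Matrix.single p.1 p.2 1) • N p := by
      intro e
      ext be al
      rw [Matrix.of_apply, hfM, Matrix.sum_apply]
      rfl
    intro e e'
    change Commute (Matrix.of fun be al => f e (M (al, be)))
      (Matrix.of fun be al => f e' (M (al, be)))
    rw [hQ, hQ]
    exact Commute.sum_left _ _ _ fun p _ => Commute.sum_right _ _ _ fun q _ =>
      ((hN p q).smul_left _).smul_right _
  · intro lam al be mu
    have hmem : M (al, be) ∈ V := Submodule.subset_span ⟨_, rfl⟩
    have h := congrArg (fun v : V => (v : Matrix (Fin N₁) (Fin N₁) ℂ) mu lam)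
      (b.sum_repr ⟨M (al, be), hmem⟩)
    simp only [AddSubmonoidClass.coe_finsetSum, Submodule.coe_smul, Matrix.sum_apply,
      Matrix.smul_apply, smul_eq_mul] at h
    refine h.symm.trans (Finset.sum_congr rfl fun e _ => ?_)
    rw [mul_comm]
    congr 1
    exact (LinearMap.congr_fun (hf e) ⟨M (al, be), hmem⟩).symm

end NCProduct

/-! ### The relations of A_R and the two twists they define. -/

namespace NCProduct

open ComplexConjugate Quadratic

variable {N₁ N₂ : ℕ}

theorem conj_realCondition {R : Fin N₁ → Fin N₂ → Fin N₂ → Fin N₁ → ℂ} (hreal : RealCondition R)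
    (lam nu : Fin N₁) (al ga : Fin N₂) :
    ∑ be, ∑ mu, R lam al be mu * conj (R mu be ga nu) = if lam = nu ∧ al = ga then 1 else 0 := by
  have h := congrArg conj (hreal lam nu al ga)
  simpa only [map_sum, map_mul, Complex.conj_conj, apply_ite conj, map_one, map_zero] using h

theorem sum_sum_mul_inverse {X Y : Fin N₁ → Fin N₂ → Fin N₂ → Fin N₁ → ℂ}
    (hXY : ∀ lam nu al ga, ∑ be, ∑ mu, X lam al be mu * Y mu be ga nu =
      if lam = nu ∧ al = ga then 1 else 0)
    (v : Fin N₁ → Fin N₂ → ℂ) (nu : Fin N₁) (ga : Fin N₂) :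
    ∑ be, ∑ mu, (∑ lam, ∑ al, X lam al be mu * v lam al) * Y mu be ga nu = v nu ga := by
  simp only [Finset.sum_mul]
  calc ∑ be, ∑ mu, ∑ lam, ∑ al, X lam al be mu * v lam al * Y mu be ga nu
      = ∑ lam, ∑ al, v lam al * ∑ be, ∑ mu, X lam al be mu * Y mu be ga nu := by
        simp only [Finset.mul_sum]
        rw [Finset.sum_congr rfl fun be _ => Finset.sum_comm, Finset.sum_comm]
        refine Finset.sum_congr rfl fun lam _ => ?_
        rw [Finset.sum_congr rfl fun be _ => Finset.sum_comm, Finset.sum_comm]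
        refine Finset.sum_congr rfl fun al _ => Finset.sum_congr rfl fun be _ =>
          Finset.sum_congr rfl fun mu _ => by ring
    _ = v nu ga := by
        simp only [hXY, ite_and, mul_ite, mul_one, mul_zero]
        simp

/-- If `v · X = 0` and `X · Y = 1`, then `v = 0`. -/
theorem eq_zero_of_sum_mul_eq_zero {X Y : Fin N₁ → Fin N₂ → Fin N₂ → Fin N₁ → ℂ}
    (hXY : ∀ lam nu al ga, ∑ be, ∑ mu, X lam al be mu * Y mu be ga nu =
      if lam = nu ∧ al = ga then 1 else 0)
    {v : Fin N₁ → Fin N₂ → ℂ} (hv : ∀ be mu, ∑ lam, ∑ al, X lam al be mu * v lam al = 0)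
    (nu : Fin N₁) (ga : Fin N₂) : v nu ga = 0 := by
  rw [← sum_sum_mul_inverse hXY v]
  simp [hv]

/-- The conditions on the coefficients of the elements of the space of relations. -/
theorem mem_relations_iff {R : Fin N₁ → Fin N₂ → Fin N₂ → Fin N₁ → ℂ} (hreal : RealCondition R)
    (r : (Fin N₁ ⊕ Fin N₂) × (Fin N₁ ⊕ Fin N₂) → ℂ) : r ∈ relations R ↔
      (∀ lam mu, r (.inl lam, .inl mu) = - r (.inl mu, .inl lam)) ∧
      (∀ al be, r (.inr al, .inr be) = - r (.inr be, .inr al)) ∧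
      ∀ mu be, r (.inl mu, .inr be) =
        - ∑ lam, ∑ al, conj (R lam al be mu) * r (.inr al, .inl lam) := by
  constructor
  · intro hr
    refine Submodule.span_induction (p := fun r _ =>
      (∀ lam mu, r (.inl lam, .inl mu) = - r (.inl mu, .inl lam)) ∧
      (∀ al be, r (.inr al, .inr be) = - r (.inr be, .inr al)) ∧
      ∀ mu be, r (.inl mu, .inr be) =
        - ∑ lam, ∑ al, conj (R lam al be mu) * r (.inr al, .inl lam)) ?_ ?_ ?_ ?_ hr
    · rintro _ (((⟨lam, mu, rfl⟩ | ⟨al, be, rfl⟩) | ⟨lam, al, rfl⟩) | ⟨lam, al, rfl⟩)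
      · refine ⟨fun lam' mu' => ?_, fun al' be' => ?_, fun mu' be' => ?_⟩ <;>
          simp [word, Pi.single_apply, and_comm]
      · refine ⟨fun lam' mu' => ?_, fun al' be' => ?_, fun mu' be' => ?_⟩ <;>
          simp [word, Pi.single_apply, and_comm]
      · refine ⟨fun lam' mu' => ?_, fun al' be' => ?_, fun mu' be' => ?_⟩
        · simp [word]
        · simp [word]
        -- The coefficient condition is written with the conjugate of `R`; the relations written
        -- with `R` satisfy it because the two arrays are inverse to each other.
        · have h : ∀ lam'' al'', ((word (.inl lam) (.inr al) - ∑ be, ∑ mu, R lam al be mu •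
              word (.inr be) (.inl mu) : (Fin N₁ ⊕ Fin N₂) × (Fin N₁ ⊕ Fin N₂) → ℂ))
              (.inr al'', .inl lam'') = - R lam al al'' lam'' := by
            intro lam'' al''
            simp [word, Pi.single_apply, ite_and]
          simp only [h, mul_neg, Finset.sum_neg_distrib, neg_neg]
          have h' := conj_realCondition hreal lam mu' al be'
          rw [Finset.sum_comm] at h'
          simp only [mul_comm (conj _)]
          rw [h']
          simp [word, Pi.single_apply, eq_comm]
      · refine ⟨fun lam' mu' => ?_, fun al' be' => ?_, fun mu' be' => ?_⟩
        · simp [word]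
        · simp [word]
        · simp [word, Pi.single_apply, ite_and]
    · simp
    · rintro x y - - ⟨h1, h2, h3⟩ ⟨h1', h2', h3'⟩
      refine ⟨fun lam mu => ?_, fun al be => ?_, fun mu be => ?_⟩
      · rw [Pi.add_apply, Pi.add_apply, h1, h1', neg_add]
      · rw [Pi.add_apply, Pi.add_apply, h2, h2', neg_add]
      · simp only [Pi.add_apply, h3, h3', mul_add, Finset.sum_add_distrib, neg_add]
    · rintro c x - ⟨h1, h2, h3⟩
      refine ⟨fun lam mu => ?_, fun al be => ?_, fun mu be => ?_⟩
      · rw [Pi.smul_apply, Pi.smul_apply, h1, smul_neg]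
      · rw [Pi.smul_apply, Pi.smul_apply, h2, smul_neg]
      · simp only [Pi.smul_apply, h3, smul_eq_mul, mul_neg, Finset.mul_sum, mul_left_comm c]
  · rintro ⟨h1, h2, h3⟩
    -- The factor 1/2 compensates for counting each commutator twice. The mixed part needs only the
    -- relations with the conjugate coefficients.
    have h : r = ((1 / 2 : ℂ) • ∑ lam, ∑ mu, r (.inl lam, .inl mu) •
          (word (.inl lam) (.inl mu) - word (.inl mu) (.inl lam))) +
        ((1 / 2 : ℂ) • ∑ al, ∑ be, r (.inr al, .inr be) •
          (word (.inr al) (.inr be) - word (.inr be) (.inr al))) +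
        ∑ lam, ∑ al, r (.inr al, .inl lam) • (word (.inr al) (.inl lam) -
          ∑ be, ∑ mu, conj (R lam al be mu) • word (.inl mu) (.inr be)) := by
      funext ⟨i, j⟩
      rcases i with i | i <;> rcases j with j | j
      · simp [word, Pi.single_apply, ite_and, mul_sub, Finset.sum_sub_distrib]
        rw [h1 j i]
        ring
      · rw [h3]
        simp [word, Pi.single_apply, ite_and, mul_comm]
      · simp [word, Pi.single_apply, ite_and]
      · simp [word, Pi.single_apply, ite_and, mul_sub, Finset.sum_sub_distrib]
        rw [h2 j i]
        ring
    rw [h]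
    refine Submodule.add_mem _ (Submodule.add_mem _ ?_ ?_) ?_
    · exact Submodule.smul_mem _ _ (Submodule.sum_mem _ fun lam _ => Submodule.sum_mem _ fun mu _ =>
        Submodule.smul_mem _ _ (Submodule.subset_span (Or.inl (Or.inl (Or.inl ⟨lam, mu, rfl⟩)))))
    · exact Submodule.smul_mem _ _ (Submodule.sum_mem _ fun al _ => Submodule.sum_mem _ fun be _ =>
        Submodule.smul_mem _ _ (Submodule.subset_span (Or.inl (Or.inl (Or.inr ⟨al, be, rfl⟩)))))
    · exact Submodule.sum_mem _ fun lam _ => Submodule.sum_mem _ fun al _ =>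
        Submodule.smul_mem _ _ (Submodule.subset_span (Or.inr ⟨lam, al, rfl⟩))

/-- The indices of the generators of the first kind. -/
def firstKind (N₁ N₂ : ℕ) : Finset (Fin N₁ ⊕ Fin N₂) := Finset.univ.filter fun i => i.isLeft

theorem inl_mem_firstKind (lam : Fin N₁) :
    (Sum.inl lam : Fin N₁ ⊕ Fin N₂) ∈ firstKind N₁ N₂ := by
  simp [firstKind]

theorem inr_notMem_firstKind (al : Fin N₂) :
    (Sum.inr al : Fin N₁ ⊕ Fin N₂) ∉ firstKind N₁ N₂ := by
  simp [firstKind]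

/-- A matrix acting on the generators of the first kind. -/
abbrev firstBlock (P : Matrix (Fin N₁) (Fin N₁) ℂ) : Matrix (Fin N₁ ⊕ Fin N₂) (Fin N₁ ⊕ Fin N₂) ℂ :=
  Matrix.fromBlocks P 0 0 0

/-- A matrix acting on the generators of the second kind. -/
abbrev secondBlock (Q : Matrix (Fin N₂) (Fin N₂) ℂ) :
    Matrix (Fin N₁ ⊕ Fin N₂) (Fin N₁ ⊕ Fin N₂) ℂ :=
  Matrix.fromBlocks 0 0 0 Q

/-- The conjugate of `R` acts on the coefficients of x_2 ⊗ x_1. The mixed condition of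
`mem_relations_iff` then says exactly that the result is antisymmetric, and reality gives
invertibility. -/
theorem exists_compatible_firstKind {R : Fin N₁ → Fin N₂ → Fin N₂ → Fin N₁ → ℂ}
    (hreal : RealCondition R) (hyb1 : YangBaxterOne R) (hyb2 : YangBaxterTwo R) :
    ∃ T : Twist (firstKind N₁ N₂), T.Compatible (relations R) := by
  obtain ⟨d, P, Q, hP, hQ, hX⟩ := exists_commuting_decomposition
    (fun lam al be mu => conj (R lam al be mu))
    (fun lam mu al be ga de => (hyb1 lam mu al be ga de).2.1)
    (fun lam mu nu rho al be => (hyb2 lam mu nu rho al be).2.1)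
  have hsum : ∀ (v : (Fin N₁ ⊕ Fin N₂) × (Fin N₁ ⊕ Fin N₂) → ℂ) (be : Fin N₂) (mu : Fin N₁),
      ∑ q : (Fin N₁ ⊕ Fin N₂) × (Fin N₁ ⊕ Fin N₂), (∑ e, secondBlock (Q e) (.inr be) q.1 *
        firstBlock (P e) (.inl mu) q.2) * v q =
      ∑ lam, ∑ al, conj (R lam al be mu) * v (.inr al, .inl lam) := by
    intro v be mu
    simp only [Fintype.sum_prod_type, Fintype.sum_sum_type, Matrix.fromBlocks_apply₁₁,
      Matrix.fromBlocks_apply₂₂, Matrix.fromBlocks_apply₁₂, Matrix.fromBlocks_apply₂₁,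
      Matrix.zero_apply, mul_zero, zero_mul, Finset.sum_const_zero, add_zero, zero_add, hX]
    rw [Finset.sum_comm]
    simp only [mul_comm (Q _ _ _)]
  refine ⟨Twist.ofBlocks (fun e => secondBlock (Q e))
    (fun e => firstBlock (P e)) ?_ ?_ ?_ ?_ ?_, fun r => ?_⟩
  · rintro e (i | i) (j | j) <;> simp [inr_notMem_firstKind]
  · rintro e (i | i) (j | j) <;> simp [inl_mem_firstKind]
  · intro e e'
    rw [Commute, SemiconjBy, Matrix.fromBlocks_multiply, Matrix.fromBlocks_multiply]
    simp [(hQ e e').eq]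
  · intro e e'
    rw [Commute, SemiconjBy, Matrix.fromBlocks_multiply, Matrix.fromBlocks_multiply]
    simp [(hP e e').eq]
  · intro v hv hv'
    funext ⟨i, j⟩
    rcases i with i | i
    · exact hv' _ fun h => h.1 (inl_mem_firstKind i)
    rcases j with j | j
    · refine eq_zero_of_sum_mul_eq_zero (v := fun lam al => v (.inr al, .inl lam)) hreal
        (fun be mu => ?_) j i
      rw [← hsum v be mu]
      exact hv (.inr be, .inl mu) (inr_notMem_firstKind be) (inl_mem_firstKind mu)
    · exact hv' _ fun h => inr_notMem_firstKind j h.2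
  · rw [mem_relations_iff hreal]
    simp only [Twist.ofBlocks_mulVec]
    constructor
    · rintro ⟨h1, h2, h3⟩ (i | i) (j | j)
      · simpa [inl_mem_firstKind] using h1 i j
      · simpa [inl_mem_firstKind, inr_notMem_firstKind, hsum] using h3 i j
      · simpa [inl_mem_firstKind, inr_notMem_firstKind, hsum, eq_neg_iff_add_eq_zero, add_comm]
          using h3 j i
      · simpa [inr_notMem_firstKind] using h2 i j
    · intro h
      refine ⟨fun i j => ?_, fun i j => ?_, fun i j => ?_⟩
      · simpa [inl_mem_firstKind] using h (.inl i) (.inl j)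
      · simpa [inr_notMem_firstKind] using h (.inr i) (.inr j)
      · simpa [inl_mem_firstKind, inr_notMem_firstKind, hsum] using h (.inl i) (.inr j)

theorem exists_compatible_firstKind_compl {R : Fin N₁ → Fin N₂ → Fin N₂ → Fin N₁ → ℂ}
    (hreal : RealCondition R) (hyb1 : YangBaxterOne R) (hyb2 : YangBaxterTwo R) :
    ∃ T : Twist (firstKind N₁ N₂)ᶜ, T.Compatible (relations R) := by
  obtain ⟨d, P, Q, hP, hQ, hX⟩ := exists_commuting_decomposition R
    (fun lam mu al be ga de => (hyb1 lam mu al be ga de).1)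
    (fun lam mu nu rho al be => (hyb2 lam mu nu rho al be).1)
  have hl : ∀ lam : Fin N₁, (Sum.inl lam : Fin N₁ ⊕ Fin N₂) ∉ (firstKind N₁ N₂)ᶜ := fun lam => by
    simp [inl_mem_firstKind]
  have hr : ∀ al : Fin N₂, (Sum.inr al : Fin N₁ ⊕ Fin N₂) ∈ (firstKind N₁ N₂)ᶜ := fun al => by
    simp [inr_notMem_firstKind]
  have hsum : ∀ (v : (Fin N₁ ⊕ Fin N₂) × (Fin N₁ ⊕ Fin N₂) → ℂ) (mu : Fin N₁) (be : Fin N₂),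
      ∑ q : (Fin N₁ ⊕ Fin N₂) × (Fin N₁ ⊕ Fin N₂), (∑ e, firstBlock (P e) (.inl mu) q.1 *
        secondBlock (Q e) (.inr be) q.2) * v q =
      ∑ lam, ∑ al, R lam al be mu * v (.inl lam, .inr al) := by
    intro v mu be
    simp only [Fintype.sum_prod_type, Fintype.sum_sum_type, Matrix.fromBlocks_apply₁₁,
      Matrix.fromBlocks_apply₂₂, Matrix.fromBlocks_apply₁₂, Matrix.fromBlocks_apply₂₁,
      Matrix.zero_apply, mul_zero, zero_mul, Finset.sum_const_zero, add_zero, zero_add, hX]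
  refine ⟨Twist.ofBlocks (fun e => firstBlock (P e))
    (fun e => secondBlock (Q e)) ?_ ?_ ?_ ?_ ?_, fun r => ?_⟩
  · rintro e (i | i) (j | j) <;> simp [hl]
  · rintro e (i | i) (j | j) <;> simp [hr]
  · intro e e'
    rw [Commute, SemiconjBy, Matrix.fromBlocks_multiply, Matrix.fromBlocks_multiply]
    simp [(hP e e').eq]
  · intro e e'
    rw [Commute, SemiconjBy, Matrix.fromBlocks_multiply, Matrix.fromBlocks_multiply]
    simp [(hQ e e').eq]
  · intro v hv hv'
    funext ⟨i, j⟩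
    rcases i with i | i
    · rcases j with j | j
      · exact hv' _ fun h => hl j h.2
      · refine eq_zero_of_sum_mul_eq_zero (v := fun lam al => v (.inl lam, .inr al))
          (conj_realCondition hreal) (fun be mu => ?_) i j
        rw [← hsum v mu be]
        exact hv (.inl mu, .inr be) (hl mu) (hr be)
    · exact hv' _ fun h => h.1 (hr i)
  · rw [mem_relations_iff hreal]
    -- Reality inverts the mixed condition, so that `R` acts on the coefficients of x_1 ⊗ x_2
    -- instead.
    have hiff : (∀ mu be, r (.inl mu, .inr be) =
        - ∑ lam, ∑ al, conj (R lam al be mu) * r (.inr al, .inl lam)) ↔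
        ∀ mu be, ∑ lam, ∑ al, R lam al be mu * r (.inl lam, .inr al) = - r (.inr be, .inl mu) := by
      constructor
      · intro h mu be
        have := sum_sum_mul_inverse hreal (fun lam al => r (.inr al, .inl lam)) mu be
        rw [← this, Finset.sum_comm, ← Finset.sum_neg_distrib]
        refine Finset.sum_congr rfl fun al _ => ?_
        rw [← Finset.sum_neg_distrib]
        refine Finset.sum_congr rfl fun lam _ => ?_
        rw [h, mul_neg, mul_comm]
      · intro h mu be
        have := sum_sum_mul_inverse (conj_realCondition hreal)
          (fun lam al => r (.inl lam, .inr al)) mu be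
        rw [← this, Finset.sum_comm, ← Finset.sum_neg_distrib]
        refine Finset.sum_congr rfl fun lam _ => ?_
        rw [← Finset.sum_neg_distrib]
        refine Finset.sum_congr rfl fun al _ => ?_
        rw [h, neg_mul, mul_comm]
    rw [hiff]
    simp only [Twist.ofBlocks_mulVec]
    constructor
    · rintro ⟨h1, h2, h3⟩ (i | i) (j | j)
      · simpa [hl] using h1 i j
      · simpa [hl, hr, hsum] using h3 i j
      · simpa [hl, hr, hsum, eq_neg_iff_add_eq_zero, add_comm] using h3 j i
      · simpa [hr] using h2 i j
    · intro h
      refine ⟨fun i j => ?_, fun i j => ?_, fun i j => ?_⟩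
      · simpa [hl] using h (.inl i) (.inl j)
      · simpa [hr] using h (.inr i) (.inr j)
      · simpa [hl, hr, hsum] using h (.inl i) (.inr j)

end NCProduct

/-! ### Dimensions of the graded components and Hilbert series. -/

namespace Quadratic

variable {ι : Type} [Fintype ι] [DecidableEq ι]

section DotProduct

variable {X : Type} [Fintype X] [DecidableEq X]

/-- The bilinear form `∑ w_x t_x`. -/
noncomputable def dotForm (X : Type) [Fintype X] [DecidableEq X] : LinearMap.BilinForm ℂ (X → ℂ) :=
  Matrix.toBilin' (1 : Matrix X X ℂ)

theorem dotForm_apply (w t : X → ℂ) : dotForm X w t = ∑ x, w x * t x := by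
  rw [dotForm, Matrix.toBilin'_apply]
  simp [Matrix.one_apply]

theorem dotForm_nondegenerate : (dotForm X).Nondegenerate :=
  LinearMap.BilinForm.nondegenerate_toBilin'_of_det_ne_zero' _ (by simp)

theorem dotForm_isRefl : (dotForm X).IsRefl := fun w t h => by
  rw [dotForm_apply] at h ⊢
  rw [← h]
  exact Finset.sum_congr rfl fun x _ => mul_comm _ _

end DotProduct

theorem orthogonal_eq (R : Submodule ℂ (ι × ι → ℂ)) :
    orthogonal R = (dotForm (ι × ι)).orthogonal R := by
  ext ω
  rw [LinearMap.BilinForm.mem_orthogonal_iff]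
  refine forall₂_congr fun r _ => ?_
  rw [dotForm_apply]
  simp only [mul_comm]

theorem orthogonal_orthogonal (R : Submodule ℂ (ι × ι → ℂ)) : orthogonal (orthogonal R) = R := by
  rw [orthogonal_eq, orthogonal_eq]
  exact LinearMap.BilinForm.orthogonal_orthogonal dotForm_nondegenerate dotForm_isRefl R

section DegreePart

theorem word_mem_degreePart (R : Submodule ℂ (ι × ι → ℂ)) (l : List ι) :
    word R l ∈ degreePart R l.length := by
  induction l with
  | nil =>
    rw [degreePart, List.length_nil, pow_zero, word_nil]
    exact Submodule.one_le.1 le_rfl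
  | cons i l ih =>
    rw [word_cons, degreePart, List.length_cons, pow_succ']
    exact Submodule.mul_mem_mul (Submodule.subset_span ⟨i, rfl⟩) ih

theorem degreePart_eq_range (R : Submodule ℂ (ι × ι → ℂ)) (n : ℕ) :
    degreePart R n = LinearMap.range (evalTensor R n) := by
  refine le_antisymm ?_ ?_
  · induction n with
    | zero =>
      rw [degreePart, pow_zero, Submodule.one_le]
      exact ⟨wordTensor 0 [], evalTensor_wordTensor R (l := []) rfl⟩
    | succ n ih =>
      rw [degreePart, pow_succ', Submodule.mul_le]
      intro a ha b hb
      obtain ⟨t, rfl⟩ := ih hb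
      refine Submodule.span_induction (p := fun a _ => a * evalTensor R n t ∈ _) ?_ ?_ ?_ ?_ ha
      · rintro _ ⟨i, rfl⟩
        refine ⟨tensLeft n i t, ?_⟩
        refine LinearMap.congr_fun (f := evalTensor R (n + 1) ∘ₗ tensLeft n i)
          (g := LinearMap.mulLeft ℂ (gen R i) ∘ₗ evalTensor R n)
          (tensor_linearMap_ext fun l hl => ?_) t
        rw [LinearMap.comp_apply, tensLeft_wordTensor, evalTensor_wordTensor R (by simp [hl]),
          LinearMap.comp_apply, evalTensor_wordTensor R hl, word_cons, LinearMap.mulLeft_apply]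
      · rw [zero_mul]
        exact Submodule.zero_mem _
      · intro x y _ _ hx hy
        rw [add_mul]
        exact Submodule.add_mem _ hx hy
      · intro c x _ hx
        rw [smul_mul_assoc]
        exact Submodule.smul_mem _ _ hx
  · rintro _ ⟨t, rfl⟩
    rw [evalTensor_apply]
    refine Submodule.sum_mem _ fun f _ => Submodule.smul_mem _ _ ?_
    have := word_mem_degreePart R (List.ofFn f)
    rwa [List.length_ofFn] at this

/-- If `w` is in `dualPart`, pairing with `w` respects the orthogonal relations and so factors
through the Koszul dual. Conversely, testing against an orthogonal relation inserted at k, k + 1 and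
taking the double orthogonal recovers membership in `R`. -/
theorem mem_dualPart_iff_forall_ker (R : Submodule ℂ (ι × ι → ℂ)) {n : ℕ} (w : Tensor ι n) :
    w ∈ dualPart R n ↔
      w ∈ (dotForm (Fin n → ι)).orthogonal (LinearMap.ker (evalTensor (orthogonal R) n)) := by
  rw [LinearMap.BilinForm.mem_orthogonal_iff]
  constructor
  · intro hw t ht
    have hg : RespectsRelations (orthogonal R)
        fun l : List ι => dotForm (Fin n → ι) w (wordTensor n l) := by
      intro l₁ l₂ ω hω
      have hdot : ∀ f : Fin n → ι, dotForm (Fin n → ι) w (Pi.single f 1) = w f := fun f => by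
        rw [dotForm_apply]
        simp [Pi.single_apply]
      by_cases hl : l₁.length + (l₂.length + 1 + 1) = n
      · rcases isEmpty_or_nonempty ι with h | ⟨⟨i₀⟩⟩
        · exact Finset.sum_eq_zero fun p _ => h.elim p.1
        obtain ⟨f, hf⟩ := exists_ofFn_eq (n := n) (l := l₁ ++ i₀ :: i₀ :: l₂) (by simp [hl])
        have hk : l₁.length + 1 < n := by omega
        have hp : ∀ p : ι × ι, wordTensor n (l₁ ++ p.1 :: p.2 :: l₂) =
            Pi.single (Function.update (Function.update f ⟨l₁.length, Nat.lt_of_succ_lt hk⟩ p.1)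
              ⟨l₁.length + 1, hk⟩ p.2) 1 := by
          intro p
          rw [← wordTensor_ofFn, ofFn_update_update, hf]
          simp
        simp only [hp, hdot, smul_eq_mul]
        exact hω _ (hw l₁.length hk f)
      · refine Finset.sum_eq_zero fun p _ => ?_
        have h0 : wordTensor n (l₁ ++ p.1 :: p.2 :: l₂) = 0 := by
          funext f
          rw [wordTensor_apply, if_neg, Pi.zero_apply]
          intro h
          refine hl ?_
          have := congrArg List.length h
          simpa using this.symm
        change ω p • dotForm (Fin n → ι) w (wordTensor n (l₁ ++ p.1 :: p.2 :: l₂)) = 0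
        rw [h0, map_zero, smul_zero]
    have key : hg.lift (evalTensor (orthogonal R) n t) = dotForm (Fin n → ι) w t := by
      refine LinearMap.congr_fun (f := hg.lift ∘ₗ evalTensor (orthogonal R) n)
        (tensor_linearMap_ext fun l hl => ?_) t
      rw [LinearMap.comp_apply, evalTensor_wordTensor _ hl, hg.lift_word]
    rw [LinearMap.mem_ker.1 ht, map_zero] at key
    exact dotForm_isRefl _ _ key.symm
  · intro h k hk f
    rw [← orthogonal_orthogonal R]
    intro ω hω
    have ht : evalTensor (orthogonal R) n (∑ p : ι × ι, ω p • Pi.single (Function.update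
        (Function.update f ⟨k, Nat.lt_of_succ_lt hk⟩ p.1) ⟨k + 1, hk⟩ p.2) 1) = 0 := by
      obtain ⟨l₁, l₂, hl⟩ : ∃ l₁ l₂ : List ι, ∀ p : ι × ι, List.ofFn (Function.update
          (Function.update f ⟨k, Nat.lt_of_succ_lt hk⟩ p.1) ⟨k + 1, hk⟩ p.2) =
          l₁ ++ p.1 :: p.2 :: l₂ := ⟨_, _, fun p => ofFn_update_update f k hk p.1 p.2⟩
      rw [map_sum, ← sum_smul_word hω l₁ l₂]
      refine Finset.sum_congr rfl fun p _ => ?_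
      rw [map_smul, ← wordTensor_ofFn, evalTensor_wordTensor _ (List.length_ofFn), hl]
    have := h _ (LinearMap.mem_ker.2 ht)
    rw [map_sum, LinearMap.sum_apply] at this
    rw [← this]
    refine Finset.sum_congr rfl fun p _ => ?_
    rw [map_smul, LinearMap.smul_apply, dotForm_apply]
    simp [Pi.single_apply, mul_comm]

theorem finrank_degreePart_orthogonal (R : Submodule ℂ (ι × ι → ℂ)) (n : ℕ) :
    Module.finrank ℂ (degreePart (orthogonal R) n) = Module.finrank ℂ (dualPart R n) := by
  have h1 : dualPart R n =
      (dotForm (Fin n → ι)).orthogonal (LinearMap.ker (evalTensor (orthogonal R) n)) :=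
    Submodule.ext (mem_dualPart_iff_forall_ker R)
  have h2 : _ = Module.finrank ℂ ((Fin n → ι) → ℂ) :=
    (evalTensor (orthogonal R) n).finrank_range_add_finrank_ker
  rw [h1, degreePart_eq_range]
  exact (Nat.eq_sub_of_add_eq h2).trans
    (LinearMap.BilinForm.finrank_orthogonal dotForm_nondegenerate _).symm

theorem range_polyTensor (n : ℕ) : LinearMap.range (polyTensor ι n) = Submodule.span ℂ
    (Set.range fun s : Sym ι n => MvPolynomial.basisMonomials ι ℂ (Multiset.toFinsupp s.1)) := by
  refine le_antisymm ?_ ?_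
  · rintro _ ⟨t, rfl⟩
    rw [polyTensor_apply]
    refine Submodule.sum_mem _ fun f _ => Submodule.smul_mem _ _ (Submodule.subset_span
      ⟨⟨(List.ofFn f : Multiset ι), by simp⟩, ?_⟩)
    have := Twist.prod_map_X_eq_monomial (List.ofFn f)
    rw [List.map_ofFn, List.prod_ofFn] at this
    rw [MvPolynomial.coe_basisMonomials]
    exact this.symm
  · rw [Submodule.span_le]
    rintro _ ⟨⟨s, hs⟩, rfl⟩
    induction s using Quotient.inductionOn with
    | h l =>
      refine ⟨wordTensor n l, ?_⟩
      rw [polyTensor_wordTensor (by simpa using hs), Twist.prod_map_X_eq_monomial,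
        MvPolynomial.coe_basisMonomials]
      rfl

theorem finrank_range_polyTensor (n : ℕ) :
    Module.finrank ℂ (LinearMap.range (polyTensor ι n)) = (Fintype.card ι).multichoose n := by
  have hli : LinearIndependent ℂ fun s : Sym ι n =>
      MvPolynomial.basisMonomials ι ℂ (Multiset.toFinsupp s.1) :=
    (MvPolynomial.basisMonomials ι ℂ).linearIndependent.comp
      (fun s : Sym ι n => Multiset.toFinsupp s.1) fun s s' h =>
        Subtype.ext (Multiset.toFinsupp.injective h)
  rw [range_polyTensor, finrank_span_eq_card hli, Sym.card_sym_eq_multichoose]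

theorem Twist.Compatible.finrank_degreePart {L : Finset ι} {T : Twist L}
    {R : Submodule ℂ (ι × ι → ℂ)} (hR : T.Compatible R) (n : ℕ) :
    Module.finrank ℂ (degreePart R n) = (Fintype.card ι).multichoose n := by
  rw [← finrank_range_polyTensor, degreePart_eq_range,
    (hR.polyEquiv.submoduleMap (LinearMap.range (evalTensor R n))).finrank_eq]
  refine congrArg (fun M : Submodule ℂ (MvPolynomial ι ℂ) => Module.finrank ℂ M) ?_
  ext p
  constructor
  · rintro ⟨_, ⟨t, rfl⟩, rfl⟩
    exact ⟨T.sort n t, (hR.toPoly_evalTensor t).symm⟩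
  · rintro ⟨t, rfl⟩
    refine ⟨_, ⟨(T.sortEquiv n).symm t, rfl⟩, ?_⟩
    refine (hR.toPoly_evalTensor _).trans ?_
    rw [sort_sortEquiv_symm]

end DegreePart

section Series

theorem multichoose_le_pow (d n : ℕ) : d.multichoose n ≤ (n + 1) ^ d := by
  induction d generalizing n with
  | zero => cases n <;> simp
  | succ d ih =>
    have h : ∀ m, (d + 1).multichoose m ≤ (m + 1) * (m + 1) ^ d := by
      intro m
      induction m with
      | zero => simp
      | succ m ihm =>
        rw [Nat.multichoose_succ_succ]
        have h1 := ih (m + 1)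
        have h2 : (m + 1) * (m + 1) ^ d ≤ (m + 1) * (m + 1 + 1) ^ d := by gcongr; omega
        nlinarith
    rw [pow_succ']
    exact h n

theorem mk_multichoose (d : ℕ) : PowerSeries.mk (fun n => (d.multichoose n : ℚ)) =
    ((1 - PowerSeries.X) ^ d : PowerSeries ℚ)⁻¹ := by
  have h : PowerSeries.mk (fun n => (d.multichoose n : ℚ)) =
      (PowerSeries.invOneSubPow ℚ d).val := by
    cases d with
    | zero =>
      ext n
      cases n <;> simp [PowerSeries.invOneSubPow_zero, PowerSeries.coeff_one]
    | succ d =>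
      rw [PowerSeries.invOneSubPow_val_succ_eq_mk_add_choose]
      ext n
      rw [PowerSeries.coeff_mk, PowerSeries.coeff_mk, Nat.multichoose_eq]
      congr 1
      rw [show d + 1 + n - 1 = d + n by omega, Nat.choose_symm_add]
  rw [h, PowerSeries.eq_inv_iff_mul_eq_one (by simp), ← PowerSeries.invOneSubPow_inv_eq_one_sub_pow]
  exact (PowerSeries.invOneSubPow ℚ d).val_inv

theorem mk_choose (d : ℕ) : PowerSeries.mk (fun n => (d.choose n : ℚ)) =
    (1 + PowerSeries.X : PowerSeries ℚ) ^ d := by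
  have h : (1 + PowerSeries.X : PowerSeries ℚ) ^ d = ((1 + Polynomial.X : Polynomial ℚ) ^ d :) := by
    simp
  ext n
  rw [h, Polynomial.coeff_coe, Polynomial.coeff_one_add_X_pow, PowerSeries.coeff_mk]

end Series

end Quadratic

/-! ### The Koszul resolution of an arbitrary left module. -/

namespace Quadratic

variable {ι : Type} [Fintype ι] [DecidableEq ι]

section LastSlice

variable (R : Submodule ℂ (ι × ι → ℂ))

/-- The component `w_i` of `w = ∑ w_i ⊗ x_i`. -/
def lastSlice (n : ℕ) (i : ι) : dualPart R (n + 1) →ₗ[ℂ] dualPart R n where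
  toFun w := ⟨fun f => w.1 (Fin.snoc f i), by
    intro k hk f
    have h := w.2 k (hk.trans n.lt_succ_self) (Fin.snoc f i)
    have e : ∀ p : ι × ι,
        (Fin.snoc (Function.update (Function.update f ⟨k, Nat.lt_of_succ_lt hk⟩ p.1)
          ⟨k + 1, hk⟩ p.2) i : Fin (n + 1) → ι) =
        Function.update (Function.update (Fin.snoc f i : Fin (n + 1) → ι)
          ⟨k, Nat.lt_of_succ_lt (hk.trans n.lt_succ_self)⟩ p.1)
          ⟨k + 1, hk.trans n.lt_succ_self⟩ p.2 := by
      intro p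
      rw [Fin.snoc_update, Fin.snoc_update]
      rfl
    simpa only [e] using h⟩
  map_add' _ _ := rfl
  map_smul' _ _ := rfl

variable {R}

theorem slice_lastSlice {n : ℕ} (i j : ι) (w : dualPart R (n + 2)) :
    slice R n i (lastSlice R (n + 1) j w) = lastSlice R n j (slice R (n + 1) i w) := by
  refine Subtype.ext (funext fun f => ?_)
  change w.1 (Fin.snoc (Fin.cons i f : Fin (n + 1) → ι) j) = w.1 (Fin.cons i (Fin.snoc f j))
  rw [Fin.cons_snoc_eq_snoc_cons]

theorem lastSlice_lastSlice_mem {n : ℕ} (w : dualPart R (n + 2)) (f : Fin n → ι) :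
    (fun p : ι × ι => (lastSlice R n p.1 (lastSlice R (n + 1) p.2 w)).1 f) ∈ R := by
  rcases isEmpty_or_nonempty ι with h | ⟨⟨i₀⟩⟩
  · have h0 : (fun p : ι × ι => (lastSlice R n p.1 (lastSlice R (n + 1) p.2 w)).1 f) = 0 :=
      funext fun p => h.elim p.1
    rw [h0]
    exact R.zero_mem
  have h := w.2 n (by omega) (Fin.snoc (Fin.snoc f i₀ : Fin (n + 1) → ι) i₀)
  convert h using 2 with p
  change w.1 (Fin.snoc (Fin.snoc f p.1 : Fin (n + 1) → ι) p.2) = _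
  refine congrArg w.1 ?_
  have h1 : (⟨n, Nat.lt_of_succ_lt (by omega)⟩ : Fin (n + 2)) = (Fin.last n).castSucc := rfl
  have h2 : (⟨n + 1, by omega⟩ : Fin (n + 2)) = Fin.last (n + 1) := rfl
  rw [h1, h2, ← Fin.snoc_update, Fin.update_snoc_last, Fin.update_snoc_last]

end LastSlice

section Resolution

variable (R : Submodule ℂ (ι × ι → ℂ)) (M : Type) [AddCommGroup M] [Module ℂ M] [Module (Alg R) M]
  [IsScalarTower ℂ (Alg R) M]

/-- The terms of the Koszul resolution of a left module. -/
abbrev ResTerm (n : ℕ) : Type := Alg R ⊗[ℂ] (dualPart R n ⊗[ℂ] M)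

/-- The part of the differential which moves the first letter to the left. -/
noncomputable def leftDiff (n : ℕ) : ResTerm R M (n + 1) →ₗ[Alg R] ResTerm R M n :=
  ∑ i : ι, TensorProduct.AlgebraTensorModule.map (rightMul R (gen R i))
    (TensorProduct.map (slice R n i) LinearMap.id)

/-- The part of the differential which moves the last letter to the right. -/
noncomputable def rightDiff (n : ℕ) : ResTerm R M (n + 1) →ₗ[Alg R] ResTerm R M n :=
  ∑ i : ι, TensorProduct.AlgebraTensorModule.map LinearMap.id
    (TensorProduct.map (lastSlice R n i) (Algebra.lsmul ℂ ℂ M (gen R i)))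

/-- The differential of the Koszul resolution of a left module. -/
noncomputable def resDiff (n : ℕ) : ResTerm R M (n + 1) →ₗ[Alg R] ResTerm R M n :=
  leftDiff R M n + (-1 : ℤ) ^ (n + 1) • rightDiff R M n

variable {R M}

theorem leftDiff_tmul {n : ℕ} (a : Alg R) (w : dualPart R (n + 1)) (m : M) :
    leftDiff R M n (a ⊗ₜ (w ⊗ₜ m)) = ∑ i, (a * gen R i) ⊗ₜ (slice R n i w ⊗ₜ m) := by
  rw [leftDiff, LinearMap.sum_apply]
  rfl

theorem rightDiff_tmul {n : ℕ} (a : Alg R) (w : dualPart R (n + 1)) (m : M) :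
    rightDiff R M n (a ⊗ₜ (w ⊗ₜ m)) = ∑ i, a ⊗ₜ (lastSlice R n i w ⊗ₜ (gen R i • m)) := by
  rw [rightDiff, LinearMap.sum_apply]
  rfl

theorem resDiff_apply {n : ℕ} (z : ResTerm R M (n + 1)) :
    resDiff R M n z = leftDiff R M n z + (-1 : ℤ) ^ (n + 1) • rightDiff R M n z := rfl

theorem resTerm_induction {n : ℕ} {P : ResTerm R M n → Prop} (z : ResTerm R M n)
    (h : ∀ a w m, P (a ⊗ₜ (w ⊗ₜ m))) (h0 : P 0) (hadd : ∀ x y, P x → P y → P (x + y)) : P z := by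
  induction z using TensorProduct.induction_on with
  | zero => exact h0
  | add x y hx hy => exact hadd x y hx hy
  | tmul a u =>
    induction u using TensorProduct.induction_on with
    | zero => rwa [TensorProduct.tmul_zero]
    | add x y hx hy => rw [TensorProduct.tmul_add]; exact hadd _ _ hx hy
    | tmul w m => exact h a w m

theorem leftDiff_leftDiff {n : ℕ} (z : ResTerm R M (n + 2)) :
    leftDiff R M n (leftDiff R M (n + 1) z) = 0 := by
  induction z using resTerm_induction with
  | h0 => simp
  | hadd x y hx hy => rw [map_add, map_add, hx, hy, add_zero]
  | h a w m =>
    have h := congrArg (TensorProduct.map (LinearMap.mulLeft ℂ a)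
      ((TensorProduct.mk ℂ (dualPart R n) M).flip m)) (sum_gen_mul_gen_tmul (slice_slice_mem w))
    rw [map_sum, map_zero, Fintype.sum_prod_type] at h
    rw [leftDiff_tmul, map_sum, ← h]
    refine Finset.sum_congr rfl fun i _ => ?_
    rw [leftDiff_tmul]
    refine Finset.sum_congr rfl fun j _ => ?_
    rw [TensorProduct.map_tmul, LinearMap.mulLeft_apply, mul_assoc]
    rfl

theorem rightDiff_rightDiff {n : ℕ} (z : ResTerm R M (n + 2)) :
    rightDiff R M n (rightDiff R M (n + 1) z) = 0 := by
  induction z using resTerm_induction with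
  | h0 => simp
  | hadd x y hx hy => rw [map_add, map_add, hx, hy, add_zero]
  | h a w m =>
    have h := congrArg (TensorProduct.mk ℂ (Alg R) (dualPart R n ⊗[ℂ] M) a ∘ₗ
      (TensorProduct.comm ℂ M (dualPart R n)).toLinearMap ∘ₗ
      TensorProduct.map ((Algebra.lsmul ℂ ℂ M).toLinearMap.flip m) LinearMap.id)
      (sum_gen_mul_gen_tmul (lastSlice_lastSlice_mem w))
    rw [map_sum, map_zero, Fintype.sum_prod_type, Finset.sum_comm] at h
    rw [rightDiff_tmul, map_sum, ← h]
    refine Finset.sum_congr rfl fun i _ => ?_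
    rw [rightDiff_tmul]
    refine Finset.sum_congr rfl fun j _ => ?_
    rw [← mul_smul]
    rfl

theorem leftDiff_rightDiff {n : ℕ} (z : ResTerm R M (n + 2)) :
    leftDiff R M n (rightDiff R M (n + 1) z) = rightDiff R M n (leftDiff R M (n + 1) z) := by
  induction z using resTerm_induction with
  | h0 => simp
  | hadd x y hx hy => simp only [map_add, hx, hy]
  | h a w m =>
    simp only [leftDiff_tmul, rightDiff_tmul, map_sum, slice_lastSlice]
    exact Finset.sum_comm

theorem resDiff_resDiff {n : ℕ} (z : ResTerm R M (n + 2)) :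
    resDiff R M n (resDiff R M (n + 1) z) = 0 := by
  simp only [resDiff_apply, map_add, map_zsmul, leftDiff_leftDiff, rightDiff_rightDiff,
    leftDiff_rightDiff, smul_zero, zero_add, add_zero]
  rw [pow_succ _ (n + 1), mul_neg_one, neg_smul, add_neg_cancel]

theorem exact_leftDiff (hR : IsKoszul R) (n : ℕ) :
    Function.Exact (leftDiff R M (n + 1)) (leftDiff R M n) := by
  have hfg : Function.Exact (koszulMap (rightOps R) (slice R (n + 1)))
      (koszulMap (rightOps R) (slice R n)) := by
    intro z
    rw [← koszulDifferential_apply, hR n z]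
    simp only [Set.mem_range, koszulDifferential_apply]
  have h := Module.Flat.rTensor_exact M hfg
  have hcomm : ∀ (k : ℕ) (z : (Alg R ⊗[ℂ] dualPart R (k + 1)) ⊗[ℂ] M),
      leftDiff R M k (TensorProduct.assoc ℂ _ _ _ z) = TensorProduct.assoc ℂ _ _ _
        ((koszulMap (rightOps R) (slice R k)).rTensor M z) := by
    intro k z
    induction z using TensorProduct.induction_on with
    | zero => simp only [map_zero]
    | add x y hx hy => simp only [map_add, hx, hy]
    | tmul u m =>
      induction u using TensorProduct.induction_on with
      | zero => simp only [TensorProduct.zero_tmul, map_zero]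
      | add x y hx hy => simp only [TensorProduct.add_tmul, map_add, hx, hy]
      | tmul a w =>
        rw [TensorProduct.assoc_tmul, leftDiff_tmul, LinearMap.rTensor_tmul, koszulMap_tmul,
          TensorProduct.sum_tmul, map_sum]
        rfl
  intro z
  obtain ⟨x, rfl⟩ := (TensorProduct.assoc ℂ (Alg R) (dualPart R (n + 1)) M).surjective z
  rw [hcomm, LinearEquiv.map_eq_zero_iff, h x]
  constructor
  · rintro ⟨y, rfl⟩
    exact ⟨TensorProduct.assoc ℂ _ _ _ y, hcomm (n + 1) y⟩
  · rintro ⟨y, hy⟩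
    obtain ⟨y, rfl⟩ := (TensorProduct.assoc ℂ (Alg R) (dualPart R (n + 2)) M).surjective y
    rw [hcomm] at hy
    exact ⟨y, (TensorProduct.assoc ℂ _ _ _).injective hy⟩

/-- The component of degree `k` for the grading of the algebra. -/
noncomputable abbrev resProj (k n : ℕ) : ResTerm R M n →ₗ[ℂ] ResTerm R M n :=
  TensorProduct.map (degreeProj R k) LinearMap.id

theorem resProj_succ_leftDiff (k : ℕ) {n : ℕ} (z : ResTerm R M (n + 1)) :
    resProj (k + 1) n (leftDiff R M n z) = leftDiff R M n (resProj k (n + 1) z) := by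
  induction z using resTerm_induction with
  | h0 => simp
  | hadd x y hx hy => simp only [map_add, hx, hy]
  | h a w m =>
    simp only [leftDiff_tmul, map_sum, TensorProduct.map_tmul, degreeProj_succ_mul_gen,
      LinearMap.id_apply]

theorem resProj_zero_leftDiff {n : ℕ} (z : ResTerm R M (n + 1)) :
    resProj 0 n (leftDiff R M n z) = 0 := by
  induction z using resTerm_induction with
  | h0 => simp
  | hadd x y hx hy => rw [map_add, map_add, hx, hy, add_zero]
  | h a w m =>
    simp only [leftDiff_tmul, map_sum, TensorProduct.map_tmul, degreeProj_zero_mul_gen,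
      TensorProduct.zero_tmul, Finset.sum_const_zero]

theorem resProj_rightDiff (k : ℕ) {n : ℕ} (z : ResTerm R M (n + 1)) :
    resProj k n (rightDiff R M n z) = rightDiff R M n (resProj k (n + 1) z) := by
  induction z using resTerm_induction with
  | h0 => simp
  | hadd x y hx hy => simp only [map_add, hx, hy]
  | h a w m =>
    simp only [rightDiff_tmul, map_sum, TensorProduct.map_tmul, LinearMap.id_apply]

theorem resProj_resProj (k m : ℕ) {n : ℕ} (z : ResTerm R M n) :
    resProj k n (resProj m n z) = if k = m then resProj k n z else 0 := by
  induction z using resTerm_induction with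
  | h0 => simp
  | hadd x y hx hy =>
    simp only [map_add, hx, hy]
    split_ifs <;> simp
  | h a w x =>
    simp only [TensorProduct.map_tmul, LinearMap.id_apply, degreeProj_degreeProj]
    split_ifs <;> simp

/-- Filter by the degree of the algebra factor: `leftDiff` raises it by one and `rightDiff`
preserves it. The top component of a cycle is a cycle for `leftDiff`, hence a boundary by
Koszulness; subtracting a full boundary lowers the top degree. -/
theorem exists_resDiff_eq (hR : IsKoszul R) {n : ℕ} {z : ResTerm R M (n + 1)}
    (hz : resDiff R M n z = 0) : ∃ y, resDiff R M (n + 1) y = z := by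
  obtain ⟨N, hN⟩ := exists_sum_map_degreeProj (R := R)
        (U := dualPart R (n + 1) ⊗[ℂ] M) z
  have h : ∀ (k : ℕ) (z : ResTerm R M (n + 1)), resDiff R M n z = 0 →
      (∀ j, k ≤ j → resProj j (n + 1) z = 0) → ∃ y, resDiff R M (n + 1) y = z := by
    intro k
    induction k with
    | zero =>
      intro z _ hj
      obtain ⟨N, hN⟩ := exists_sum_map_degreeProj (R := R)
        (U := dualPart R (n + 1) ⊗[ℂ] M) z
      refine ⟨0, ?_⟩
      rw [map_zero, ← hN N le_rfl]
      exact (Finset.sum_eq_zero fun j _ => hj j (Nat.zero_le j)).symm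
    | succ k ih =>
      intro z hz hj
      have h1 : leftDiff R M n (resProj k (n + 1) z) = 0 := by
        have h2 := congrArg (resProj (k + 1) n) hz
        rwa [resDiff_apply, map_add, map_zsmul, resProj_succ_leftDiff, resProj_rightDiff,
          hj (k + 1) le_rfl, map_zero, smul_zero, add_zero, map_zero] at h2
      obtain ⟨y, hy⟩ := (exact_leftDiff hR n _).1 h1
      -- The preimage is made homogeneous of degree one less, so that its `rightDiff` contributes
      -- nothing in degree `k`. For `k = 0` the component itself must vanish.
      have h3 : ∃ y' : ResTerm R M (n + 2), leftDiff R M (n + 1) y' = resProj k (n + 1) z ∧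
          ∀ j, k ≤ j → resProj j (n + 2) y' = 0 := by
        have h4 := congrArg (resProj k (n + 1)) hy
        rw [resProj_resProj, if_pos rfl] at h4
        cases k with
        | zero =>
          rw [resProj_zero_leftDiff] at h4
          exact ⟨0, by rw [map_zero, h4], fun j _ => map_zero _⟩
        | succ k =>
          rw [resProj_succ_leftDiff] at h4
          refine ⟨_, h4, fun j hj => ?_⟩
          rw [resProj_resProj, if_neg (by omega)]
      obtain ⟨y', hy', hy0⟩ := h3
      obtain ⟨x, hx⟩ := ih (z - resDiff R M (n + 1) y') (by
        rw [map_sub, hz, resDiff_resDiff, sub_zero]) fun j hkj => by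
          rw [resDiff_apply, hy', map_sub, map_add, map_zsmul, resProj_rightDiff, hy0 j hkj,
            map_zero, smul_zero, add_zero, resProj_resProj]
          split_ifs with hjk
          · rw [sub_self]
          · rw [hj j (by omega), sub_zero]
      exact ⟨x + y', by rw [map_add, hx, sub_add_cancel]⟩
  refine h N z hz fun j hj => ?_
  conv_lhs => rw [← hN N le_rfl, map_sum]
  refine Finset.sum_eq_zero fun k hk => ?_
  rw [Finset.mem_range] at hk
  exact (resProj_resProj j k z).trans (if_neg (by omega))

variable (R M) in
/-- The augmentation of the Koszul resolution. -/
noncomputable def resAug : ResTerm R M 0 →ₗ[Alg R] M :=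
  TensorProduct.AlgebraTensorModule.lift (LinearMap.toSpanSingleton (Alg R)
    (dualPart R 0 ⊗[ℂ] M →ₗ[ℂ] M) (TensorProduct.lift
      (LinearMap.lsmul ℂ M ∘ₗ LinearMap.proj default ∘ₗ (dualPart R 0).subtype)))

theorem resAug_tmul (a : Alg R) (w : dualPart R 0) (m : M) :
    resAug R M (a ⊗ₜ (w ⊗ₜ m)) = a • w.1 default • m := rfl

variable (R) in
/-- The unit tensor of degree zero. -/
def unitTensor : dualPart R 0 := ⟨fun _ => 1, fun _ hk => absurd hk (Nat.not_lt_zero _)⟩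

theorem eq_smul_unitTensor (w : dualPart R 0) : w = w.1 default • unitTensor R := by
  refine Subtype.ext (funext fun f => ?_)
  rw [Subsingleton.elim f default]
  exact (mul_one _).symm

variable (R) in
/-- The generator `x_i` as a tensor. -/
def letterTensor (i : ι) : dualPart R 1 := ⟨fun f => if f 0 = i then 1 else 0,
  fun _ hk => absurd hk (by omega)⟩

theorem slice_letterTensor (i j : ι) :
    slice R 0 j (letterTensor R i) = (if j = i then (1 : ℂ) else 0) • unitTensor R := by
  refine Subtype.ext (funext fun f => ?_)
  exact (mul_one _).symm

theorem lastSlice_letterTensor (i j : ι) :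
    lastSlice R 0 j (letterTensor R i) = (if j = i then (1 : ℂ) else 0) • unitTensor R := by
  refine Subtype.ext (funext fun f => ?_)
  exact (mul_one _).symm

theorem resDiff_letterTensor (a : Alg R) (i : ι) (m : M) :
    resDiff R M 0 (a ⊗ₜ (letterTensor R i ⊗ₜ m)) =
      (a * gen R i) ⊗ₜ (unitTensor R ⊗ₜ m) - a ⊗ₜ (unitTensor R ⊗ₜ (gen R i • m)) := by
  have h : ∀ x : ResTerm R M 0, (-1 : ℤ) ^ (0 + 1) • x = -x := fun x => by simp
  rw [resDiff_apply, leftDiff_tmul, rightDiff_tmul, h, ← sub_eq_add_neg]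
  simp only [slice_letterTensor, lastSlice_letterTensor, ite_smul, one_smul, zero_smul,
    TensorProduct.ite_tmul, TensorProduct.tmul_ite, Finset.sum_ite_eq', Finset.mem_univ, if_true]

/-- Modulo boundaries the last letter of a word in the algebra factor may be moved to act on `m`;
this is repeated until the word is empty. -/
theorem tmul_unitTensor_sub_mem (a : Alg R) (m : M) :
    a ⊗ₜ (unitTensor R ⊗ₜ m) - 1 ⊗ₜ (unitTensor R ⊗ₜ (a • m)) ∈
      LinearMap.range (resDiff R M 0) := by
  induction a using word_induction generalizing m with
  | h0 => simp
  | hadd x y hx hy =>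
    convert Submodule.add_mem _ (hx m) (hy m) using 1
    rw [add_smul, TensorProduct.add_tmul, TensorProduct.tmul_add, TensorProduct.tmul_add]
    abel
  | hsmul c x hx =>
    convert Submodule.smul_of_tower_mem _ c (hx m) using 1
    rw [smul_assoc, TensorProduct.tmul_smul, TensorProduct.tmul_smul, smul_sub]
    rfl
  | h l =>
    induction l using List.reverseRecOn generalizing m with
    | nil => simp [word_nil]
    | append_singleton l i ih =>
      rw [word_concat]
      have := Submodule.add_mem _ (ih (gen R i • m))
        (LinearMap.mem_range_self (resDiff R M 0) (word R l ⊗ₜ (letterTensor R i ⊗ₜ m)))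
      rw [resDiff_letterTensor] at this
      convert this using 1
      rw [mul_smul]
      abel

theorem exists_resDiff_zero_eq {z : ResTerm R M 0} (hz : resAug R M z = 0) :
    ∃ y, resDiff R M 0 y = z := by
  have h : ∀ z : ResTerm R M 0,
      z - 1 ⊗ₜ (unitTensor R ⊗ₜ resAug R M z) ∈ LinearMap.range (resDiff R M 0) := by
    intro z
    induction z using resTerm_induction with
    | h0 => simp
    | hadd x y hx hy =>
      convert Submodule.add_mem _ hx hy using 1
      rw [map_add, TensorProduct.tmul_add, TensorProduct.tmul_add]
      abel
    | h a w m =>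
      have := tmul_unitTensor_sub_mem a (w.1 default • m)
      rw [resAug_tmul]
      convert this using 2
      conv_lhs => rw [eq_smul_unitTensor w, TensorProduct.smul_tmul]
  have h := h z
  rwa [hz, TensorProduct.tmul_zero, TensorProduct.tmul_zero, sub_zero] at h

theorem resAug_resDiff (z : ResTerm R M 1) : resAug R M (resDiff R M 0 z) = 0 := by
  induction z using resTerm_induction with
  | h0 => simp
  | hadd x y hx hy => rw [map_add, map_add, hx, hy, add_zero]
  | h a w m =>
    rw [resDiff_apply, leftDiff_tmul, rightDiff_tmul, map_add, map_zsmul, map_sum, map_sum]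
    simp only [resAug_tmul, zero_add, pow_one, neg_one_smul]
    rw [add_neg_eq_zero]
    refine Finset.sum_congr rfl fun i _ => ?_
    have : (slice R 0 i w).1 default = (lastSlice R 0 i w).1 default :=
      congrArg w.1 (funext fun j => by
        obtain rfl : j = 0 := Subsingleton.elim (α := Fin 1) j 0
        rfl)
    rw [this, mul_smul, smul_comm (gen R i)]

theorem resAug_surjective : Function.Surjective (resAug R M) := fun m =>
  ⟨1 ⊗ₜ (unitTensor R ⊗ₜ m), by rw [resAug_tmul, one_smul]; exact one_smul ℂ m⟩

end Resolution

end Quadratic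

/-! ### Koszul cochains as maps out of the resolution. -/

namespace Quadratic

variable {ι : Type} [Fintype ι] [DecidableEq ι] {R : Submodule ℂ (ι × ι → ℂ)}

section Cochains

variable {M : Type} [AddCommGroup M] [Module ℂ M] [Module (Alg R) M] [IsScalarTower ℂ (Alg R) M]

/-- A linear form on the Koszul resolution of a one-dimensional module, as a Koszul cochain. -/
noncomputable def toCochain (e : M ≃ₗ[ℂ] ℂ) {n : ℕ} (f : ResTerm R M n →ₗ[Alg R] Alg R) :
    dualPart R n →ₗ[ℂ] Alg R where
  toFun w := f (1 ⊗ₜ (w ⊗ₜ e.symm 1))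
  map_add' v w := by rw [TensorProduct.add_tmul, TensorProduct.tmul_add, map_add]
  map_smul' c w := by
    rw [← TensorProduct.smul_tmul', TensorProduct.tmul_smul, LinearMap.map_smul_of_tower]
    rfl

/-- A Koszul cochain, as a linear form on the Koszul resolution of a one-dimensional module. -/
noncomputable def ofCochain (e : M ≃ₗ[ℂ] ℂ) {n : ℕ} (ψ : dualPart R n →ₗ[ℂ] Alg R) :
    ResTerm R M n →ₗ[Alg R] Alg R :=
  TensorProduct.AlgebraTensorModule.lift (LinearMap.toSpanSingleton (Alg R)
    (dualPart R n ⊗[ℂ] M →ₗ[ℂ] Alg R) (TensorProduct.lift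
      ((LinearMap.lsmul ℂ (Alg R)).flip ∘ₗ ψ) ∘ₗ
        TensorProduct.map LinearMap.id e.toLinearMap))

theorem ofCochain_tmul (e : M ≃ₗ[ℂ] ℂ) {n : ℕ} (ψ : dualPart R n →ₗ[ℂ] Alg R) (a : Alg R)
    (w : dualPart R n) (m : M) : ofCochain e ψ (a ⊗ₜ (w ⊗ₜ m)) = a * e m • ψ w := rfl

theorem toCochain_ofCochain (e : M ≃ₗ[ℂ] ℂ) {n : ℕ} (ψ : dualPart R n →ₗ[ℂ] Alg R) :
    toCochain e (ofCochain e ψ) = ψ := by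
  refine LinearMap.ext fun w => ?_
  change ofCochain e ψ (1 ⊗ₜ (w ⊗ₜ e.symm 1)) = ψ w
  rw [ofCochain_tmul, one_mul, e.apply_symm_apply, one_smul]

theorem toCochain_injective (e : M ≃ₗ[ℂ] ℂ) {n : ℕ} :
    Function.Injective (toCochain (R := R) e (n := n)) := by
  intro f g h
  refine LinearMap.ext fun z => ?_
  induction z using resTerm_induction with
  | h0 => rw [map_zero, map_zero]
  | hadd x y hx hy => rw [map_add, map_add, hx, hy]
  | h a w m =>
    have h1 : (a ⊗ₜ (w ⊗ₜ m) : ResTerm R M n) = a • (1 ⊗ₜ ((e m • w) ⊗ₜ e.symm 1)) := by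
      rw [TensorProduct.smul_tmul, ← map_smul, smul_eq_mul, mul_one, e.symm_apply_apply,
        TensorProduct.smul_tmul', smul_eq_mul, mul_one]
    rw [h1, map_smul, map_smul]
    exact congrArg (a • ·) (LinearMap.congr_fun h (e m • w))

/-- When the generators act by 0 the right part of the differential disappears. -/
theorem toCochain_comp_resDiff (e : M ≃ₗ[ℂ] ℂ) (hM : ∀ i (m : M), gen R i • m = 0) {n : ℕ}
    (f : ResTerm R M n →ₗ[Alg R] Alg R) :
    toCochain e (f ∘ₗ resDiff R M n) = coboundary R n (toCochain e f) := by
  refine LinearMap.ext fun w => ?_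
  change f (resDiff R M n (1 ⊗ₜ (w ⊗ₜ e.symm 1))) = _
  rw [coboundary_apply, resDiff_apply, rightDiff_tmul, leftDiff_tmul]
  simp only [hM, TensorProduct.tmul_zero, Finset.sum_const_zero, smul_zero, add_zero, one_mul,
    map_sum]
  refine Finset.sum_congr rfl fun i _ => ?_
  change _ = gen R i • f _
  rw [← map_smul, TensorProduct.smul_tmul', smul_eq_mul, mul_one]

end Cochains

open scoped ModuleCat

variable (R) in
/-- The Koszul complex of a left module. -/
noncomputable def moduleComplex (M : ModuleCat.{0} (Alg R)) :
    ChainComplex (ModuleCat.{0} (Alg R)) ℕ :=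
  ChainComplex.of (fun n => ModuleCat.of (Alg R) (ResTerm R M n))
    (fun n => ModuleCat.ofHom (resDiff R M n))
    (fun _ => ModuleCat.hom_ext (LinearMap.ext fun z => resDiff_resDiff z))

theorem moduleComplex_d (M : ModuleCat.{0} (Alg R)) (n : ℕ) :
    (moduleComplex R M).d (n + 1) n = ModuleCat.ofHom (resDiff R M n) :=
  ChainComplex.of_d (fun n => ModuleCat.of (Alg R) (ResTerm R M n))
    (fun n => ModuleCat.ofHom (resDiff R M n)) n

theorem moduleComplex_exactAt_succ (hR : IsKoszul R) (M : ModuleCat.{0} (Alg R)) (n : ℕ) :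
    (moduleComplex R M).ExactAt (n + 1) := by
  rw [HomologicalComplex.exactAt_iff' _ (n + 1 + 1) (n + 1) n (by simp) (by simp),
    ShortComplex.moduleCat_exact_iff]
  intro x hx
  change ((moduleComplex R M).d (n + 1) n).hom x = 0 at hx
  rw [moduleComplex_d] at hx
  obtain ⟨y, hy⟩ := exists_resDiff_eq hR hx
  refine ⟨y, ?_⟩
  change ((moduleComplex R M).d (n + 1 + 1) (n + 1)).hom y = x
  rw [moduleComplex_d]
  exact hy

instance projective_moduleComplex_X (M : ModuleCat.{0} (Alg R)) (n : ℕ) :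
    Projective ((moduleComplex R M).X n) := by
  have : Module.Free (Alg R) (ResTerm R M n) := inferInstance
  exact (IsProjective.iff_projective (R := Alg R) (ResTerm R M n)).1 inferInstance

/-- The Koszul resolution of a left module over a Koszul algebra. -/
noncomputable def koszulResolution (hR : IsKoszul R) (M : ModuleCat.{0} (Alg R)) :
    ProjectiveResolution M where
  complex := moduleComplex R M
  π := (ChainComplex.toSingle₀Equiv _ _).symm ⟨ModuleCat.ofHom (resAug R M), by
    rw [moduleComplex_d]
    exact ModuleCat.hom_ext (LinearMap.ext fun z => resAug_resDiff z)⟩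
  quasiIso := ⟨fun n => by
    cases n
    · rw [ChainComplex.quasiIsoAt₀_iff, ShortComplex.quasiIso_iff_of_zeros']
      · refine (ShortComplex.exact_and_epi_g_iff_of_iso (S₂ := ShortComplex.mk
          (ModuleCat.ofHom (resDiff R M 0)) (ModuleCat.ofHom (resAug R M))
          (ModuleCat.hom_ext (LinearMap.ext fun z => resAug_resDiff z))) ?_).2 ⟨?_, ?_⟩
        · exact ShortComplex.isoMk (Iso.refl _) (Iso.refl _) (Iso.refl _)
            (by simp [moduleComplex_d]; rfl) (by simp; rfl)
        · rw [ShortComplex.moduleCat_exact_iff]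
          exact fun x hx => exists_resDiff_zero_eq hx
        · exact (ModuleCat.epi_iff_surjective _).2 resAug_surjective
      all_goals rfl
    · rw [quasiIsoAt_iff_exactAt']
      · apply moduleComplex_exactAt_succ hR
      · apply ChainComplex.exactAt_succ_single_obj⟩

end Quadratic

/-! ### Ext groups, the Gorenstein property, dimensions and growth. -/

namespace Quadratic

variable {ι : Type} [Fintype ι] [DecidableEq ι] {R : Submodule ℂ (ι × ι → ℂ)}

open scoped ModuleCat

theorem hasProjectiveDimensionLT_of_subsingleton (hR : IsKoszul R) {d : ℕ}
    (hd : ∀ n, d ≤ n → Subsingleton (dualPart R n)) (M : ModuleCat.{0} (Alg R)) :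
    HasProjectiveDimensionLT M d := by
  refine HasProjectiveDimensionLT.mk fun i hi Y x => ?_
  obtain ⟨f, hf, rfl⟩ := (koszulResolution hR M).extMk_surjective x (i + 1) rfl
  have h : f = 0 := by
    have := hd i hi
    have h1 : Subsingleton (ResTerm R M i) := ⟨fun x y => by
      have h0 : ∀ z : ResTerm R M i, z = 0 := fun z => by
        induction z using resTerm_induction with
        | h0 => rfl
        | hadd x y hx hy => rw [hx, hy, add_zero]
        | h a w m =>
          rw [Subsingleton.elim w 0, TensorProduct.zero_tmul, TensorProduct.tmul_zero]
      rw [h0 x, h0 y]⟩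
    refine ModuleCat.hom_ext (LinearMap.ext fun z => ?_)
    have hz : z = 0 := h1.elim (α := ResTerm R M i) z 0
    rw [hz, map_zero, map_zero]
  subst h
  exact (koszulResolution hR M).extMk_zero _ _

variable (R) in
/-- The underlying space of the trivial module. -/
noncomputable def trivialModuleEquiv : trivialModule R ≃ₗ[ℂ] ℂ where
  toFun z := z
  invFun z := z
  left_inv _ := rfl
  right_inv _ := rfl
  map_add' _ _ := rfl
  map_smul' c z := by
    change augmentation R (algebraMap ℂ (Alg R) c) * (show ℂ from z) = c * (show ℂ from z)
    rw [(augmentation R).commutes]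
    rfl

theorem gen_smul_trivialModule (i : ι) (z : trivialModule R) : gen R i • z = 0 := by
  change augmentation R (gen R i) * (show ℂ from z) = 0
  rw [augmentation_gen, zero_mul]

section

variable (hR : IsKoszul R)

/-- The cochain on the Koszul resolution of the trivial module given by a Koszul cochain. -/
noncomputable def cochainHom {n : ℕ} (φ : dualPart R n →ₗ[ℂ] Alg R) :
    (koszulResolution hR (trivialModule R)).complex.X n ⟶ regularModule R :=
  ModuleCat.ofHom (ofCochain (M := trivialModule R) (trivialModuleEquiv R) φ)

/-- The Koszul cochain given by a cochain on the Koszul resolution of the trivial module. -/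
noncomputable def homCochain {n : ℕ}
    (f : (koszulResolution hR (trivialModule R)).complex.X n ⟶ regularModule R) :
    dualPart R n →ₗ[ℂ] Alg R :=
  toCochain (M := trivialModule R) (trivialModuleEquiv R) (ModuleCat.Hom.hom f)

theorem homCochain_cochainHom {n : ℕ} (φ : dualPart R n →ₗ[ℂ] Alg R) :
    homCochain hR (cochainHom hR φ) = φ :=
  toCochain_ofCochain _ _

theorem homCochain_injective {n : ℕ} : Function.Injective (homCochain hR (n := n)) :=
  fun _ _ h => ModuleCat.hom_ext (toCochain_injective _ h)

theorem homCochain_zero {n : ℕ} : homCochain hR (n := n) 0 = 0 := rfl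

theorem homCochain_d_comp {n : ℕ}
    (f : (koszulResolution hR (trivialModule R)).complex.X n ⟶ regularModule R) :
    homCochain hR ((koszulResolution hR (trivialModule R)).complex.d (n + 1) n ≫ f) =
      coboundary R n (homCochain hR f) := by
  have h : (koszulResolution hR (trivialModule R)).complex.d (n + 1) n =
    ModuleCat.ofHom (resDiff R (trivialModule R) n) := moduleComplex_d _ _
  rw [h]
  exact toCochain_comp_resDiff _ gen_smul_trivialModule _

theorem d_comp_eq_zero_iff {n : ℕ}
    (f : (koszulResolution hR (trivialModule R)).complex.X n ⟶ regularModule R) :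
    (koszulResolution hR (trivialModule R)).complex.d (n + 1) n ≫ f = 0 ↔
      coboundary R n (homCochain hR f) = 0 := by
  rw [← homCochain_d_comp, ← (homCochain_injective hR).eq_iff, homCochain_zero]

theorem homCochain_sub {n : ℕ}
    (f g : (koszulResolution hR (trivialModule R)).complex.X n ⟶ regularModule R) :
    homCochain hR (f - g) = homCochain hR f - homCochain hR g := rfl

theorem homCochain_comp_rightMulHom {n : ℕ}
    (f : (koszulResolution hR (trivialModule R)).complex.X n ⟶ regularModule R) (a : Alg R)
    (w : dualPart R n) :
    homCochain hR (f ≫ rightMulHom R a) w = homCochain hR f w * a := rfl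

theorem homCochain_comp_smul {n : ℕ}
    (f : (koszulResolution hR (trivialModule R)).complex.X n ⟶ regularModule R) (c : ℂ)
    (w : dualPart R n) :
    homCochain hR (f ≫ (c • 𝟙 (regularModule R))) w = c • homCochain hR f w :=
  (Algebra.smul_def c (homCochain hR f w)).symm

end

/-- In degree 0 there are no coboundaries: the resolution, as a cochain complex, vanishes in degree
1. -/
theorem eq_zero_of_extMk_eq_zero {C : Type*} [Category C] [Abelian C] [HasExt C]
    {X Y : C} (P : ProjectiveResolution X) (f : P.complex.X 0 ⟶ Y)
    (hf : P.complex.d (0 + 1) 0 ≫ f = 0) (h : P.extMk f (0 + 1) rfl hf = 0) : f = 0 := by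
  rw [← P.extEquivCohomologyClass.apply_eq_iff_eq,
    ProjectiveResolution.extEquivCohomologyClass_extMk,
    ProjectiveResolution.extEquivCohomologyClass_zero,
    CochainComplex.HomComplex.CohomologyClass.mk_eq_zero_iff,
    CochainComplex.HomComplex.Cocycle.toSingleMk_mem_coboundaries_iff _ _ _ _ _ 1 (by simp)] at h
  obtain ⟨g, hg⟩ := h
  have h0 : Limits.IsZero (P.cochainComplex.X 1) :=
    CochainComplex.isZero_of_isStrictlyLE _ 0 _
  rw [h0.eq_of_src g 0, Limits.comp_zero] at hg
  rw [← cancel_epi (P.cochainComplexXIso (-(0 : ℕ)) 0 rfl).hom, ← hg, Limits.comp_zero]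

namespace Twist

variable {L L' : Finset ι} {T : Twist L} {T' : Twist L'}

theorem Compatible.extMk_eq_zero (hR : T.Compatible R) (hR' : T'.Compatible R) (h : L' = Lᶜ)
    (hK : IsKoszul R) {n : ℕ}
    (f : (koszulResolution hK (trivialModule R)).complex.X n ⟶ regularModule R)
    (hf : (koszulResolution hK (trivialModule R)).complex.d (n + 1) n ≫ f = 0)
    (hc : Fintype.card ι ≠ n ∨ ∀ w, augmentation R (homCochain hK f w) = 0) :
    (koszulResolution hK (trivialModule R)).extMk f (n + 1) rfl hf = 0 := by
  have hφ := (d_comp_eq_zero_iff hK f).1 hf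
  cases n with
  | zero =>
    obtain rfl : f = 0 := homCochain_injective hK (hR.eq_zero_of_coboundary_zero hR' h hφ hc)
    exact ProjectiveResolution.extMk_zero _ _ _
  | succ n =>
    obtain ⟨ψ, hψ⟩ := hR.exists_coboundary_eq hR' h hφ hc
    refine (ProjectiveResolution.extMk_eq_zero_iff _ f _ rfl hf n rfl).2
      ⟨cochainHom hK ψ, homCochain_injective hK ?_⟩
    rw [homCochain_d_comp, homCochain_cochainHom, hψ]

end Twist

/-- Every term of a coboundary starts with a generator, so coboundaries take values in the
augmentation ideal. This detects the nonzero top class. -/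
theorem augmentation_homCochain_of_extMk_eq_zero (hK : IsKoszul R) {n : ℕ}
    (f : (koszulResolution hK (trivialModule R)).complex.X n ⟶ regularModule R)
    (hf : (koszulResolution hK (trivialModule R)).complex.d (n + 1) n ≫ f = 0)
    (h0 : (koszulResolution hK (trivialModule R)).extMk f (n + 1) rfl hf = 0) (w : dualPart R n) :
    augmentation R (homCochain hK f w) = 0 := by
  cases n with
  | zero =>
    obtain rfl := eq_zero_of_extMk_eq_zero _ f hf h0
    exact map_zero _
  | succ n =>
    obtain ⟨g, rfl⟩ := (ProjectiveResolution.extMk_eq_zero_iff _ f _ rfl hf n rfl).1 h0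
    rw [homCochain_d_comp, coboundary_apply, map_sum]
    exact Finset.sum_eq_zero fun i _ => by rw [map_mul, augmentation_gen, zero_mul]

namespace Twist

variable {L L' : Finset ι} {T : Twist L} {T' : Twist L'}

/-- A cocycle with values in the augmentation ideal is a coboundary, even in the top degree; hence a
class is determined by the augmentation of a representing cochain. -/
theorem Compatible.extMk_eq_extMk (hR : T.Compatible R) (hR' : T'.Compatible R) (h : L' = Lᶜ)
    (hK : IsKoszul R) {n : ℕ}
    (f g : (koszulResolution hK (trivialModule R)).complex.X n ⟶ regularModule R)
    (hf : (koszulResolution hK (trivialModule R)).complex.d (n + 1) n ≫ f = 0)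
    (hg : (koszulResolution hK (trivialModule R)).complex.d (n + 1) n ≫ g = 0)
    (hc : ∀ w, augmentation R (homCochain hK f w) = augmentation R (homCochain hK g w)) :
    (koszulResolution hK (trivialModule R)).extMk f (n + 1) rfl hf =
      (koszulResolution hK (trivialModule R)).extMk g (n + 1) rfl hg := by
  rw [← sub_eq_zero, ProjectiveResolution.sub_extMk]
  refine hR.extMk_eq_zero hR' h hK _ _ (.inr fun w => ?_)
  rw [homCochain_sub, LinearMap.sub_apply, map_sub, hc, sub_self]

theorem Compatible.isGorenstein (hR : T.Compatible R) (hR' : T'.Compatible R) (h : L' = Lᶜ) :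
    IsGorenstein R (Fintype.card ι) := by
  have hK := hR.isKoszul hR' h
  refine ⟨fun n hn => ⟨fun x y => ?_⟩, ?_, fun a x => ?_⟩
  · obtain ⟨f, hf, rfl⟩ := (koszulResolution hK (trivialModule R)).extMk_surjective x (n + 1) rfl
    obtain ⟨g, hg, rfl⟩ := (koszulResolution hK (trivialModule R)).extMk_surjective y (n + 1) rfl
    rw [hR.extMk_eq_zero hR' h hK f hf (.inl hn.symm), hR.extMk_eq_zero hR' h hK g hg (.inl hn.symm)]
  · have h1 : Module.finrank ℂ (dualPart R (Fintype.card ι)) = 1 := by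
      rw [hR.finrank_dualPart, Nat.choose_self]
    obtain ⟨b⟩ : Nonempty (dualPart R (Fintype.card ι) ≃ₗ[ℂ] ℂ) :=
      ⟨LinearEquiv.ofFinrankEq _ _ (by rw [h1, Module.finrank_self])⟩
    -- The generating class is a scalar-valued linear form on the one-dimensional top space; it is a
    -- cocycle because the next space is zero.
    let φ : dualPart R (Fintype.card ι) →ₗ[ℂ] Alg R := Algebra.linearMap ℂ (Alg R) ∘ₗ b.toLinearMap
    have hε : ∀ w, augmentation R (φ w) = b w := fun w => (augmentation R).commutes (b w)
    have hφ : coboundary R _ φ = 0 := by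
      have := hR.subsingleton_dualPart (Nat.lt_succ_self (Fintype.card ι))
      exact LinearMap.ext fun w => by rw [Subsingleton.elim w 0, map_zero, map_zero]
    have hd := (d_comp_eq_zero_iff hK (cochainHom hK φ)).2
      (by rw [homCochain_cochainHom, hφ])
    refine finrank_eq_one_iff'.2
      ⟨(koszulResolution hK (trivialModule R)).extMk (cochainHom hK φ) _ rfl hd, ?_, fun x => ?_⟩
    · intro h0
      have h2 := augmentation_homCochain_of_extMk_eq_zero hK _ hd h0 (b.symm 1)
      rw [homCochain_cochainHom, hε, b.apply_symm_apply] at h2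
      exact one_ne_zero h2
    · obtain ⟨f, hf, rfl⟩ := (koszulResolution hK (trivialModule R)).extMk_surjective x _ rfl
      refine ⟨augmentation R (homCochain hK f (b.symm 1)), ?_⟩
      rw [Abelian.Ext.smul_eq_comp_mk₀, ProjectiveResolution.extMk_comp_mk₀]
      refine hR.extMk_eq_extMk hR' h hK _ _ _ _ fun w => ?_
      have hw : w = b w • b.symm 1 := by
        rw [← map_smul, smul_eq_mul, mul_one, b.symm_apply_apply]
      rw [homCochain_comp_smul, homCochain_cochainHom, map_smul, hε]
      conv_rhs => rw [hw, map_smul, map_smul]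
      rw [smul_eq_mul, smul_eq_mul, mul_comm]
  · obtain ⟨f, hf, rfl⟩ := (koszulResolution hK (trivialModule R)).extMk_surjective x _ rfl
    rw [Abelian.Ext.smul_eq_comp_mk₀, ProjectiveResolution.extMk_comp_mk₀,
      ProjectiveResolution.extMk_comp_mk₀]
    refine hR.extMk_eq_extMk hR' h hK _ _ _ _ fun w => ?_
    rw [homCochain_comp_rightMulHom, homCochain_comp_smul, map_mul, map_smul, smul_eq_mul, mul_comm]

theorem Compatible.projectiveDimension_le (hR : T.Compatible R) (hR' : T'.Compatible R)
    (h : L' = Lᶜ) (M : ModuleCat.{0} (Alg R)) :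
    projectiveDimension M ≤ (Fintype.card ι : WithBot ℕ∞) := by
  refine (projectiveDimension_le_iff M _).2
    (hasProjectiveDimensionLT_of_subsingleton (hR.isKoszul hR' h) (fun n hn => ?_) M)
  exact hR.subsingleton_dualPart hn

/-- A smaller projective dimension would kill the top Ext group into the algebra, which is
one-dimensional. -/
theorem Compatible.projectiveDimension_trivialModule (hR : T.Compatible R)
    (hR' : T'.Compatible R) (h : L' = Lᶜ) :
    projectiveDimension (trivialModule R) = (Fintype.card ι : WithBot ℕ∞) := by
  refine le_antisymm (hR.projectiveDimension_le hR' h _)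
    ((projectiveDimension_ge_iff _ _).2 fun hlt => ?_)
  have h0 := HasProjectiveDimensionLT.subsingleton (trivialModule R) (Fintype.card ι)
    (Fintype.card ι) le_rfl (regularModule R)
  have h1 := (hR.isGorenstein hR' h).2.1
  rw [Module.finrank_zero_of_subsingleton] at h1
  exact zero_ne_one h1

theorem Compatible.globalDimension (hR : T.Compatible R) (hR' : T'.Compatible R) (h : L' = Lᶜ) :
    globalDimension (Alg R) = (Fintype.card ι : WithBot ℕ∞) := by
  refine le_antisymm (iSup_le fun M => hR.projectiveDimension_le hR' h M) ?_
  rw [← hR.projectiveDimension_trivialModule hR' h]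
  exact le_iSup (fun M : ModuleCat.{0} (Alg R) => projectiveDimension M) (trivialModule R)

theorem Compatible.hilbertSeries (hR : T.Compatible R) :
    hilbertSeries R = ((1 - PowerSeries.X) ^ Fintype.card ι : PowerSeries ℚ)⁻¹ := by
  rw [← mk_multichoose]
  exact congrArg PowerSeries.mk (funext fun n => by rw [hR.finrank_degreePart])

theorem Compatible.hilbertSeries_orthogonal (hR : T.Compatible R) :
    Quadratic.hilbertSeries (orthogonal R) = (1 + PowerSeries.X : PowerSeries ℚ) ^ Fintype.card ι := by
  rw [← mk_choose]
  exact congrArg PowerSeries.mk (funext fun n => by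
    rw [finrank_degreePart_orthogonal, hR.finrank_dualPart])

theorem Compatible.hasPolynomialGrowth (hR : T.Compatible R) : HasPolynomialGrowth R := by
  -- With d letters the dimension is at most (n + 1)^d ≤ (2 n)^d for n ≥ 1; the exponent N - 1 = d
  -- gives N = d + 1.
  refine ⟨2 ^ Fintype.card ι, by positivity, Fintype.card ι + 1, fun n hn => ?_⟩
  rw [hR.finrank_degreePart, Nat.cast_add, Nat.cast_one, add_sub_cancel_right, zpow_natCast,
    ← mul_pow]
  calc ((Fintype.card ι).multichoose n : ℝ) ≤ ((n + 1) ^ Fintype.card ι : ℕ) :=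
        Nat.cast_le.2 (multichoose_le_pow _ _)
    _ = ((n : ℝ) + 1) ^ Fintype.card ι := by push_cast; rfl
    _ ≤ (2 * (n : ℝ)) ^ Fintype.card ι := by
        have : (1 : ℝ) ≤ n := by exact_mod_cast hn
        gcongr
        linarith

end Twist

end Quadratic

theorem theorem3p2 (N₁ N₂ : ℕ) (R : Fin N₁ → Fin N₂ → Fin N₂ → Fin N₁ → ℂ)
    (hreal : NCProduct.RealCondition R)
    (hyb1 : NCProduct.YangBaxterOne R)
    (hyb2 : NCProduct.YangBaxterTwo R) :
    Quadratic.IsKoszul (NCProduct.relations R) ∧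
    Quadratic.globalDimension (Quadratic.Alg (NCProduct.relations R)) = ((N₁ + N₂ : ℕ) : WithBot ℕ∞) ∧
    projectiveDimension (Quadratic.trivialModule (NCProduct.relations R)) =
      ((N₁ + N₂ : ℕ) : WithBot ℕ∞) ∧
    Quadratic.IsGorenstein (NCProduct.relations R) (N₁ + N₂) ∧
    Quadratic.HasPolynomialGrowth (NCProduct.relations R) ∧
    Quadratic.hilbertSeries (NCProduct.relations R) =
      ((1 - PowerSeries.X) ^ (N₁ + N₂) : PowerSeries ℚ)⁻¹ ∧
    Quadratic.hilbertSeries (Quadratic.orthogonal (NCProduct.relations R)) =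
      (1 + PowerSeries.X : PowerSeries ℚ) ^ (N₁ + N₂) := by
  obtain ⟨T, hT⟩ := NCProduct.exists_compatible_firstKind hreal hyb1 hyb2
  obtain ⟨T', hT'⟩ := NCProduct.exists_compatible_firstKind_compl hreal hyb1 hyb2
  have hcard : Fintype.card (Fin N₁ ⊕ Fin N₂) = N₁ + N₂ := by
    rw [Fintype.card_sum, Fintype.card_fin, Fintype.card_fin]
  rw [← hcard]
  exact ⟨hT.isKoszul hT' rfl, hT.globalDimension hT' rfl,
    hT.projectiveDimension_trivialModule hT' rfl, hT.isGorenstein hT' rfl,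
    hT.hasPolynomialGrowth, hT.hilbertSeries, hT.hilbertSeries_orthogonal⟩
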